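/- Let $\mathscr U$ be a separable metrizable space with its Borel $\sigma$-algebra and a $\sigma$-finite Borel measure $\mu$, let $\mathscr Y$ be a measurable space with a $\sigma$-finite measure written $dy$, and let $\Theta$ be a set. For every $\theta\in\Theta$ let $(y,u)\mapsto p(y\mid\theta,u)\ge 0$ be jointly measurable with $\int p(y\mid\theta,u)\,dy=1$ for all $u$. Let $\mathbb F$ be the set of probability densities on $\mathscr U$ with respect to $\mu$, and $\overline{\mathbb F}$ the closure, in the weak topology on probability measures on $\mathscr U$, of the set of probability measures with density in $\mathbb F$. For $f\in\overline{\mathbb F}$ put $m_{f,\theta}(y)=\int p(y\mid\theta,u)\,f(du)$ (where $f(du)=f(u)\,d\mu(u)$ if $f\in\mathbb F$), and let $K(g,h)=\int g\log(g/h)\in[0,\infty]$ denote the Kullback–Leibler divergence of two densities with respect to the same measure ($dy$ or $\mu$). Let $Y_1,Y_2,\dots$ be random elements of $\mathscr Y$ and $w_1,w_2,\ldots\in(0,1)$. For each $\theta$ let $f_{0,\theta}\in\mathbb F$ be strictly positive $\mu$-almost everywhere, and for $i\ge1$ define $$f_{i,\theta}(u)=(1-w_i)f_{i-1,\theta}(u)+w_i\,\frac{p(Y_i\mid\theta,u)f_{i-1,\theta}(u)}{\int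 p(Y_i\mid\theta,u')f_{i-1,\theta}(u')\,d\mu(u')},\qquad m_{i,\theta}(y)=\int p(y\mid\theta,u)f_{i,\theta}(u)\,d\mu(u),$$ where $m_{0,\theta}$ is defined from $f_{0,\theta}$ in the same way. Put $$K_n(\theta)=\frac1n\sum_{i=1}^n\log\frac{m(Y_i)}{m_{i-1,\theta}(Y_i)},\qquad K^\star(\theta)=\inf\{K(m,m_{f,\theta}):f\in\overline{\mathbb F}\},\qquad a_n=\sum_{i=1}^n w_i .$$ Assume: 1. $Y_1,Y_2,\dots$ are independent with common density $m$ with respect to $dy$, and $K(m,m_{f,\theta})<\infty$ for all $\theta\in\Theta$, $f\in\overline{\mathbb F}$. 2. $\sum_n w_n=\infty$ and $\sum_n w_n^2<\infty$. 3. $\overline{\mathbb F}$ is compact in the weak topology. 4. For all $(y,\theta)$ the map $u\mapsto p(y\mid\theta,u)$ is bounded and continuous. 5. For all $\theta_1,\theta_2$ there is $A<\infty$ with $\sup_{u_1,u_2}\int\{p(y\mid\theta_1,u_1)/p(y\mid\theta_2,u_2)\}^2m(y)\,dy\le A$. 6. For every $\theta$ there is $B<\infty$ such that $\int\{\log(m(y)/m_{f,\theta}(y))\}^2m(y)\,dy\le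 B$ whenever $f\in\overline{\mathbb F}$ attains the infimum $K^\star(\theta)$. Then for each fixed $\theta\in\Theta$, $K_n(\theta)\to K^\star(\theta)$ almost surely as $n\to\infty$. If in addition the infimum $K^\star(\theta)$ is attained at some density $f\in\mathbb F$ (for example, at one in the interior of $\mathbb F$) with $K(f,f_{0,\theta})<\infty$, the sequence $(w_n)$ is nonincreasing, and $\sum_n a_nw_n^2<\infty$, then $K_n(\theta)-K^\star(\theta)=O(a_n^{-1})$ almost surely. -/

import Mathlib

open Filter Topology MeasureTheory ProbabilityTheory InformationTheory Asymptotics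
open scoped ENNReal NNReal

noncomputable section

namespace PredRec

variable {𝒰 𝒴 : Type*} [MeasurableSpace 𝒰] [MeasurableSpace 𝒴]

/-- The set of (real-valued) probability densities with respect to `μ`. -/
def Densities {α : Type*} [MeasurableSpace α] (μ : Measure α) : Set (α → ℝ) :=
  {f | Measurable f ∧ (∀ x, 0 ≤ f x) ∧ ∫⁻ x, ENNReal.ofReal (f x) ∂μ = 1}

/-- The measure with density `f` with respect to `μ`. -/
def ofDensity {α : Type*} [MeasurableSpace α] (μ : Measure α) (f : α → ℝ) : Measure α :=
  μ.withDensity fun x => ENNReal.ofReal (f x)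

/-- The weak closure of the set of densities with respect to `μ`, each density being identified
with the probability measure it defines; the topology on `ProbabilityMeasure 𝒰` is that of weak
convergence. -/
def closedMixing [TopologicalSpace 𝒰] [OpensMeasurableSpace 𝒰] (μ : Measure 𝒰) :
    Set (ProbabilityMeasure 𝒰) :=
  closure {F | ∃ f ∈ Densities μ, (F : Measure 𝒰) = ofDensity μ f}

/-- The mixture `y ↦ ∫ k(y, u) dF(u)` of the kernel `k` with mixing measure `F`. -/
def mixture (k : 𝒴 → 𝒰 → ℝ) (F : Measure 𝒰) (y : 𝒴) : ℝ :=
  ∫ u, k y u ∂F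

/-- The Kullback-Leibler divergence `K(m, m') = ∫ log (m / m') m dν` of two densities with
respect to `ν`, with values in `[0, ∞]`. -/
def KL (ν : Measure 𝒴) (m m' : 𝒴 → ℝ) : ℝ≥0∞ :=
  klDiv (ofDensity ν m) (ofDensity ν m')

/-- The smallest Kullback-Leibler divergence from `m` to a mixture of the kernel `k` with mixing
measure in the weak closure of the densities with respect to `μ`. -/
def KLopt [TopologicalSpace 𝒰] [OpensMeasurableSpace 𝒰] (μ : Measure 𝒰) (ν : Measure 𝒴)
    (m : 𝒴 → ℝ) (k : 𝒴 → 𝒰 → ℝ) : ℝ≥0∞ :=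
  ⨅ F ∈ closedMixing μ, KL ν m (mixture k (F : Measure 𝒰))

/-- Predictive recursion with kernel `k`, initial density `f₀`, weights `w` and data `y`.
Indices are shifted by one: `y i` and `w i` are the `(i+1)`-st observation and weight, and
`prDensity μ k f₀ w y i` is the estimate after `i` observations. -/
def prDensity (μ : Measure 𝒰) (k : 𝒴 → 𝒰 → ℝ) (f₀ : 𝒰 → ℝ) (w : ℕ → ℝ) (y : ℕ → 𝒴) :
    ℕ → 𝒰 → ℝ
  | 0 => f₀
  | i + 1 => fun u =>
      (1 - w i) * prDensity μ k f₀ w y i u +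
        w i * (k (y i) u * prDensity μ k f₀ w y i u /
          ∫ u', k (y i) u' * prDensity μ k f₀ w y i u' ∂μ)

/-- The predictive recursion estimate of the mixture density after `i` observations. -/
def prMixture (μ : Measure 𝒰) (k : 𝒴 → 𝒰 → ℝ) (f₀ : 𝒰 → ℝ) (w : ℕ → ℝ) (y : ℕ → 𝒴)
    (i : ℕ) (z : 𝒴) : ℝ :=
  ∫ u, k z u * prDensity μ k f₀ w y i u ∂μ

/-- The normalized predictive recursion marginal log-likelihood
`n⁻¹ ∑_{i=1}^n log (m(Y_i) / m_{i-1}(Y_i))`. -/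
def empKL (μ : Measure 𝒰) (m : 𝒴 → ℝ) (k : 𝒴 → 𝒰 → ℝ) (f₀ : 𝒰 → ℝ) (w : ℕ → ℝ)
    (y : ℕ → 𝒴) (n : ℕ) : ℝ :=
  (n : ℝ)⁻¹ * ∑ i ∈ Finset.range n, Real.log (m (y i) / prMixture μ k f₀ w y i (y i))

/-- The sum of the first `n` weights. -/
def partialSum (w : ℕ → ℝ) (n : ℕ) : ℝ := ∑ i ∈ Finset.range n, w i

end PredRec

end

namespace PredRec

/-! ### Jensen-type inequalities for `ℝ≥0∞`-valued functions. -/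

variable {𝒰 𝒴 : Type*} [MeasurableSpace 𝒰] [MeasurableSpace 𝒴]

/-! Fix `θ`, let `P` be the law with density `m`, and compare mixing measures through `relEnt G F =
∫ log (m_G / m_F) dP`. This quantity satisfies the cocycle identity `relEnt G F = relEnt G H +
relEnt H F` and is a difference of Kullback–Leibler divergences from `m`. By Jensen, the bound on
kernel ratios passes to all mixtures, `∫ (m_G / m_F)² dP ≤ A`; hence `|relEnt| ≤ A`, and every
second-order term below is uniformly controlled.

Two estimates on the recursion `F_i` carry the proof. (1) Averaging one update over a fresh
observation increases `relEnt G F_i` by at most a constant times `w_i²`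
(`integral_relEnt_update_le`), because the averaged posterior mixture satisfies `∫∫ m_post / m_F dP
dP ≥ 1`. So the excess divergence is an almost supermartingale and converges almost surely. (2) The
`Φ`-mean of `log (f_n / f_0)` telescopes. It is bounded whenever `Φ` is dominated by a multiple of
`f_0`, or has a density with finite divergence from `f_0`; yet its `i`-th increment has mean at
least `w_i relEnt Φ F_i - O(w_i²)`. Hence `∑ w_i E[relEnt Φ F_i]` is bounded above
(`sum_mul_integral_relEnt_le`). As `∑ w_i = ∞`, the limit in (1) must be the optimal value, once the
optimum over the weak closure is approximated by such `Φ`.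

Finally `K_n` splits (`ae_empKL_eq`) into an average of i.i.d. terms, an average of martingale
differences and a Cesàro mean of relative entropies. For consistency these are handled by the strong
law, Kronecker's lemma and the convergence above. For the rate, take the minimizer as reference and
use the weights `a_n / n`: they are square summable by Hardy's inequality, so both random averages
are `O(1 / a_n)`. The almost supermartingale multiplied by `a_n`, together with (2), bounds the
Cesàro mean. -/

theorem two_mul_inv_le_inv_add (c x : ℝ≥0∞) (hc0 : c ≠ 0) (hc : c ≠ ∞) :
    2 * c⁻¹ ≤ x⁻¹ + c⁻¹ ^ 2 * x := by
  rcases eq_or_ne x 0 with rfl | hx0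
  · simp
  rcases eq_or_ne x ∞ with rfl | hx
  · simp [ENNReal.mul_top, hc]
  lift c to ℝ≥0 using hc
  lift x to ℝ≥0 using hx
  have hc' : c ≠ 0 := by simpa using hc0
  have hx' : x ≠ 0 := by simpa using hx0
  rw [← ENNReal.coe_inv hc', ← ENNReal.coe_inv hx']
  norm_cast
  rw [← NNReal.coe_le_coe]
  push_cast
  have h1 : (0 : ℝ) < c := by positivity
  have h2 : (0 : ℝ) < x := by positivity
  -- The graph of `1 / x` lies above its tangent at `c`; the gap is an explicit square. The
  -- statement is arranged without subtraction, which would be truncated in `ℝ≥0∞`.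
  have : (x : ℝ)⁻¹ + (c : ℝ)⁻¹ ^ 2 * x - 2 * (c : ℝ)⁻¹ = (x - c) ^ 2 / (x * c ^ 2) := by
    field_simp
    ring
  have : 0 ≤ ((x : ℝ) - c) ^ 2 / (x * c ^ 2) := by positivity
  linarith

/-- Jensen's inequality for the reciprocal. -/
theorem inv_lintegral_le_lintegral_inv {F : Measure 𝒰} [IsProbabilityMeasure F] {g : 𝒰 → ℝ≥0∞}
    (hg : Measurable g) (hfin : ∫⁻ u, g u ∂F ≠ ∞) :
    (∫⁻ u, g u ∂F)⁻¹ ≤ ∫⁻ u, (g u)⁻¹ ∂F := by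
  rcases eq_or_ne (∫⁻ u, g u ∂F) 0 with h0 | h0
  · have h : g =ᵐ[F] 0 := (lintegral_eq_zero_iff hg).1 h0
    have : ∫⁻ u, (g u)⁻¹ ∂F = ∫⁻ _, ∞ ∂F := by
      refine lintegral_congr_ae ?_
      filter_upwards [h] with u hu
      simp [hu]
    rw [this]
    simp
  · set c := ∫⁻ u, g u ∂F with hc
    have h : 2 * c⁻¹ ≤ ∫⁻ u, (g u)⁻¹ ∂F + c⁻¹ := by
      calc 2 * c⁻¹ = ∫⁻ _, 2 * c⁻¹ ∂F := by simp
        _ ≤ ∫⁻ u, ((g u)⁻¹ + c⁻¹ ^ 2 * g u) ∂F :=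
            lintegral_mono fun u => two_mul_inv_le_inv_add c (g u) h0 hfin
        _ = ∫⁻ u, (g u)⁻¹ ∂F + c⁻¹ := by
            rw [lintegral_add_right _ (hg.const_mul _), lintegral_const_mul _ hg, ← hc, sq, mul_assoc,
              ENNReal.inv_mul_cancel h0 hfin, mul_one]
    rw [two_mul] at h
    exact (ENNReal.add_le_add_iff_right (ENNReal.inv_ne_top.2 h0)).1 h

theorem lintegral_sq_le_lintegral_sq {F : Measure 𝒰} [IsProbabilityMeasure F] {g : 𝒰 → ℝ≥0∞}
    (hg : Measurable g) : (∫⁻ u, g u ∂F) ^ 2 ≤ ∫⁻ u, g u ^ 2 ∂F := by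
  have hpq : Real.HolderConjugate 2 2 := Real.HolderConjugate.two_two
  have h := ENNReal.lintegral_mul_le_Lp_mul_Lq F hpq hg.aemeasurable
    (aemeasurable_const (b := (1 : ℝ≥0∞)))
  simp only [Pi.mul_apply, mul_one, ENNReal.one_rpow, lintegral_const, measure_univ,
    ENNReal.rpow_ofNat, one_pow] at h
  calc (∫⁻ u, g u ∂F) ^ 2 ≤ ((∫⁻ u, g u ^ 2 ∂F) ^ (1 / 2 : ℝ)) ^ 2 := by gcongr
    _ = _ := by
      rw [← ENNReal.rpow_two, ← ENNReal.rpow_mul]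
      norm_num

/-! ### Mixtures of a kernel: ratio moments, relative entropy and the effect of one update. -/

theorem mixture_nonneg {𝒴 : Type*} {k : 𝒴 → 𝒰 → ℝ} (hk : ∀ y u, 0 ≤ k y u) (F : Measure 𝒰) (y : 𝒴) :
    0 ≤ mixture k F y := integral_nonneg (hk y)

/-- The Kullback-Leibler type functional `∫ log (m_G / m_F) dP` comparing two mixtures. -/
noncomputable def relEnt (k : 𝒴 → 𝒰 → ℝ) (P : Measure 𝒴) (G F : Measure 𝒰) : ℝ :=
  ∫ y, Real.log (mixture k G y / mixture k F y) ∂P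

/-- The mixing measure `F` conditioned on the observation `y` of the mixture. -/
noncomputable def posterior (k : 𝒴 → 𝒰 → ℝ) (F : Measure 𝒰) (y : 𝒴) : Measure 𝒰 :=
  F.withDensity fun u => ENNReal.ofReal (k y u / mixture k F y)

/-- A nonnegative measurable kernel, bounded in its second variable, whose ratios have second
moments at most `A` under `P`, and whose mixture with respect to `F₀` does not vanish. -/
structure IsRegularKernel (k : 𝒴 → 𝒰 → ℝ) (P : Measure 𝒴) (A : ℝ≥0) (F₀ : Measure 𝒰) : Prop where
  meas : Measurable fun z : 𝒴 × 𝒰 => k z.1 z.2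
  nonneg : ∀ y u, 0 ≤ k y u
  bdd : ∀ y, ∃ C : ℝ, ∀ u, k y u ≤ C
  ratio : ∀ u v, ∫⁻ y, (ENNReal.ofReal (k y u) / ENNReal.ofReal (k y v)) ^ 2 ∂P ≤ A
  pos : ∀ᵐ y ∂P, 0 < mixture k F₀ y

/-- Apply `log x ≥ 1 - 1 / x = (x - 1) - (x - 1)² / x` at `x = 1 + w (r - 1)`. Since `r ≥ 0`, `x ≥ 1
- w ≥ η`, so the remainder is quadratic in `w` with no upper bound on `r`. -/
theorem sub_sq_div_le_log {η w r : ℝ} (hη : 0 < η) (hw : 0 ≤ w) (hwη : w ≤ 1 - η) (hr : 0 ≤ r) :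
    w * (r - 1) - w ^ 2 / η * (r ^ 2 + 1) ≤ Real.log (1 + w * (r - 1)) := by
  have hx : η ≤ 1 + w * (r - 1) := by nlinarith [mul_nonneg hw hr]
  have hpos : 0 < 1 + w * (r - 1) := hη.trans_le hx
  refine le_trans ?_ (Real.one_sub_inv_le_log_of_pos hpos)
  have e : 1 - (1 + w * (r - 1))⁻¹ = w * (r - 1) - (w * (r - 1)) ^ 2 / (1 + w * (r - 1)) := by
    field_simp
    ring
  rw [e]
  have h1 : (w * (r - 1)) ^ 2 / (1 + w * (r - 1)) ≤ (w * (r - 1)) ^ 2 / η := by gcongr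
  have h2 : (w * (r - 1)) ^ 2 / η ≤ w ^ 2 / η * (r ^ 2 + 1) := by
    rw [div_mul_eq_mul_div]
    gcongr
    nlinarith [mul_nonneg (sq_nonneg w) hr]
  linarith

theorem log_sq_le {x : ℝ} (hx : 0 < x) : Real.log x ^ 2 ≤ x ^ 2 + x⁻¹ ^ 2 := by
  have h1 := Real.log_le_sub_one_of_pos hx
  have h2 := Real.log_le_sub_one_of_pos (inv_pos.2 hx)
  rw [Real.log_inv] at h2
  have hx' := inv_pos.2 hx
  rcases le_total 0 (Real.log x) with h | h
  · nlinarith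
  · nlinarith

namespace IsRegularKernel

variable {k : 𝒴 → 𝒰 → ℝ} {P : Measure 𝒴} {A : ℝ≥0} {F₀ : Measure 𝒰}

theorem meas_right (hk : IsRegularKernel k P A F₀) (y : 𝒴) : Measurable (k y) :=
  hk.meas.comp measurable_prodMk_left

theorem integrable (hk : IsRegularKernel k P A F₀) (F : Measure 𝒰) [IsFiniteMeasure F] (y : 𝒴) :
    Integrable (k y) F := by
  obtain ⟨C, hC⟩ := hk.bdd y
  refine Integrable.of_bound (hk.meas_right y).aestronglyMeasurable C (ae_of_all _ fun u => ?_)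
  rw [Real.norm_of_nonneg (hk.nonneg y u)]
  exact hC u

theorem measurable_mixture (hk : IsRegularKernel k P A F₀) (F : Measure 𝒰) [SFinite F] :
    Measurable (mixture k F) :=
  (StronglyMeasurable.integral_prod_right (f := fun y u => k y u)
    hk.meas.stronglyMeasurable).measurable

theorem ofReal_mixture (hk : IsRegularKernel k P A F₀) (F : Measure 𝒰) [IsFiniteMeasure F]
    (y : 𝒴) : ENNReal.ofReal (mixture k F y) = ∫⁻ u, ENNReal.ofReal (k y u) ∂F :=
  ofReal_integral_eq_lintegral_ofReal (hk.integrable F y) (ae_of_all _ (hk.nonneg y))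

/-- Pointwise in `y`, Jensen for the reciprocal bounds `m_G / m_F` by the double average of `k y u /
k y v`, and Jensen for the square moves the square inside. Tonelli then leaves the kernel bound for
each pair `(u, v)`. -/
theorem lintegral_ratio_sq_le (hk : IsRegularKernel k P A F₀) [SFinite P] (G F : Measure 𝒰)
    [IsProbabilityMeasure G] [IsProbabilityMeasure F] :
    ∫⁻ y, (ENNReal.ofReal (mixture k G y) / ENNReal.ofReal (mixture k F y)) ^ 2 ∂P ≤ A := by
  have hm : Measurable fun z : 𝒴 × 𝒰 => ENNReal.ofReal (k z.1 z.2) := hk.meas.ennreal_ofReal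
  have hpt : ∀ y, (ENNReal.ofReal (mixture k G y) / ENNReal.ofReal (mixture k F y)) ^ 2 ≤
      ∫⁻ u, ∫⁻ v, (ENNReal.ofReal (k y u) / ENNReal.ofReal (k y v)) ^ 2 ∂F ∂G := by
    intro y
    have hmy : Measurable fun u => ENNReal.ofReal (k y u) := (hk.meas_right y).ennreal_ofReal
    have h1 : ENNReal.ofReal (mixture k G y) / ENNReal.ofReal (mixture k F y) ≤
        ∫⁻ u, ∫⁻ v, (ENNReal.ofReal (k y u) / ENNReal.ofReal (k y v)) ∂F ∂G := by
      simp only [div_eq_mul_inv]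
      calc _ ≤ ENNReal.ofReal (mixture k G y) * ∫⁻ v, (ENNReal.ofReal (k y v))⁻¹ ∂F := by
            gcongr
            rw [hk.ofReal_mixture F]
            refine inv_lintegral_le_lintegral_inv hmy ?_
            rw [← hk.ofReal_mixture F]
            exact ENNReal.ofReal_ne_top
        _ = _ := by
            rw [hk.ofReal_mixture G, ← lintegral_mul_const _ hmy]
            refine lintegral_congr fun u => ?_
            exact (lintegral_const_mul (f := fun v => (ENNReal.ofReal (k y v))⁻¹) _ hmy.inv).symm
    have hm2 : Measurable fun z : 𝒰 × 𝒰 => ENNReal.ofReal (k y z.1) / ENNReal.ofReal (k y z.2) :=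
      (hmy.comp measurable_fst).div (hmy.comp measurable_snd)
    calc _ ≤ (∫⁻ u, ∫⁻ v, (ENNReal.ofReal (k y u) / ENNReal.ofReal (k y v)) ∂F ∂G) ^ 2 := by
          gcongr
      _ ≤ ∫⁻ u, (∫⁻ v, (ENNReal.ofReal (k y u) / ENNReal.ofReal (k y v)) ∂F) ^ 2 ∂G :=
          lintegral_sq_le_lintegral_sq hm2.lintegral_prod_right'
      _ ≤ _ := lintegral_mono fun u =>
          lintegral_sq_le_lintegral_sq (hm2.comp measurable_prodMk_left)
  have hm3 : Measurable fun z : (𝒴 × 𝒰) × 𝒰 =>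
      (ENNReal.ofReal (k z.1.1 z.1.2) / ENNReal.ofReal (k z.1.1 z.2)) ^ 2 := by
    refine Measurable.pow_const (Measurable.div ?_ ?_) 2
    · exact hm.comp measurable_fst
    · exact hm.comp ((measurable_fst.comp measurable_fst).prodMk measurable_snd)
  calc _ ≤ ∫⁻ y, ∫⁻ u, ∫⁻ v, (ENNReal.ofReal (k y u) / ENNReal.ofReal (k y v)) ^ 2 ∂F ∂G ∂P :=
        lintegral_mono hpt
    _ = ∫⁻ u, ∫⁻ v, ∫⁻ y, (ENNReal.ofReal (k y u) / ENNReal.ofReal (k y v)) ^ 2 ∂P ∂F ∂G := by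
        rw [lintegral_lintegral_swap]
        · refine lintegral_congr fun u => ?_
          rw [lintegral_lintegral_swap]
          exact (hm3.comp (f := fun z : 𝒴 × 𝒰 => ((z.1, u), z.2)) (by fun_prop)).aemeasurable
        · exact hm3.lintegral_prod_right'.aemeasurable
    _ ≤ ∫⁻ _, ∫⁻ _, A ∂F ∂G :=
        lintegral_mono fun u => lintegral_mono fun v => hk.ratio u v
    _ = A := by simp

/-- Where `m_F = 0 < m_{F₀}` the extended ratio is `∞`, which a finite second moment allows only on
a null set. -/
theorem mixture_pos (hk : IsRegularKernel k P A F₀) [SFinite P] [IsProbabilityMeasure F₀]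
    (F : Measure 𝒰) [IsProbabilityMeasure F] : ∀ᵐ y ∂P, 0 < mixture k F y := by
  have h := hk.lintegral_ratio_sq_le F₀ F
  have hm : Measurable fun y =>
      (ENNReal.ofReal (mixture k F₀ y) / ENNReal.ofReal (mixture k F y)) ^ 2 :=
    ((hk.measurable_mixture F₀).ennreal_ofReal.div
      (hk.measurable_mixture F).ennreal_ofReal).pow_const 2
  filter_upwards [ae_lt_top hm (h.trans_lt ENNReal.coe_lt_top).ne, hk.pos] with y hy hy0
  by_contra hneg
  have h0 : ENNReal.ofReal (mixture k F y) = 0 := ENNReal.ofReal_eq_zero.2 (not_lt.1 hneg)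
  have h1 : ENNReal.ofReal (mixture k F₀ y) ≠ 0 := by simpa using hy0
  rw [h0, ENNReal.div_zero h1] at hy
  simp at hy

theorem lintegral_ofReal_ratio_sq_le (hk : IsRegularKernel k P A F₀) [SFinite P]
    [IsProbabilityMeasure F₀] (G F : Measure 𝒰) [IsProbabilityMeasure G] [IsProbabilityMeasure F] :
    ∫⁻ y, ENNReal.ofReal ((mixture k G y / mixture k F y) ^ 2) ∂P ≤ A := by
  -- Real division sends `a / 0` to `0` and extended division to `∞` for `a > 0`; the two agree
  -- almost everywhere by `mixture_pos`.
  refine le_trans (le_of_eq (lintegral_congr_ae ?_)) (hk.lintegral_ratio_sq_le G F)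
  filter_upwards [hk.mixture_pos F] with y hy
  rw [ENNReal.ofReal_pow (div_nonneg (mixture_nonneg hk.nonneg G y) hy.le),
    ENNReal.ofReal_div_of_pos hy]

theorem measurable_ratio (hk : IsRegularKernel k P A F₀) (G F : Measure 𝒰) [SFinite G]
    [SFinite F] : Measurable fun y => mixture k G y / mixture k F y :=
  (hk.measurable_mixture G).div (hk.measurable_mixture F)

theorem measurable_log_ratio (hk : IsRegularKernel k P A F₀) (G F : Measure 𝒰) [SFinite G]
    [SFinite F] : Measurable fun y => Real.log (mixture k G y / mixture k F y) :=
  Real.measurable_log.comp (hk.measurable_ratio G F)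

theorem isProbabilityMeasure_posterior (hk : IsRegularKernel k P A F₀) (F : Measure 𝒰)
    [IsFiniteMeasure F] {y : 𝒴} (hy : 0 < mixture k F y) :
    IsProbabilityMeasure (posterior k F y) := by
  refine ⟨?_⟩
  have hmy : Measurable fun u => ENNReal.ofReal (k y u) := (hk.meas_right y).ennreal_ofReal
  rw [posterior, withDensity_apply _ MeasurableSet.univ, Measure.restrict_univ]
  simp_rw [ENNReal.ofReal_div_of_pos hy, div_eq_mul_inv]
  rw [lintegral_mul_const _ hmy, ← hk.ofReal_mixture F]
  exact ENNReal.mul_inv_cancel (by simpa using hy) ENNReal.ofReal_ne_top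

theorem mixture_posterior (hk : IsRegularKernel k P A F₀) (F : Measure 𝒰) (y z : 𝒴) :
    mixture k (posterior k F y) z = (∫ u, k z u * k y u ∂F) / mixture k F y := by
  have h0 := mixture_nonneg hk.nonneg F y
  rw [mixture, posterior, integral_withDensity_eq_integral_toReal_smul
    ((hk.meas_right y).div_const _).ennreal_ofReal (ae_of_all _ fun _ => ENNReal.ofReal_lt_top),
    ← integral_div]
  refine integral_congr_ae (ae_of_all _ fun u => ?_)
  simp only [smul_eq_mul]
  rw [ENNReal.toReal_ofReal (div_nonneg (hk.nonneg y u) h0)]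
  ring

variable [IsProbabilityMeasure P] [IsProbabilityMeasure F₀]

theorem integrable_ratio_sq (hk : IsRegularKernel k P A F₀) (G F : Measure 𝒰)
    [IsProbabilityMeasure G] [IsProbabilityMeasure F] :
    Integrable (fun y => (mixture k G y / mixture k F y) ^ 2) P := by
  refine ⟨((hk.measurable_ratio G F).pow_const 2).aestronglyMeasurable, ?_⟩
  rw [hasFiniteIntegral_iff_ofReal (ae_of_all _ fun y => sq_nonneg _)]
  exact (hk.lintegral_ofReal_ratio_sq_le G F).trans_lt ENNReal.coe_lt_top

theorem integral_ratio_sq_le (hk : IsRegularKernel k P A F₀) (G F : Measure 𝒰)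
    [IsProbabilityMeasure G] [IsProbabilityMeasure F] :
    ∫ y, (mixture k G y / mixture k F y) ^ 2 ∂P ≤ A := by
  rw [integral_eq_lintegral_of_nonneg_ae (ae_of_all _ fun y => sq_nonneg _)
    ((hk.measurable_ratio G F).pow_const 2).aestronglyMeasurable]
  exact ENNReal.toReal_le_coe_of_le_coe (hk.lintegral_ofReal_ratio_sq_le G F)

theorem memLp_ratio (hk : IsRegularKernel k P A F₀) (G F : Measure 𝒰)
    [IsProbabilityMeasure G] [IsProbabilityMeasure F] :
    MemLp (fun y => mixture k G y / mixture k F y) 2 P :=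
  (memLp_two_iff_integrable_sq (hk.measurable_ratio G F).aestronglyMeasurable).2
    (hk.integrable_ratio_sq G F)

theorem integrable_ratio (hk : IsRegularKernel k P A F₀) (G F : Measure 𝒰)
    [IsProbabilityMeasure G] [IsProbabilityMeasure F] :
    Integrable (fun y => mixture k G y / mixture k F y) P :=
  (hk.memLp_ratio G F).integrable (by norm_num)

theorem integral_ratio_le (hk : IsRegularKernel k P A F₀) (G F : Measure 𝒰)
    [IsProbabilityMeasure G] [IsProbabilityMeasure F] :
    ∫ y, mixture k G y / mixture k F y ∂P ≤ 1 + A := by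
  calc _ ≤ ∫ y, (1 + (mixture k G y / mixture k F y) ^ 2) ∂P :=
        integral_mono (hk.integrable_ratio G F)
          ((integrable_const _).add (hk.integrable_ratio_sq G F)) fun y => by
            simp only
            nlinarith [sq_nonneg (mixture k G y / mixture k F y - 1)]
    _ = 1 + ∫ y, (mixture k G y / mixture k F y) ^ 2 ∂P := by
        rw [integral_add (integrable_const _) (hk.integrable_ratio_sq G F)]
        simp
    _ ≤ _ := by
        gcongr
        exact hk.integral_ratio_sq_le G F

theorem log_ratio_sq_le (hk : IsRegularKernel k P A F₀) (G F : Measure 𝒰)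
    [IsProbabilityMeasure G] [IsProbabilityMeasure F] :
    ∀ᵐ y ∂P, Real.log (mixture k G y / mixture k F y) ^ 2 ≤
      (mixture k G y / mixture k F y) ^ 2 + (mixture k F y / mixture k G y) ^ 2 := by
  filter_upwards [hk.mixture_pos F, hk.mixture_pos G] with y h1 h2
  have h := log_sq_le (div_pos h2 h1)
  rwa [inv_div] at h

theorem integrable_log_ratio_sq (hk : IsRegularKernel k P A F₀) (G F : Measure 𝒰)
    [IsProbabilityMeasure G] [IsProbabilityMeasure F] :
    Integrable (fun y => Real.log (mixture k G y / mixture k F y) ^ 2) P := by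
  refine ((hk.integrable_ratio_sq G F).add (hk.integrable_ratio_sq F G)).mono'
    ((hk.measurable_log_ratio G F).pow_const 2).aestronglyMeasurable ?_
  filter_upwards [hk.log_ratio_sq_le G F] with y hy
  rw [Real.norm_of_nonneg (sq_nonneg _)]
  exact hy

theorem integral_log_ratio_sq_le (hk : IsRegularKernel k P A F₀) (G F : Measure 𝒰)
    [IsProbabilityMeasure G] [IsProbabilityMeasure F] :
    ∫ y, Real.log (mixture k G y / mixture k F y) ^ 2 ∂P ≤ 2 * A := by
  calc _ ≤ ∫ y, ((mixture k G y / mixture k F y) ^ 2 + (mixture k F y / mixture k G y) ^ 2) ∂P :=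
        integral_mono_ae (hk.integrable_log_ratio_sq G F)
          ((hk.integrable_ratio_sq G F).add (hk.integrable_ratio_sq F G)) (hk.log_ratio_sq_le G F)
    _ = _ := integral_add (hk.integrable_ratio_sq G F) (hk.integrable_ratio_sq F G)
    _ ≤ 2 * A := by
        linarith [hk.integral_ratio_sq_le G F, hk.integral_ratio_sq_le F G]

theorem integrable_log_ratio (hk : IsRegularKernel k P A F₀) (G F : Measure 𝒰)
    [IsProbabilityMeasure G] [IsProbabilityMeasure F] :
    Integrable (fun y => Real.log (mixture k G y / mixture k F y)) P :=
  ((memLp_two_iff_integrable_sq (hk.measurable_log_ratio G F).aestronglyMeasurable).2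
    (hk.integrable_log_ratio_sq G F)).integrable (by norm_num)

theorem relEnt_le (hk : IsRegularKernel k P A F₀) (G F : Measure 𝒰)
    [IsProbabilityMeasure G] [IsProbabilityMeasure F] :
    relEnt k P G F ≤ ∫ y, mixture k G y / mixture k F y ∂P - 1 := by
  have : ∫ y, mixture k G y / mixture k F y ∂P - 1 =
      ∫ y, (mixture k G y / mixture k F y - 1) ∂P := by
    rw [integral_sub (hk.integrable_ratio G F) (integrable_const _)]
    simp
  rw [this]
  refine integral_mono_ae (hk.integrable_log_ratio G F)
    ((hk.integrable_ratio G F).sub (integrable_const _)) ?_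
  filter_upwards [hk.mixture_pos F, hk.mixture_pos G] with y h1 h2
  exact Real.log_le_sub_one_of_pos (div_pos h2 h1)

theorem relEnt_add (hk : IsRegularKernel k P A F₀) (G H F : Measure 𝒰)
    [IsProbabilityMeasure G] [IsProbabilityMeasure F] [IsProbabilityMeasure H] :
    relEnt k P G F = relEnt k P G H + relEnt k P H F := by
  unfold relEnt
  rw [← integral_add (hk.integrable_log_ratio G H) (hk.integrable_log_ratio H F)]
  refine integral_congr_ae ?_
  filter_upwards [hk.mixture_pos F, hk.mixture_pos G, hk.mixture_pos H] with y h1 h2 h3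
  rw [Real.log_div h2.ne' h1.ne', Real.log_div h2.ne' h3.ne', Real.log_div h3.ne' h1.ne']
  ring

/-- The cocycle identity gives `relEnt G G = 0` and antisymmetry, so the upper bound `(1 + A) - 1`
for both orders suffices. -/
theorem abs_relEnt_le (hk : IsRegularKernel k P A F₀) (G F : Measure 𝒰)
    [IsProbabilityMeasure G] [IsProbabilityMeasure F] : |relEnt k P G F| ≤ A := by
  have h := hk.relEnt_add G F G
  have h0 := hk.relEnt_add G G G
  have h1 := hk.relEnt_le G F
  have h2 := hk.relEnt_le F G
  have h3 := hk.integral_ratio_le F G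
  have h4 := hk.integral_ratio_le G F
  rw [abs_le]
  constructor <;> linarith

/-- By the cocycle identity only `relEnt F F'` matters, and with `r = m_G / m_F` its integrand is
`-log (1 + w (r - 1))`, bounded by `sub_sq_div_le_log`. -/
theorem relEnt_convexComb_le (hk : IsRegularKernel k P A F₀) (G₀ F G F' : Measure 𝒰)
    [IsProbabilityMeasure G₀] [IsProbabilityMeasure F] [IsProbabilityMeasure G]
    [IsProbabilityMeasure F'] {η w : ℝ} (hη : 0 < η) (hw : 0 ≤ w) (hwη : w ≤ 1 - η)
    (hF' : ∀ y, mixture k F' y = (1 - w) * mixture k F y + w * mixture k G y) :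
    relEnt k P G₀ F' ≤ relEnt k P G₀ F - w * (∫ y, mixture k G y / mixture k F y ∂P - 1) +
      w ^ 2 / η * (A + 1) := by
  rw [hk.relEnt_add G₀ F F']
  have h1 := hk.integrable_ratio G F
  have h2 := hk.integrable_ratio_sq G F
  have i1 : Integrable (fun y => w * (mixture k G y / mixture k F y - 1)) P :=
    (h1.sub (integrable_const _)).const_mul _
  have i2 : Integrable (fun y => w ^ 2 / η * ((mixture k G y / mixture k F y) ^ 2 + 1)) P :=
    (h2.add (integrable_const _)).const_mul _
  have key : relEnt k P F F' ≤ ∫ y, (w ^ 2 / η * ((mixture k G y / mixture k F y) ^ 2 + 1) -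
      w * (mixture k G y / mixture k F y - 1)) ∂P := by
    refine integral_mono_ae (hk.integrable_log_ratio F F') (i2.sub i1) ?_
    filter_upwards [hk.mixture_pos F, hk.mixture_pos F'] with y hF hFp
    have h := sub_sq_div_le_log hη hw hwη
      (div_nonneg (mixture_nonneg hk.nonneg G y) hF.le)
    have e : mixture k F y / mixture k F' y =
        (1 + w * (mixture k G y / mixture k F y - 1))⁻¹ := by
      rw [← inv_div, inv_inj, hF']
      field_simp
      ring
    rw [e, Real.log_inv]
    linarith
  rw [integral_sub i2 i1, integral_const_mul, integral_const_mul,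
    integral_add h2 (integrable_const _), integral_sub h1 (integrable_const _)] at key
  simp only [integral_const, probReal_univ, smul_eq_mul, mul_one] at key
  have h3 : w ^ 2 / η * (∫ y, (mixture k G y / mixture k F y) ^ 2 ∂P + 1) ≤
      w ^ 2 / η * (A + 1) := by
    gcongr
    exact hk.integral_ratio_sq_le G F
  linarith

/-- Averaged over the observation, the posterior mixture dominates the prior one. -/
theorem one_le_integral_posterior_ratio (hk : IsRegularKernel k P A F₀) (F : Measure 𝒰)
    [IsProbabilityMeasure F] :
    1 ≤ ∫ y, (∫ z, mixture k (posterior k F y) z / mixture k F z ∂P) ∂P := by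
  have hm : Measurable fun z : 𝒴 × 𝒰 => ENNReal.ofReal (k z.1 z.2) := hk.meas.ennreal_ofReal
  have hmF := hk.measurable_mixture F
  have hmeas : Measurable fun z : 𝒴 × 𝒰 =>
      ENNReal.ofReal (k z.1 z.2) / ENNReal.ofReal (mixture k F z.1) :=
    hm.div (hmF.comp measurable_fst).ennreal_ofReal
  -- By Tonelli the double integral equals `∫ g² dF`. Since `∫ g dF = 1`, Cauchy–Schwarz gives the
  -- bound.
  set g : 𝒰 → ℝ≥0∞ := fun u =>
    ∫⁻ z, ENNReal.ofReal (k z u) / ENNReal.ofReal (mixture k F z) ∂P with hg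
  have hgm : Measurable g := hmeas.lintegral_prod_left'
  have hg1 : ∫⁻ u, g u ∂F = 1 := by
    rw [hg, lintegral_lintegral_swap (f := fun u z => ENNReal.ofReal (k z u) /
      ENNReal.ofReal (mixture k F z)) (hmeas.comp measurable_swap).aemeasurable]
    have : ∀ᵐ z ∂P, ∫⁻ u, ENNReal.ofReal (k z u) / ENNReal.ofReal (mixture k F z) ∂F = 1 := by
      filter_upwards [hk.mixture_pos F] with z hz
      simp_rw [div_eq_mul_inv]
      rw [lintegral_mul_const _ (hk.meas_right z).ennreal_ofReal, ← hk.ofReal_mixture F]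
      exact ENNReal.mul_inv_cancel (by simpa using hz) ENNReal.ofReal_ne_top
    rw [lintegral_congr_ae this]
    simp
  have hpt : ∀ᵐ y ∂P, ENNReal.ofReal (∫ z, mixture k (posterior k F y) z / mixture k F z ∂P) =
      ∫⁻ u, ENNReal.ofReal (k y u) / ENNReal.ofReal (mixture k F y) * g u ∂F := by
    filter_upwards [hk.mixture_pos F] with y hy
    have := hk.isProbabilityMeasure_posterior F hy
    rw [ofReal_integral_eq_lintegral_ofReal (hk.integrable_ratio _ F) (ae_of_all _ fun z =>
      div_nonneg (mixture_nonneg hk.nonneg _ z) (mixture_nonneg hk.nonneg _ z))]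
    have e : ∀ᵐ z ∂P, ENNReal.ofReal (mixture k (posterior k F y) z / mixture k F z) =
        ∫⁻ u, ENNReal.ofReal (k y u) / ENNReal.ofReal (mixture k F y) *
          (ENNReal.ofReal (k z u) / ENNReal.ofReal (mixture k F z)) ∂F := by
      filter_upwards [hk.mixture_pos F] with z hz
      rw [ENNReal.ofReal_div_of_pos hz, hk.ofReal_mixture, posterior,
        lintegral_withDensity_eq_lintegral_mul _ ((hk.meas_right y).div_const _).ennreal_ofReal
        (hk.meas_right z).ennreal_ofReal, div_eq_mul_inv, ← lintegral_mul_const]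
      · refine lintegral_congr fun u => ?_
        simp only [Pi.mul_apply]
        rw [ENNReal.ofReal_div_of_pos hy, mul_assoc, div_eq_mul_inv (ENNReal.ofReal (k z u))]
      · exact ((hk.meas_right y).div_const _).ennreal_ofReal.mul (hk.meas_right z).ennreal_ofReal
    rw [lintegral_congr_ae e, lintegral_lintegral_swap]
    · refine lintegral_congr fun u => ?_
      rw [lintegral_const_mul]
      exact hmeas.comp (f := fun z => (z, u)) (by fun_prop)
    · refine Measurable.aemeasurable ?_
      exact ((((hk.meas_right y).comp measurable_snd).ennreal_ofReal).div_const _).mul hmeas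
  have hDm : AEStronglyMeasurable
      (fun y => ∫ z, mixture k (posterior k F y) z / mixture k F z ∂P) P := by
    -- The explicit formula for the posterior mixture exhibits joint measurability in the
    -- conditioning observation and the argument.
    simp_rw [hk.mixture_posterior F]
    refine Measurable.aestronglyMeasurable ?_
    have h1 : Measurable fun p : 𝒴 × 𝒴 => ∫ u, k p.2 u * k p.1 u ∂F := by
      refine (StronglyMeasurable.integral_prod_right
        (f := fun (p : 𝒴 × 𝒴) u => k p.2 u * k p.1 u) ?_).measurable
      refine Measurable.stronglyMeasurable (Measurable.mul ?_ ?_)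
      · exact hk.meas.comp (f := fun q : (𝒴 × 𝒴) × 𝒰 => (q.1.2, q.2)) (by fun_prop)
      · exact hk.meas.comp (f := fun q : (𝒴 × 𝒴) × 𝒰 => (q.1.1, q.2)) (by fun_prop)
    exact (StronglyMeasurable.integral_prod_right
      (f := fun (y z : 𝒴) => (∫ u, k z u * k y u ∂F) / mixture k F y / mixture k F z)
      ((h1.div (hmF.comp measurable_fst)).div
        (hmF.comp measurable_snd)).stronglyMeasurable).measurable
  have h0 : ∀ y, 0 ≤ ∫ z, mixture k (posterior k F y) z / mixture k F z ∂P := fun y =>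
    integral_nonneg fun z => div_nonneg (mixture_nonneg hk.nonneg _ z)
      (mixture_nonneg hk.nonneg _ z)
  have hint : Integrable (fun y => ∫ z, mixture k (posterior k F y) z / mixture k F z ∂P) P := by
    refine Integrable.of_bound hDm (1 + A) ?_
    filter_upwards [hk.mixture_pos F] with y hy
    have := hk.isProbabilityMeasure_posterior F hy
    rw [Real.norm_of_nonneg (h0 y)]
    exact hk.integral_ratio_le _ F
  rw [← ENNReal.ofReal_le_ofReal_iff (integral_nonneg h0),
    ofReal_integral_eq_lintegral_ofReal hint (ae_of_all _ h0), lintegral_congr_ae hpt,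
    lintegral_lintegral_swap (hmeas.mul (hgm.comp measurable_snd)).aemeasurable, ENNReal.ofReal_one]
  calc (1 : ℝ≥0∞) = (∫⁻ u, g u ∂F) ^ 2 := by rw [hg1]; simp
    _ ≤ ∫⁻ u, g u ^ 2 ∂F := lintegral_sq_le_lintegral_sq hgm
    _ = _ := by
      refine lintegral_congr fun u => ?_
      rw [sq]
      exact (lintegral_mul_const (f := fun y => ENNReal.ofReal (k y u) /
        ENNReal.ofReal (mixture k F y)) _
        (hmeas.comp (f := fun z => (z, u)) (by fun_prop))).symm

theorem integral_relEnt_update_le (hk : IsRegularKernel k P A F₀) (G₀ F : Measure 𝒰)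
    [IsProbabilityMeasure G₀] [IsProbabilityMeasure F] {η w : ℝ} (hη : 0 < η) (hw : 0 ≤ w)
    (hwη : w ≤ 1 - η) (F' : 𝒴 → Measure 𝒰)
    (hF' : ∀ᵐ y ∂P, IsProbabilityMeasure (F' y) ∧ ∀ z, mixture k (F' y) z =
      (1 - w) * mixture k F z + w * mixture k (posterior k F y) z)
    (hmeas : AEStronglyMeasurable (fun y => relEnt k P G₀ (F' y)) P) :
    ∫ y, relEnt k P G₀ (F' y) ∂P ≤ relEnt k P G₀ F + w ^ 2 / η * (A + 1) := by
  have hpost := hk.one_le_integral_posterior_ratio F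
  -- The integral of a non-integrable function is `0`, so the lower bound `1` already forces
  -- integrability.
  have hint : Integrable (fun y => ∫ z, mixture k (posterior k F y) z / mixture k F z ∂P) P := by
    by_contra h
    rw [integral_undef h] at hpost
    linarith
  have hint' : Integrable (fun y => relEnt k P G₀ (F' y)) P := by
    refine Integrable.of_bound hmeas A ?_
    filter_upwards [hF'] with y hy
    have := hy.1
    exact hk.abs_relEnt_le G₀ (F' y)
  have i1 : Integrable (fun y => w *
      (∫ z, mixture k (posterior k F y) z / mixture k F z ∂P - 1)) P :=
    (hint.sub (integrable_const _)).const_mul _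
  calc _ ≤ ∫ y, (relEnt k P G₀ F + w ^ 2 / η * (A + 1) - w *
        (∫ z, mixture k (posterior k F y) z / mixture k F z ∂P - 1)) ∂P := by
        refine integral_mono_ae hint' ((integrable_const _).sub i1) ?_
        filter_upwards [hF', hk.mixture_pos F] with y hy hpos
        have := hy.1
        have := hk.isProbabilityMeasure_posterior F hpos
        have := hk.relEnt_convexComb_le G₀ F (posterior k F y) (F' y) hη hw hwη hy.2
        linarith
    _ = relEnt k P G₀ F + w ^ 2 / η * (A + 1) - w *
        (∫ y, (∫ z, mixture k (posterior k F y) z / mixture k F z ∂P) ∂P - 1) := by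
        rw [integral_sub (integrable_const _) i1, integral_const_mul,
          integral_sub hint (integrable_const _)]
        simp
    _ ≤ _ := by
        have := mul_nonneg hw (sub_nonneg.2 hpost)
        linarith

end IsRegularKernel

/-! ### Lower bounds for the mean logarithmic growth of the mixing density. -/

/-- The expected logarithmic growth, under `Φ`, of the mixing density when the estimate `F` is
updated with the observation `y` and weight `w`. -/
noncomputable def logGrowth (k : 𝒴 → 𝒰 → ℝ) (Φ F : Measure 𝒰) (w : ℝ) (y : 𝒴) : ℝ :=
  ∫ u, Real.log (1 + w * (k y u / mixture k F y - 1)) ∂Φ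

theorem abs_log_one_add_le {η w r : ℝ} (hη : 0 < η) (hw : 0 ≤ w) (hwη : w ≤ 1 - η) (hr : 0 ≤ r) :
    |Real.log (1 + w * (r - 1))| ≤ |Real.log η| + r := by
  have hx : η ≤ 1 + w * (r - 1) := by nlinarith [mul_nonneg hw hr]
  have hpos : 0 < 1 + w * (r - 1) := hη.trans_le hx
  have h1 := Real.log_le_log hη hx
  have h2 := Real.log_le_sub_one_of_pos hpos
  have h3 := neg_abs_le (Real.log η)
  have h4 := abs_nonneg (Real.log η)
  rw [abs_le]
  constructor
  · linarith
  · nlinarith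

namespace IsRegularKernel

variable {k : 𝒴 → 𝒰 → ℝ} {P : Measure 𝒴} {A : ℝ≥0} {F₀ : Measure 𝒰}

theorem integrable_log_growth (hk : IsRegularKernel k P A F₀) (Φ F : Measure 𝒰)
    [IsProbabilityMeasure Φ] {η w : ℝ} (hη : 0 < η) (hw : 0 ≤ w) (hwη : w ≤ 1 - η) (y : 𝒴) :
    Integrable (fun u => Real.log (1 + w * (k y u / mixture k F y - 1))) Φ := by
  have h0 := mixture_nonneg hk.nonneg F y
  refine Integrable.mono' (g := fun u => |Real.log η| + k y u / mixture k F y)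
    ((integrable_const _).add ((hk.integrable Φ y).div_const _)) ?_ (ae_of_all _ fun u => ?_)
  · exact (Real.measurable_log.comp (measurable_const.add (measurable_const.mul
      (((hk.meas_right y).div_const _).sub measurable_const)))).aestronglyMeasurable
  · exact abs_log_one_add_le hη hw hwη (div_nonneg (hk.nonneg y u) h0)

theorem abs_logGrowth_le (hk : IsRegularKernel k P A F₀) (Φ F : Measure 𝒰)
    [IsProbabilityMeasure Φ] {η w : ℝ} (hη : 0 < η) (hw : 0 ≤ w) (hwη : w ≤ 1 - η) (y : 𝒴) :
    |logGrowth k Φ F w y| ≤ |Real.log η| + mixture k Φ y / mixture k F y := by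
  have h0 := mixture_nonneg hk.nonneg F y
  have hi := (hk.integrable Φ y).div_const (mixture k F y)
  calc |logGrowth k Φ F w y| ≤ ∫ u, (|Real.log η| + k y u / mixture k F y) ∂Φ := by
        rw [logGrowth, ← Real.norm_eq_abs]
        exact norm_integral_le_of_norm_le ((integrable_const _).add hi) (ae_of_all _ fun u =>
          abs_log_one_add_le hη hw hwη (div_nonneg (hk.nonneg y u) h0))
    _ = _ := by
        rw [integral_add (integrable_const _) hi, integral_div]
        simp [mixture]

variable [IsProbabilityMeasure P] [IsProbabilityMeasure F₀]

theorem integrable_logGrowth (hk : IsRegularKernel k P A F₀) (Φ F : Measure 𝒰)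
    [IsProbabilityMeasure Φ] [IsProbabilityMeasure F] {η w : ℝ} (hη : 0 < η) (hw : 0 ≤ w)
    (hwη : w ≤ 1 - η) : Integrable (logGrowth k Φ F w) P := by
  refine Integrable.mono' ((integrable_const |Real.log η|).add (hk.integrable_ratio Φ F)) ?_
    (ae_of_all _ fun y => hk.abs_logGrowth_le Φ F hη hw hwη y)
  refine (StronglyMeasurable.integral_prod_right
    (f := fun y u => Real.log (1 + w * (k y u / mixture k F y - 1)))
    (Measurable.stronglyMeasurable ?_)).aestronglyMeasurable
  exact Real.measurable_log.comp (measurable_const.add (measurable_const.mul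
    ((hk.meas.div ((hk.measurable_mixture F).comp measurable_fst)).sub measurable_const)))

theorem lintegral_lintegral_sq_le (hk : IsRegularKernel k P A F₀) (Φ F : Measure 𝒰)
    [IsProbabilityMeasure Φ] [IsProbabilityMeasure F] :
    ∫⁻ y, ∫⁻ u, ENNReal.ofReal ((k y u / mixture k F y) ^ 2) ∂Φ ∂P ≤ A := by
  have hm : Measurable fun z : 𝒴 × 𝒰 => ENNReal.ofReal ((k z.1 z.2 / mixture k F z.1) ^ 2) :=
    ((hk.meas.div ((hk.measurable_mixture F).comp measurable_fst)).pow_const 2).ennreal_ofReal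
  rw [lintegral_lintegral_swap hm.aemeasurable]
  calc _ ≤ ∫⁻ _, A ∂Φ := by
        refine lintegral_mono fun u => ?_
        -- The kernel at `u` is the mixture with mixing measure a point mass at `u`, so the bound
        -- for mixtures applies.
        refine le_trans (le_of_eq ?_) (hk.lintegral_ofReal_ratio_sq_le (Measure.dirac u) F)
        refine lintegral_congr fun y => ?_
        have e : mixture k (Measure.dirac u) y = k y u :=
          integral_dirac' _ _ (hk.meas_right y).stronglyMeasurable
        rw [e]
    _ = A := by simp

/-- Integrating `sub_sq_div_le_log` over `u` and `y` leaves the linear term `w (∫ m_Φ / m_F dP -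
1)`, which dominates `w * relEnt k P Φ F` by `relEnt_le`. -/
theorem le_integral_logGrowth (hk : IsRegularKernel k P A F₀) (Φ F : Measure 𝒰)
    [IsProbabilityMeasure Φ] [IsProbabilityMeasure F] {η w : ℝ} (hη : 0 < η) (hw : 0 ≤ w)
    (hwη : w ≤ 1 - η) :
    w * relEnt k P Φ F - w ^ 2 / η * (A + 1) ≤ ∫ y, logGrowth k Φ F w y ∂P := by
  have hm : Measurable fun z : 𝒴 × 𝒰 => (k z.1 z.2 / mixture k F z.1) ^ 2 :=
    (hk.meas.div ((hk.measurable_mixture F).comp measurable_fst)).pow_const 2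
  have hbdd : ∀ y, Integrable (fun u => (k y u / mixture k F y) ^ 2) Φ := by
    intro y
    obtain ⟨C, hC⟩ := hk.bdd y
    refine Integrable.of_bound (hm.comp measurable_prodMk_left).aestronglyMeasurable
      ((C / mixture k F y) ^ 2) (ae_of_all _ fun u => ?_)
    have h0 := mixture_nonneg hk.nonneg F y
    rw [Real.norm_of_nonneg (sq_nonneg _)]
    have := hk.nonneg y u
    have := hC u
    gcongr
  set q : 𝒴 → ℝ := fun y => ∫ u, (k y u / mixture k F y) ^ 2 ∂Φ with hq
  have hq0 : ∀ y, 0 ≤ q y := fun y => integral_nonneg fun u => sq_nonneg _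
  have hqm : AEStronglyMeasurable q P :=
    (StronglyMeasurable.integral_prod_right (f := fun y u => (k y u / mixture k F y) ^ 2)
      hm.stronglyMeasurable).aestronglyMeasurable
  have hqA : ∫⁻ y, ENNReal.ofReal (q y) ∂P ≤ A := by
    refine le_trans (le_of_eq (lintegral_congr fun y => ?_)) (hk.lintegral_lintegral_sq_le Φ F)
    exact ofReal_integral_eq_lintegral_ofReal (hbdd y) (ae_of_all _ fun u => sq_nonneg _)
  have hqi : Integrable q P := by
    refine ⟨hqm, ?_⟩
    rw [hasFiniteIntegral_iff_ofReal (ae_of_all _ hq0)]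
    exact hqA.trans_lt ENNReal.coe_lt_top
  have hqA' : ∫ y, q y ∂P ≤ A := by
    rw [integral_eq_lintegral_of_nonneg_ae (ae_of_all _ hq0) hqm]
    exact ENNReal.toReal_le_coe_of_le_coe hqA
  have hr := hk.integrable_ratio Φ F
  have hpt : ∀ y, w * (mixture k Φ y / mixture k F y - 1) - w ^ 2 / η * (q y + 1) ≤
      logGrowth k Φ F w y := by
    intro y
    have h0 := mixture_nonneg hk.nonneg F y
    have hi := (hk.integrable Φ y).div_const (mixture k F y)
    have i1 : Integrable (fun u => w * (k y u / mixture k F y - 1)) Φ :=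
      (hi.sub (integrable_const _)).const_mul _
    have i2 : Integrable (fun u => w ^ 2 / η * ((k y u / mixture k F y) ^ 2 + 1)) Φ :=
      ((hbdd y).add (integrable_const _)).const_mul _
    calc _ = ∫ u, (w * (k y u / mixture k F y - 1) -
          w ^ 2 / η * ((k y u / mixture k F y) ^ 2 + 1)) ∂Φ := by
          rw [integral_sub i1 i2, integral_const_mul, integral_const_mul,
            integral_sub hi (integrable_const _), integral_add (hbdd y) (integrable_const _),
            integral_div]
          simp [hq, mixture]
      _ ≤ _ := integral_mono (i1.sub i2) (hk.integrable_log_growth Φ F hη hw hwη y) fun u =>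
          sub_sq_div_le_log hη hw hwη (div_nonneg (hk.nonneg y u) h0)
  have i1 : Integrable (fun y => w * (mixture k Φ y / mixture k F y - 1)) P :=
    (hr.sub (integrable_const _)).const_mul _
  have i2 : Integrable (fun y => w ^ 2 / η * (q y + 1)) P :=
    (hqi.add (integrable_const _)).const_mul _
  have h := integral_mono (i1.sub i2) (hk.integrable_logGrowth Φ F hη hw hwη) hpt
  simp only [Pi.sub_apply] at h
  rw [integral_sub i1 i2, integral_const_mul, integral_const_mul,
    integral_sub hr (integrable_const _), integral_add hqi (integrable_const _)] at h
  simp only [integral_const, probReal_univ, smul_eq_mul, mul_one] at h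
  have h1 := mul_le_mul_of_nonneg_left (hk.relEnt_le Φ F) hw
  have h2 : w ^ 2 / η * (∫ y, q y ∂P + 1) ≤ w ^ 2 / η * (A + 1) := by gcongr
  linarith

end IsRegularKernel

/-! ### Real-valued densities and the measures they define. -/

section Densities

variable {μ : Measure 𝒰}

theorem isProbabilityMeasure_ofDensity {f : 𝒰 → ℝ} (hf : f ∈ Densities μ) :
    IsProbabilityMeasure (ofDensity μ f) := by
  refine ⟨?_⟩
  rw [ofDensity, withDensity_apply _ MeasurableSet.univ, Measure.restrict_univ]
  exact hf.2.2

theorem integral_ofDensity {f : 𝒰 → ℝ} (hf : Measurable f) (h0 : ∀ u, 0 ≤ f u) (g : 𝒰 → ℝ) :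
    ∫ u, g u ∂(ofDensity μ f) = ∫ u, g u * f u ∂μ := by
  rw [ofDensity, integral_withDensity_eq_integral_toReal_smul hf.ennreal_ofReal
    (ae_of_all _ fun _ => ENNReal.ofReal_lt_top)]
  refine integral_congr_ae (ae_of_all _ fun u => ?_)
  simp only [smul_eq_mul]
  rw [ENNReal.toReal_ofReal (h0 u), mul_comm]

theorem integrable_ofDensity_iff {f : 𝒰 → ℝ} (hf : Measurable f) (h0 : ∀ u, 0 ≤ f u)
    (g : 𝒰 → ℝ) : Integrable g (ofDensity μ f) ↔ Integrable (fun u => g u * f u) μ := by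
  rw [ofDensity, integrable_withDensity_iff_integrable_smul' hf.ennreal_ofReal
    (ae_of_all _ fun _ => ENNReal.ofReal_lt_top)]
  refine integrable_congr (ae_of_all _ fun u => ?_)
  simp only [smul_eq_mul]
  rw [ENNReal.toReal_ofReal (h0 u), mul_comm]

theorem integrable_of_mem_densities {f : 𝒰 → ℝ} (hf : f ∈ Densities μ) : Integrable f μ := by
  refine ⟨hf.1.aestronglyMeasurable, ?_⟩
  rw [hasFiniteIntegral_iff_ofReal (ae_of_all _ hf.2.1), hf.2.2]
  exact ENNReal.one_lt_top

theorem integral_of_mem_densities {f : 𝒰 → ℝ} (hf : f ∈ Densities μ) : ∫ u, f u ∂μ = 1 := by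
  rw [integral_eq_lintegral_of_nonneg_ae (ae_of_all _ hf.2.1) hf.1.aestronglyMeasurable, hf.2.2]
  rfl

theorem mem_densities_of_integral {f : 𝒰 → ℝ} (hf : Measurable f) (h0 : ∀ u, 0 ≤ f u)
    (h1 : ∫ u, f u ∂μ = 1) : f ∈ Densities μ := by
  refine ⟨hf, h0, ?_⟩
  have hi : Integrable f μ := by
    by_contra h
    rw [integral_undef h] at h1
    exact zero_ne_one h1
  rw [← ofReal_integral_eq_lintegral_ofReal hi (ae_of_all _ h0), h1, ENNReal.ofReal_one]

end Densities

/-! ### The recursion along a deterministic sequence of observations. -/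

section Path

variable {μ : Measure 𝒰} {k : 𝒴 → 𝒰 → ℝ} {f₀ : 𝒰 → ℝ} {w : ℕ → ℝ}

theorem prDensity_congr {𝒴 : Type*} {k : 𝒴 → 𝒰 → ℝ} {x x' : ℕ → 𝒴} {n : ℕ}
    (h : ∀ j < n, x j = x' j) : prDensity μ k f₀ w x n = prDensity μ k f₀ w x' n := by
  induction n with
  | zero => rfl
  | succ n ih =>
    funext u
    simp only [prDensity]
    rw [ih fun j hj => h j (hj.trans (Nat.lt_succ_self n)), h n (Nat.lt_succ_self n)]

theorem prDensity_nonneg {𝒴 : Type*} {k : 𝒴 → 𝒰 → ℝ} (hk : ∀ y u, 0 ≤ k y u)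
    (hf₀ : ∀ u, 0 ≤ f₀ u) (hw : ∀ n, w n ∈ Set.Ioo (0 : ℝ) 1) (x : ℕ → 𝒴) (n : ℕ) (u : 𝒰) :
    0 ≤ prDensity μ k f₀ w x n u := by
  induction n generalizing u with
  | zero => exact hf₀ u
  | succ n ih =>
    simp only [prDensity]
    have h1 := ih u
    have h2 := hk (x n) u
    have h3 : 0 ≤ ∫ u', k (x n) u' * prDensity μ k f₀ w x n u' ∂μ :=
      integral_nonneg fun u' => mul_nonneg (hk _ _) (ih u')
    have h4 := (hw n).1.le
    have h5 := sub_nonneg.2 (hw n).2.le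
    positivity

theorem measurable_prDensity_prod [SFinite μ] (hk : Measurable fun z : 𝒴 × 𝒰 => k z.1 z.2)
    (hf₀ : Measurable f₀) (n : ℕ) :
    Measurable fun q : (ℕ → 𝒴) × 𝒰 => prDensity μ k f₀ w q.1 n q.2 := by
  induction n with
  | zero => exact hf₀.comp measurable_snd
  | succ n ih =>
    simp only [prDensity]
    have h1 : Measurable fun q : (ℕ → 𝒴) × 𝒰 => k (q.1 n) q.2 :=
      hk.comp (f := fun q : (ℕ → 𝒴) × 𝒰 => (q.1 n, q.2)) (by fun_prop)
    have h2 : Measurable fun x : ℕ → 𝒴 => ∫ u, k (x n) u * prDensity μ k f₀ w x n u ∂μ :=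
      (StronglyMeasurable.integral_prod_right
        (f := fun (x : ℕ → 𝒴) u => k (x n) u * prDensity μ k f₀ w x n u)
        (h1.mul ih).stronglyMeasurable).measurable
    exact (ih.const_mul _).add (((h1.mul ih).div (h2.comp measurable_fst)).const_mul _)

theorem measurable_prDensity [SFinite μ] (hk : Measurable fun z : 𝒴 × 𝒰 => k z.1 z.2)
    (hf₀ : Measurable f₀) (x : ℕ → 𝒴) (n : ℕ) : Measurable (prDensity μ k f₀ w x n) :=
  (measurable_prDensity_prod hk hf₀ n).comp measurable_prodMk_left

/-- The measure with the predictive recursion estimate as its density. -/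
noncomputable def prMeasure (μ : Measure 𝒰) (k : 𝒴 → 𝒰 → ℝ) (f₀ : 𝒰 → ℝ) (w : ℕ → ℝ)
    (x : ℕ → 𝒴) (n : ℕ) : Measure 𝒰 :=
  ofDensity μ (prDensity μ k f₀ w x n)

/-- Paths all of whose values have positive initial mixture density. -/
def goodPaths (k : 𝒴 → 𝒰 → ℝ) (F₀ : Measure 𝒰) : Set (ℕ → 𝒴) :=
  {x | ∀ j, 0 < mixture k F₀ (x j)}

variable {P : Measure 𝒴} {A : ℝ≥0}

theorem mixture_prMeasure [SFinite μ] (hk : Measurable fun z : 𝒴 × 𝒰 => k z.1 z.2)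
    (hk0 : ∀ y u, 0 ≤ k y u) (hf₀ : Measurable f₀) (hf₀0 : ∀ u, 0 ≤ f₀ u)
    (hw : ∀ n, w n ∈ Set.Ioo (0 : ℝ) 1) (x : ℕ → 𝒴) (n : ℕ) (z : 𝒴) :
    mixture k (prMeasure μ k f₀ w x n) z = prMixture μ k f₀ w x n z :=
  integral_ofDensity (measurable_prDensity hk hf₀ x n) (prDensity_nonneg hk0 hf₀0 hw x n) _

theorem measurable_mixture_prMeasure [SFinite μ] (hk : Measurable fun z : 𝒴 × 𝒰 => k z.1 z.2)
    (hk0 : ∀ y u, 0 ≤ k y u) (hf₀ : Measurable f₀) (hf₀0 : ∀ u, 0 ≤ f₀ u)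
    (hw : ∀ n, w n ∈ Set.Ioo (0 : ℝ) 1) (n : ℕ) :
    Measurable fun q : (ℕ → 𝒴) × 𝒴 => mixture k (prMeasure μ k f₀ w q.1 n) q.2 := by
  simp_rw [mixture_prMeasure hk hk0 hf₀ hf₀0 hw]
  refine (StronglyMeasurable.integral_prod_right
    (f := fun (q : (ℕ → 𝒴) × 𝒴) u => k q.2 u * prDensity μ k f₀ w q.1 n u)
    (Measurable.stronglyMeasurable (Measurable.mul ?_ ?_))).measurable
  · exact hk.comp (f := fun q : ((ℕ → 𝒴) × 𝒴) × 𝒰 => (q.1.2, q.2)) (by fun_prop)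
  · exact (measurable_prDensity_prod hk hf₀ n).comp
      (f := fun q : ((ℕ → 𝒴) × 𝒴) × 𝒰 => (q.1.1, q.2)) (by fun_prop)

/-- The two conclusions need each other: the lower bound by a multiple of `f₀` keeps the normalizing
integral positive on good paths, and positivity makes the next step a density. Each step costs a
factor `1 - w n`. -/
theorem IsRegularKernel.prDensity_mem [SFinite μ]
    (hk : IsRegularKernel k P A (ofDensity μ f₀)) (hf₀ : f₀ ∈ Densities μ)
    (hw : ∀ n, w n ∈ Set.Ioo (0 : ℝ) 1) {x : ℕ → 𝒴} (hx : x ∈ goodPaths k (ofDensity μ f₀))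
    (n : ℕ) : prDensity μ k f₀ w x n ∈ Densities μ ∧
      ∃ c > 0, ∀ u, c * f₀ u ≤ prDensity μ k f₀ w x n u := by
  induction n with
  | zero => exact ⟨hf₀, 1, one_pos, fun u => (one_mul _).le⟩
  | succ n ih =>
    obtain ⟨hmem, c, hc, hle⟩ := ih
    have := isProbabilityMeasure_ofDensity hf₀
    have := isProbabilityMeasure_ofDensity hmem
    have hint : Integrable (fun u => k (x n) u * prDensity μ k f₀ w x n u) μ :=
      (integrable_ofDensity_iff hmem.1 hmem.2.1 _).1 (hk.integrable _ (x n))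
    have hint₀ : Integrable (fun u => k (x n) u * f₀ u) μ :=
      (integrable_ofDensity_iff hf₀.1 hf₀.2.1 _).1 (hk.integrable _ (x n))
    have hpos : 0 < ∫ u, k (x n) u * prDensity μ k f₀ w x n u ∂μ := by
      have h1 := hx n
      rw [mixture, integral_ofDensity hf₀.1 hf₀.2.1] at h1
      calc 0 < c * ∫ u, k (x n) u * f₀ u ∂μ := mul_pos hc h1
        _ = ∫ u, c * (k (x n) u * f₀ u) ∂μ := (integral_const_mul _ _).symm
        _ ≤ _ := integral_mono (hint₀.const_mul _) hint fun u => by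
          have := mul_le_mul_of_nonneg_left (hle u) (hk.nonneg (x n) u)
          simp only
          linarith
    refine ⟨mem_densities_of_integral (measurable_prDensity hk.meas hf₀.1 x (n + 1))
      (prDensity_nonneg hk.nonneg hf₀.2.1 hw x (n + 1)) ?_, (1 - w n) * c,
      mul_pos (sub_pos.2 (hw n).2) hc, fun u => ?_⟩
    · simp only [prDensity]
      rw [integral_add ((integrable_of_mem_densities hmem).const_mul _)
        ((hint.div_const _).const_mul _), integral_const_mul, integral_const_mul, integral_div,
        div_self hpos.ne', integral_of_mem_densities hmem]
      ring
    · simp only [prDensity]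
      have h1 := mul_le_mul_of_nonneg_left (hle u) (sub_nonneg.2 (hw n).2.le)
      have h2 : 0 ≤ w n * (k (x n) u * prDensity μ k f₀ w x n u /
          ∫ u', k (x n) u' * prDensity μ k f₀ w x n u' ∂μ) :=
        mul_nonneg (hw n).1.le (div_nonneg (mul_nonneg (hk.nonneg _ _) (hmem.2.1 u)) hpos.le)
      linarith

theorem IsRegularKernel.isProbabilityMeasure_prMeasure [SFinite μ]
    (hk : IsRegularKernel k P A (ofDensity μ f₀)) (hf₀ : f₀ ∈ Densities μ)
    (hw : ∀ n, w n ∈ Set.Ioo (0 : ℝ) 1) {x : ℕ → 𝒴} (hx : x ∈ goodPaths k (ofDensity μ f₀))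
    (n : ℕ) : IsProbabilityMeasure (prMeasure μ k f₀ w x n) :=
  isProbabilityMeasure_ofDensity (hk.prDensity_mem hf₀ hw hx n).1

theorem IsRegularKernel.mixture_prMeasure_pos [SFinite μ]
    (hk : IsRegularKernel k P A (ofDensity μ f₀)) (hf₀ : f₀ ∈ Densities μ)
    (hw : ∀ n, w n ∈ Set.Ioo (0 : ℝ) 1) {x : ℕ → 𝒴} (hx : x ∈ goodPaths k (ofDensity μ f₀))
    (n : ℕ) {y : 𝒴} (hy : 0 < mixture k (ofDensity μ f₀) y) :
    0 < mixture k (prMeasure μ k f₀ w x n) y := by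
  obtain ⟨hmem, c, hc, hle⟩ := hk.prDensity_mem hf₀ hw hx n
  have := isProbabilityMeasure_ofDensity hf₀
  have := isProbabilityMeasure_ofDensity hmem
  rw [mixture, integral_ofDensity hf₀.1 hf₀.2.1] at hy
  rw [prMeasure, mixture, integral_ofDensity hmem.1 hmem.2.1]
  calc 0 < c * ∫ u, k y u * f₀ u ∂μ := mul_pos hc hy
    _ = ∫ u, c * (k y u * f₀ u) ∂μ := (integral_const_mul _ _).symm
    _ ≤ _ := integral_mono
      (((integrable_ofDensity_iff hf₀.1 hf₀.2.1 _).1 (hk.integrable _ y)).const_mul _)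
      ((integrable_ofDensity_iff hmem.1 hmem.2.1 _).1 (hk.integrable _ y)) fun u => by
        have := mul_le_mul_of_nonneg_left (hle u) (hk.nonneg y u)
        simp only
        linarith

theorem IsRegularKernel.mixture_prMeasure_succ [SFinite μ]
    (hk : IsRegularKernel k P A (ofDensity μ f₀)) (hf₀ : f₀ ∈ Densities μ)
    (hw : ∀ n, w n ∈ Set.Ioo (0 : ℝ) 1) {x : ℕ → 𝒴} (hx : x ∈ goodPaths k (ofDensity μ f₀))
    (n : ℕ) (z : 𝒴) :
    mixture k (prMeasure μ k f₀ w x (n + 1)) z =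
      (1 - w n) * mixture k (prMeasure μ k f₀ w x n) z +
        w n * mixture k (posterior k (prMeasure μ k f₀ w x n) (x n)) z := by
  have hmem := (hk.prDensity_mem hf₀ hw hx n).1
  have := hk.isProbabilityMeasure_prMeasure hf₀ hw hx n
  rw [hk.mixture_posterior, mixture_prMeasure hk.meas hk.nonneg hf₀.1 hf₀.2.1 hw,
    mixture_prMeasure hk.meas hk.nonneg hf₀.1 hf₀.2.1 hw,
    mixture_prMeasure hk.meas hk.nonneg hf₀.1 hf₀.2.1 hw]
  have e1 : ∫ u, k z u * k (x n) u ∂(prMeasure μ k f₀ w x n) =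
      ∫ u, k z u * k (x n) u * prDensity μ k f₀ w x n u ∂μ :=
    integral_ofDensity hmem.1 hmem.2.1 _
  have i1 : Integrable (fun u => k z u * prDensity μ k f₀ w x n u) μ :=
    (integrable_ofDensity_iff hmem.1 hmem.2.1 _).1
      (hk.integrable (prMeasure μ k f₀ w x n) z)
  have i2 : Integrable (fun u => k z u * k (x n) u * prDensity μ k f₀ w x n u) μ := by
    refine (integrable_ofDensity_iff hmem.1 hmem.2.1 _).1 ?_
    obtain ⟨C, hC⟩ := hk.bdd z
    refine (hk.integrable (prMeasure μ k f₀ w x n) (x n)).bdd_mul (c := C)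
      (hk.meas_right z).aestronglyMeasurable (ae_of_all _ fun u => ?_)
    rw [Real.norm_of_nonneg (hk.nonneg z u)]
    exact hC u
  rw [e1, prMixture, prMixture, prMixture, ← integral_const_mul, ← integral_div,
    ← integral_const_mul, ← integral_add (i1.const_mul _) ((i2.div_const _).const_mul _)]
  refine integral_congr_ae (ae_of_all _ fun u => ?_)
  simp only [prDensity]
  ring

theorem prMeasure_congr {𝒴 : Type*} {k : 𝒴 → 𝒰 → ℝ} {x x' : ℕ → 𝒴} {n : ℕ}
    (h : ∀ j < n, x j = x' j) : prMeasure μ k f₀ w x n = prMeasure μ k f₀ w x' n := by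
  rw [prMeasure, prMeasure, prDensity_congr h]

theorem prMeasure_update {𝒴 : Type*} {k : 𝒴 → 𝒰 → ℝ} (x : ℕ → 𝒴) (n : ℕ) (y : 𝒴) :
    prMeasure μ k f₀ w (Function.update x n y) n = prMeasure μ k f₀ w x n :=
  prMeasure_congr fun j hj => by simp [hj.ne]

theorem update_mem_goodPaths {𝒴 : Type*} {k : 𝒴 → 𝒰 → ℝ} {F₀ : Measure 𝒰} {x : ℕ → 𝒴}
    (hx : x ∈ goodPaths k F₀) (n : ℕ) {y : 𝒴} (hy : 0 < mixture k F₀ y) :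
    Function.update x n y ∈ goodPaths k F₀ := by
  intro j
  rcases eq_or_ne j n with rfl | h
  · simpa using hy
  · simpa [h] using hx j

theorem IsRegularKernel.measurable_relEnt_prMeasure [SFinite μ] [SFinite P]
    (hk : IsRegularKernel k P A (ofDensity μ f₀)) (hf₀ : f₀ ∈ Densities μ)
    (hw : ∀ n, w n ∈ Set.Ioo (0 : ℝ) 1) (G : Measure 𝒰) [SFinite G] (n : ℕ) :
    Measurable fun x => relEnt k P G (prMeasure μ k f₀ w x n) :=
  (StronglyMeasurable.integral_prod_right
    (f := fun x z => Real.log (mixture k G z / mixture k (prMeasure μ k f₀ w x n) z))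
    (Real.measurable_log.comp (((hk.measurable_mixture G).comp measurable_snd).div
      (measurable_mixture_prMeasure hk.meas hk.nonneg hf₀.1 hf₀.2.1 hw n))).stronglyMeasurable
      ).measurable

/-- Coordinate `n` is the first one that the estimate after `n` observations ignores. Replacing it
by `y` and integrating therefore averages exactly one update. -/
theorem IsRegularKernel.integral_relEnt_prMeasure_succ_le [SFinite μ] [IsProbabilityMeasure P]
    (hk : IsRegularKernel k P A (ofDensity μ f₀)) (hf₀ : f₀ ∈ Densities μ)
    (hw : ∀ n, w n ∈ Set.Ioo (0 : ℝ) 1) {η : ℝ} (hη : 0 < η) (hwη : ∀ n, w n ≤ 1 - η)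
    (G : Measure 𝒰) [IsProbabilityMeasure G]
    {x : ℕ → 𝒴} (hx : x ∈ goodPaths k (ofDensity μ f₀)) (n : ℕ) :
    ∫ y, relEnt k P G (prMeasure μ k f₀ w (Function.update x n y) (n + 1)) ∂P ≤
      relEnt k P G (prMeasure μ k f₀ w x n) + w n ^ 2 / η * (A + 1) := by
  have := isProbabilityMeasure_ofDensity hf₀
  have := hk.isProbabilityMeasure_prMeasure hf₀ hw hx n
  refine hk.integral_relEnt_update_le G (prMeasure μ k f₀ w x n) hη (hw n).1.le (hwη n)
    (fun y => prMeasure μ k f₀ w (Function.update x n y) (n + 1)) ?_ ?_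
  · filter_upwards [hk.pos] with y hy
    have hg := update_mem_goodPaths hx n hy
    refine ⟨hk.isProbabilityMeasure_prMeasure hf₀ hw hg _, fun z => ?_⟩
    rw [hk.mixture_prMeasure_succ hf₀ hw hg, prMeasure_update, Function.update_self]
  · exact ((hk.measurable_relEnt_prMeasure hf₀ hw G (n + 1)).comp
      (measurable_update x)).aestronglyMeasurable

/-- The measure `Φ` lives where `f₀` is positive, and the logarithm of the ratio of any density
to `f₀` has `Φ`-mean at most `C`. -/
structure HasLogBound (μ : Measure 𝒰) (f₀ : 𝒰 → ℝ) (Φ : Measure 𝒰) (C : ℝ) : Prop where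
  pos : ∀ᵐ u ∂Φ, 0 < f₀ u
  bound : ∀ q ∈ Densities μ, (∀ u, 0 < f₀ u → 0 < q u) →
    Integrable (fun u => Real.log (q u / f₀ u)) Φ → ∫ u, Real.log (q u / f₀ u) ∂Φ ≤ C

/-- Successive densities have ratio `1 + w_i (k / m_i - 1)`, so the logarithms telescope to `log
(f_n / f₀)`; `f_n` is a density, hence the log bound applies to it. -/
theorem IsRegularKernel.sum_logGrowth_le [SFinite μ]
    (hk : IsRegularKernel k P A (ofDensity μ f₀)) (hf₀ : f₀ ∈ Densities μ)
    (hw : ∀ n, w n ∈ Set.Ioo (0 : ℝ) 1) {η : ℝ} (hη : 0 < η) (hwη : ∀ n, w n ≤ 1 - η)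
    {Φ : Measure 𝒰} [IsProbabilityMeasure Φ] {C : ℝ} (hΦ : HasLogBound μ f₀ Φ C)
    {x : ℕ → 𝒴} (hx : x ∈ goodPaths k (ofDensity μ f₀)) (n : ℕ) :
    ∑ i ∈ Finset.range n, logGrowth k Φ (prMeasure μ k f₀ w x i) (w i) (x i) ≤ C := by
  have key : ∀ u, 0 < f₀ u → Real.log (prDensity μ k f₀ w x n u / f₀ u) =
      ∑ i ∈ Finset.range n, Real.log (1 + w i *
        (k (x i) u / mixture k (prMeasure μ k f₀ w x i) (x i) - 1)) := by
    intro u hu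
    induction n with
    | zero => simp [prDensity, hu.ne']
    | succ n ih =>
      obtain ⟨hmem, c, hc, hle⟩ := hk.prDensity_mem hf₀ hw hx n
      have hpos : 0 < prDensity μ k f₀ w x n u := (mul_pos hc hu).trans_le (hle u)
      have hmix := hk.mixture_prMeasure_pos hf₀ hw hx n (hx n)
      rw [Finset.sum_range_succ, ← ih, ← Real.log_mul (div_pos hpos hu).ne']
      · congr 1
        simp only [prDensity]
        rw [mixture_prMeasure hk.meas hk.nonneg hf₀.1 hf₀.2.1 hw, prMixture]
        ring
      · have h1 := (hw n).1
        have h2 := (hw n).2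
        have h3 : 0 ≤ k (x n) u / mixture k (prMeasure μ k f₀ w x n) (x n) :=
          div_nonneg (hk.nonneg _ _) hmix.le
        nlinarith [mul_nonneg h1.le h3]
  have hint : ∀ i ∈ Finset.range n, Integrable (fun u => Real.log (1 + w i *
        (k (x i) u / mixture k (prMeasure μ k f₀ w x i) (x i) - 1))) Φ := fun i _ =>
    hk.integrable_log_growth Φ _ hη (hw i).1.le (hwη i) (x i)
  have hae : (fun u => Real.log (prDensity μ k f₀ w x n u / f₀ u)) =ᵐ[Φ] fun u =>
      ∑ i ∈ Finset.range n, Real.log (1 + w i *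
        (k (x i) u / mixture k (prMeasure μ k f₀ w x i) (x i) - 1)) := by
    filter_upwards [hΦ.pos] with u hu using key u hu
  simp only [logGrowth]
  rw [← integral_finsetSum _ hint, ← integral_congr_ae hae]
  obtain ⟨hmem, c, hc, hle⟩ := hk.prDensity_mem hf₀ hw hx n
  exact hΦ.bound _ hmem (fun u hu => (mul_pos hc hu).trans_le (hle u))
    ((integrable_congr hae).2 (integrable_finsetSum _ hint))

end Path

end PredRec

namespace PredRec

/-! ### Almost sure convergence of square integrable martingale series. -/

section Martingale

variable {Ω : Type*} {mΩ : MeasurableSpace Ω} {Pr : Measure Ω}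

theorem eLpNorm_one_le_of_integral_abs_le {f : Ω → ℝ} (hf : Integrable f Pr) {R : ℝ}
    (h : ∫ ω, |f ω| ∂Pr ≤ R) : eLpNorm f 1 Pr ≤ R.toNNReal := by
  rw [eLpNorm_one_eq_lintegral_enorm, ← ofReal_integral_norm_eq_lintegral_enorm hf]
  exact ENNReal.ofReal_le_ofReal h

/-- By monotone convergence the sum of the series has finite mean, so it is finite almost surely. -/
theorem ae_summable_of_sum_integral_le {g : ℕ → Ω → ℝ} (hg : ∀ i, Integrable (g i) Pr)
    (h0 : ∀ i, 0 ≤ᵐ[Pr] g i) {D : ℝ}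
    (hD : ∀ n, ∑ i ∈ Finset.range n, ∫ ω, g i ω ∂Pr ≤ D) :
    ∀ᵐ ω ∂Pr, Summable fun i => g i ω := by
  have hm : ∀ i, AEMeasurable (fun ω => ENNReal.ofReal (g i ω)) Pr := fun i =>
    (hg i).1.aemeasurable.ennreal_ofReal
  have hlt : ∫⁻ ω, ∑' i, ENNReal.ofReal (g i ω) ∂Pr ≤ ENNReal.ofReal D := by
    rw [lintegral_tsum hm, ENNReal.tsum_eq_iSup_nat]
    refine iSup_le fun n => ?_
    calc _ = ∑ i ∈ Finset.range n, ENNReal.ofReal (∫ ω, g i ω ∂Pr) :=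
          Finset.sum_congr rfl fun i _ =>
            (ofReal_integral_eq_lintegral_ofReal (hg i) (h0 i)).symm
      _ = ENNReal.ofReal (∑ i ∈ Finset.range n, ∫ ω, g i ω ∂Pr) :=
          (ENNReal.ofReal_sum_of_nonneg fun i _ => integral_nonneg_of_ae (h0 i)).symm
      _ ≤ _ := ENNReal.ofReal_le_ofReal (hD n)
  have hae := ae_lt_top' (AEMeasurable.tsum hm) (hlt.trans_lt ENNReal.ofReal_lt_top).ne
  filter_upwards [hae, ae_all_iff.2 h0] with ω hω hω0
  have := ENNReal.summable_toReal hω.ne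
  refine this.congr fun i => ?_
  rw [ENNReal.toReal_ofReal (hω0 i)]

variable [IsProbabilityMeasure Pr]

theorem integral_mul_eq_zero_of_condExp_eq_zero {m : MeasurableSpace Ω} (hm : m ≤ mΩ)
    {f g : Ω → ℝ} (hf : StronglyMeasurable[m] f) (hf2 : MemLp f 2 Pr) (hg2 : MemLp g 2 Pr)
    (hg : Pr[g | m] =ᵐ[Pr] 0) : ∫ ω, f ω * g ω ∂Pr = 0 := by
  have hi : Integrable (f * g) Pr := hf2.integrable_mul hg2
  have h := condExp_mul_of_stronglyMeasurable_left hf hi (hg2.integrable (by norm_num))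
  have h0 : Pr[f * g | m] =ᵐ[Pr] 0 := by
    filter_upwards [h, hg] with ω h1 h2
    rw [h1, Pi.mul_apply, h2]
    simp
  calc ∫ ω, f ω * g ω ∂Pr = ∫ ω, (Pr[f * g | m]) ω ∂Pr := (integral_condExp hm).symm
    _ = ∫ ω, (0 : Ω → ℝ) ω ∂Pr := integral_congr_ae h0
    _ = 0 := by simp

theorem condExp_sub_condExp_eq_zero {m : MeasurableSpace Ω} (hm : m ≤ mΩ)
    {g : Ω → ℝ} (hg : Integrable g Pr) : Pr[g - Pr[g | m] | m] =ᵐ[Pr] 0 := by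
  have h := condExp_sub hg (integrable_condExp (m := m) (μ := Pr) (f := g)) m
  rw [condExp_of_stronglyMeasurable hm stronglyMeasurable_condExp integrable_condExp] at h
  exact h.trans (by simp)

/-- Conditional expectation is an orthogonal projection in `L²`, so Pythagoras applies. -/
theorem integral_sub_condExp_sq_le {m : MeasurableSpace Ω} (hm : m ≤ mΩ)
    {g : Ω → ℝ} (hg : MemLp g 2 Pr) :
    ∫ ω, (g ω - (Pr[g | m]) ω) ^ 2 ∂Pr ≤ ∫ ω, g ω ^ 2 ∂Pr := by
  set h := Pr[g | m]
  have hh2 : MemLp h 2 Pr := hg.condExp (by norm_num)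
  have hD : MemLp (g - h) 2 Pr := hg.sub hh2
  have h0 : ∫ ω, h ω * (g - h) ω ∂Pr = 0 :=
    integral_mul_eq_zero_of_condExp_eq_zero hm stronglyMeasurable_condExp hh2 hD
      (condExp_sub_condExp_eq_zero hm (hg.integrable (by norm_num)))
  have i1 : Integrable (fun ω => (g ω - h ω) ^ 2) Pr := hD.integrable_sq
  have i2 : Integrable (fun ω => 2 * (h ω * (g - h) ω)) Pr :=
    (hh2.integrable_mul hD).const_mul 2
  have e : ∀ ω, g ω ^ 2 = (g ω - h ω) ^ 2 + 2 * (h ω * (g - h) ω) + h ω ^ 2 := fun ω => by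
    simp only [Pi.sub_apply]
    ring
  have : ∫ ω, g ω ^ 2 ∂Pr = ∫ ω, (g ω - h ω) ^ 2 ∂Pr + ∫ ω, h ω ^ 2 ∂Pr := by
    simp_rw [e]
    have i3 : Integrable (fun ω => (g ω - h ω) ^ 2 + 2 * (h ω * (g - h) ω)) Pr := i1.add i2
    rw [integral_add i3 hh2.integrable_sq, integral_add i1 i2, integral_const_mul, h0]
    ring
  have : 0 ≤ ∫ ω, h ω ^ 2 ∂Pr := integral_nonneg fun ω => sq_nonneg _
  linarith

/-- A series of martingale differences with summable second moments converges almost surely. -/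
theorem ae_exists_tendsto_sum_of_condExp_eq_zero (ℱ : Filtration ℕ mΩ) {ξ : ℕ → Ω → ℝ}
    (hadp : ∀ i, StronglyMeasurable[ℱ (i + 1)] (ξ i)) (hL2 : ∀ i, MemLp (ξ i) 2 Pr)
    (hzero : ∀ i, Pr[ξ i | ℱ i] =ᵐ[Pr] 0) {v : ℕ → ℝ} (hv : ∀ i, ∫ ω, ξ i ω ^ 2 ∂Pr ≤ v i)
    (hvs : Summable v) :
    ∀ᵐ ω ∂Pr, ∃ l, Tendsto (fun n => ∑ i ∈ Finset.range n, ξ i ω) atTop (𝓝 l) := by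
  set S : ℕ → Ω → ℝ := fun n ω => ∑ i ∈ Finset.range n, ξ i ω with hS
  have hS2 : ∀ n, MemLp (S n) 2 Pr := fun n => memLp_finsetSum _ fun i _ => hL2 i
  have hsucc : ∀ n, S (n + 1) - S n = ξ n := fun n => by
    funext ω
    simp [hS, Finset.sum_range_succ]
  have hSm : ∀ n, StronglyMeasurable[ℱ n] (S n) := fun n =>
    Finset.stronglyMeasurable_fun_sum _ fun i hi =>
      (hadp i).mono (ℱ.mono (Nat.succ_le_of_lt (Finset.mem_range.1 hi)))
  have hmart : Martingale S ℱ Pr :=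
    martingale_of_condExp_sub_eq_zero_nat hSm (fun n => (hS2 n).integrable (by norm_num))
      fun n => by rw [hsucc]; exact hzero n
  have hv0 : ∀ i, 0 ≤ v i := fun i => (integral_nonneg fun ω => sq_nonneg _).trans (hv i)
  -- Each increment is orthogonal to the preceding partial sum, so second moments add up.
  have hsq : ∀ n, ∫ ω, S n ω ^ 2 ∂Pr ≤ ∑ i ∈ Finset.range n, v i := by
    intro n
    induction n with
    | zero => simp [hS]
    | succ n ih =>
      have e : ∀ ω, S (n + 1) ω ^ 2 = S n ω ^ 2 + 2 * (S n ω * ξ n ω) + ξ n ω ^ 2 := fun ω => by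
        simp only [hS, Finset.sum_range_succ]
        ring
      simp_rw [e]
      have i2 : Integrable (fun ω => 2 * (S n ω * ξ n ω)) Pr :=
        ((hS2 n).integrable_mul (hL2 n)).const_mul 2
      have i3 : Integrable (fun ω => S n ω ^ 2 + 2 * (S n ω * ξ n ω)) Pr :=
        (hS2 n).integrable_sq.add i2
      rw [integral_add i3 (hL2 n).integrable_sq,
        integral_add (hS2 n).integrable_sq i2, integral_const_mul,
        integral_mul_eq_zero_of_condExp_eq_zero (ℱ.le n) (hSm n) (hS2 n) (hL2 n) (hzero n),
        Finset.sum_range_succ]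
      linarith [hv n]
  -- Martingale convergence needs only an `L¹` bound, obtained from the second moments through `|s|
  -- ≤ 1 + s²`.
  refine hmart.submartingale.exists_ae_tendsto_of_bdd (R := (1 + ∑' i, v i).toNNReal) fun n =>
    eLpNorm_one_le_of_integral_abs_le ((hS2 n).integrable (by norm_num)) ?_
  calc ∫ ω, |S n ω| ∂Pr ≤ ∫ ω, (1 + S n ω ^ 2) ∂Pr :=
        integral_mono ((hS2 n).integrable (by norm_num)).abs
          ((integrable_const _).add (hS2 n).integrable_sq) fun ω => by
            simp only
            nlinarith [sq_nonneg (|S n ω| - 1), sq_abs (S n ω)]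
    _ = 1 + ∫ ω, S n ω ^ 2 ∂Pr := by
        rw [integral_add (integrable_const _) (hS2 n).integrable_sq]
        simp
    _ ≤ _ := by
        gcongr
        exact (hsq n).trans (hvs.sum_le_tsum _ fun i _ => hv0 i)

theorem ae_exists_tendsto_sum_mul_sub_condExp (ℱ : Filtration ℕ mΩ) {g : ℕ → Ω → ℝ}
    (hadp : ∀ i, StronglyMeasurable[ℱ (i + 1)] (g i)) (hL2 : ∀ i, MemLp (g i) 2 Pr)
    {C : ℝ} (hC : ∀ i, ∫ ω, g i ω ^ 2 ∂Pr ≤ C) {c : ℕ → ℝ} (hc : Summable fun i => c i ^ 2) :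
    ∀ᵐ ω ∂Pr, ∃ l, Tendsto (fun n => ∑ i ∈ Finset.range n, c i * (g i ω - (Pr[g i | ℱ i]) ω))
      atTop (𝓝 l) := by
  refine ae_exists_tendsto_sum_of_condExp_eq_zero ℱ
    (ξ := fun i ω => c i * (g i ω - (Pr[g i | ℱ i]) ω)) (v := fun i => c i ^ 2 * C)
    (fun i => ?_) (fun i => ?_) (fun i => ?_) (fun i => ?_) (hc.mul_right C)
  · exact ((hadp i).sub (stronglyMeasurable_condExp.mono (ℱ.mono (Nat.le_succ i)))).const_mul _
  · exact ((hL2 i).sub ((hL2 i).condExp (by norm_num))).const_mul _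
  · have h0 := condExp_sub_condExp_eq_zero (ℱ.le i) ((hL2 i).integrable (by norm_num))
    have h1 := condExp_smul (μ := Pr) (c i) (g i - Pr[g i | ℱ i]) (ℱ i)
    filter_upwards [h0, h1] with ω h0 h1
    change (Pr[c i • (g i - Pr[g i | ℱ i]) | ℱ i]) ω = 0
    rw [h1, Pi.smul_apply, h0]
    simp
  · simp_rw [mul_pow]
    rw [integral_const_mul]
    exact mul_le_mul_of_nonneg_left
      ((integral_sub_condExp_sq_le (ℱ.le i) (hL2 i)).trans (hC i)) (sq_nonneg _)

end Martingale

/-! ### Conditioning an i.i.d. sequence on its past, and almost supermartingales. -/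

section Past

variable {Ω 𝒴 : Type*} {mΩ : MeasurableSpace Ω} {Pr : Measure Ω} [IsProbabilityMeasure Pr]
  [MeasurableSpace 𝒴] {Y : ℕ → Ω → 𝒴} {P : Measure 𝒴}

/-- The sequence of the first `n` observations, continued with the constant `y₀`. -/
def pastPath {Ω 𝒴 : Type*} (Y : ℕ → Ω → 𝒴) (y₀ : 𝒴) (n : ℕ) (ω : Ω) : ℕ → 𝒴 :=
  fun j => if j < n then Y j ω else y₀

theorem measurable_pastPath (hY : ∀ i, Measurable (Y i)) (y₀ : 𝒴) (n : ℕ) :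
    Measurable (pastPath Y y₀ n) := by
  refine measurable_pi_lambda _ fun j => ?_
  by_cases h : j < n <;> simp [pastPath, h, hY j]

theorem pastPath_succ {Ω 𝒴 : Type*} (Y : ℕ → Ω → 𝒴) (y₀ : 𝒴) (n : ℕ) (ω : Ω) :
    pastPath Y y₀ (n + 1) ω = Function.update (pastPath Y y₀ n ω) n (Y n ω) := by
  funext j
  rcases eq_or_ne j n with rfl | h
  · simp [pastPath]
  · simp only [pastPath, Function.update_of_ne h]
    congr 1
    simp only [eq_iff_iff]
    omega

/-- The filtration generated by the past observations. -/
def pastFiltration (hY : ∀ i, Measurable (Y i)) (y₀ : 𝒴) : Filtration ℕ mΩ where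
  seq n := MeasurableSpace.comap (pastPath Y y₀ n) inferInstance
  mono' := by
    intro n m hnm
    have hT : Measurable fun (x : ℕ → 𝒴) (j : ℕ) => if j < n then x j else y₀ := by
      refine measurable_pi_lambda _ fun j => ?_
      by_cases h : j < n
      · simpa [h] using measurable_pi_apply j
      · simp [h]
    have e : pastPath Y y₀ n =
        (fun (x : ℕ → 𝒴) (j : ℕ) => if j < n then x j else y₀) ∘ pastPath Y y₀ m := by
      funext ω j
      by_cases h : j < n
      · simp [pastPath, h, h.trans_le hnm]
      · simp [pastPath, h]
    simp only [e, ← MeasurableSpace.comap_comp]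
    exact MeasurableSpace.comap_mono hT.comap_le
  le' n := (measurable_pastPath hY y₀ n).comap_le

theorem stronglyMeasurable_comp_pastPath (hY : ∀ i, Measurable (Y i)) (y₀ : 𝒴) (n : ℕ)
    {φ : (ℕ → 𝒴) → ℝ} (hφ : Measurable φ) :
    StronglyMeasurable[pastFiltration hY y₀ n] fun ω => φ (pastPath Y y₀ n ω) :=
  (hφ.comp (comap_measurable (pastPath Y y₀ n))).stronglyMeasurable

theorem stronglyMeasurable_comp_pastPath_prod (hY : ∀ i, Measurable (Y i)) (y₀ : 𝒴) (n : ℕ)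
    {φ : (ℕ → 𝒴) × 𝒴 → ℝ} (hφ : Measurable φ) :
    StronglyMeasurable[pastFiltration hY y₀ (n + 1)]
      fun ω => φ (pastPath Y y₀ n ω, Y n ω) := by
  have h1 : Measurable[pastFiltration hY y₀ (n + 1)] (pastPath Y y₀ n) :=
    (comap_measurable (pastPath Y y₀ n)).mono
      ((pastFiltration hY y₀).mono (Nat.le_succ n)) le_rfl
  have h2 : Measurable[pastFiltration hY y₀ (n + 1)] (Y n) := by
    have e : Y n = fun ω => pastPath Y y₀ (n + 1) ω n := by
      funext ω
      simp [pastPath]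
    rw [e]
    exact (measurable_pi_apply n).comp (comap_measurable (pastPath Y y₀ (n + 1)))
  exact (hφ.comp (h1.prodMk h2)).stronglyMeasurable

theorem indepFun_pastPath {Ω : Type*} {mΩ : MeasurableSpace Ω} {Pr : Measure Ω} {Y : ℕ → Ω → 𝒴}
    (hY : ∀ i, Measurable (Y i)) (hind : iIndepFun Y Pr) (y₀ : 𝒴) (n : ℕ) :
    IndepFun (pastPath Y y₀ n) (Y n) Pr := by
  have h := hind.indepFun_finset (Finset.range n) {n} (by simp) hY
  have hφ : Measurable fun (v : Finset.range n → 𝒴) (j : ℕ) =>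
      if hj : j ∈ Finset.range n then v ⟨j, hj⟩ else y₀ := by
    refine measurable_pi_lambda _ fun j => ?_
    by_cases hj : j ∈ Finset.range n
    · simpa only [hj, dite_true] using measurable_pi_apply _
    · simp only [hj, dite_false, measurable_const]
  have hψ : Measurable fun v : ({n} : Finset ℕ) → 𝒴 => v ⟨n, Finset.mem_singleton_self n⟩ :=
    measurable_pi_apply _
  have e1 : pastPath Y y₀ n = (fun (v : Finset.range n → 𝒴) (j : ℕ) =>
      if hj : j ∈ Finset.range n then v ⟨j, hj⟩ else y₀) ∘
        fun ω (i : Finset.range n) => Y i ω := by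
    funext ω j
    simp [pastPath]
  rw [e1]
  exact h.comp hφ hψ

theorem map_pastPath_prod (hY : ∀ i, Measurable (Y i)) (hind : iIndepFun Y Pr)
    (hlaw : ∀ i, Pr.map (Y i) = P) (y₀ : 𝒴) (n : ℕ) :
    Pr.map (fun ω => (pastPath Y y₀ n ω, Y n ω)) = (Pr.map (pastPath Y y₀ n)).prod P := by
  rw [(indepFun_iff_map_prod_eq_prod_map_map (measurable_pastPath hY y₀ n).aemeasurable
    (hY n).aemeasurable).1 (indepFun_pastPath hY hind y₀ n), hlaw]

theorem lintegral_pastPath (hY : ∀ i, Measurable (Y i)) (hind : iIndepFun Y Pr)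
    (hlaw : ∀ i, Pr.map (Y i) = P) (y₀ : 𝒴) (n : ℕ) [SFinite P] {φ : (ℕ → 𝒴) × 𝒴 → ℝ≥0∞}
    (hφ : Measurable φ) :
    ∫⁻ ω, φ (pastPath Y y₀ n ω, Y n ω) ∂Pr = ∫⁻ ω, ∫⁻ y, φ (pastPath Y y₀ n ω, y) ∂P ∂Pr := by
  have hX := measurable_pastPath hY y₀ n
  rw [← lintegral_map hφ (hX.prodMk (hY n)), map_pastPath_prod hY hind hlaw,
    lintegral_prod _ hφ.aemeasurable, lintegral_map hφ.lintegral_prod_right' hX]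

/-- The past is independent of the next observation, so their joint law is a product. Conditioning
freezes the past and integrates out the last coordinate; Fubini on the sets `t ×ˢ univ` checks this.
-/
theorem condExp_pastPath (hY : ∀ i, Measurable (Y i)) (hind : iIndepFun Y Pr)
    (hlaw : ∀ i, Pr.map (Y i) = P) (y₀ : 𝒴) (n : ℕ) [SFinite P] {φ : (ℕ → 𝒴) × 𝒴 → ℝ}
    (hφ : Measurable φ) (hint : Integrable (fun ω => φ (pastPath Y y₀ n ω, Y n ω)) Pr) :
    Pr[fun ω => φ (pastPath Y y₀ n ω, Y n ω) | pastFiltration hY y₀ n] =ᵐ[Pr]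
      fun ω => ∫ y, φ (pastPath Y y₀ n ω, y) ∂P := by
  have hX := measurable_pastPath hY y₀ n
  have hpair := hX.prodMk (hY n)
  have hmap := map_pastPath_prod hY hind hlaw y₀ n
  have hint' : Integrable φ ((Pr.map (pastPath Y y₀ n)).prod P) := by
    rw [← hmap, integrable_map_measure hφ.aestronglyMeasurable hpair.aemeasurable]
    exact hint
  have hm : Measurable fun x => ∫ y, φ (x, y) ∂P :=
    (StronglyMeasurable.integral_prod_right' hφ.stronglyMeasurable).measurable
  have hi2 : Integrable (fun ω => ∫ y, φ (pastPath Y y₀ n ω, y) ∂P) Pr :=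
    (integrable_map_measure hm.aestronglyMeasurable hX.aemeasurable).1 hint'.integral_prod_left
  refine (ae_eq_condExp_of_forall_setIntegral_eq ((pastFiltration hY y₀).le n) hint
    (fun s _ _ => hi2.integrableOn) ?_
    (stronglyMeasurable_comp_pastPath hY y₀ n hm).aestronglyMeasurable).symm
  rintro s ⟨t, ht, rfl⟩ -
  have h1 : ∫ ω in pastPath Y y₀ n ⁻¹' t, φ (pastPath Y y₀ n ω, Y n ω) ∂Pr =
      ∫ q in t ×ˢ Set.univ, φ q ∂((Pr.map (pastPath Y y₀ n)).prod P) := by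
    rw [← hmap, setIntegral_map (ht.prod MeasurableSet.univ) hφ.aestronglyMeasurable
      hpair.aemeasurable]
    congr 2
    ext ω
    simp
  have h2 : ∫ ω in pastPath Y y₀ n ⁻¹' t, (∫ y, φ (pastPath Y y₀ n ω, y) ∂P) ∂Pr =
      ∫ x in t, (∫ y, φ (x, y) ∂P) ∂(Pr.map (pastPath Y y₀ n)) := by
    rw [setIntegral_map ht hm.aestronglyMeasurable hX.aemeasurable]
  rw [h1, h2, setIntegral_prod _ hint'.integrableOn]
  simp

/-- A strong-law type series: weighted deviations of functions of the observation and its past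
from their conditional means converge almost surely. -/
theorem ae_exists_tendsto_sum_pastPath (hY : ∀ i, Measurable (Y i)) (hind : iIndepFun Y Pr)
    (hlaw : ∀ i, Pr.map (Y i) = P) (y₀ : 𝒴) [SFinite P] {φ : ℕ → (ℕ → 𝒴) × 𝒴 → ℝ}
    (hφ : ∀ i, Measurable (φ i)) {C : ℝ≥0}
    (hC : ∀ i, ∀ᵐ ω ∂Pr, ∫⁻ y, ENNReal.ofReal (φ i (pastPath Y y₀ i ω, y) ^ 2) ∂P ≤ C)
    {c : ℕ → ℝ} (hc : Summable fun i => c i ^ 2) :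
    ∀ᵐ ω ∂Pr, ∃ l, Tendsto (fun n => ∑ i ∈ Finset.range n, c i *
      (φ i (pastPath Y y₀ i ω, Y i ω) - ∫ y, φ i (pastPath Y y₀ i ω, y) ∂P)) atTop (𝓝 l) := by
  set g : ℕ → Ω → ℝ := fun i ω => φ i (pastPath Y y₀ i ω, Y i ω) with hg
  have hgm : ∀ i, Measurable (g i) := fun i =>
    (hφ i).comp ((measurable_pastPath hY y₀ i).prodMk (hY i))
  have hl : ∀ i, ∫⁻ ω, ENNReal.ofReal (g i ω ^ 2) ∂Pr ≤ C := by
    intro i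
    have h := lintegral_pastPath hY hind hlaw y₀ i (φ := fun q => ENNReal.ofReal (φ i q ^ 2))
      ((hφ i).pow_const 2).ennreal_ofReal
    rw [hg]
    simp only at h ⊢
    rw [h]
    calc _ ≤ ∫⁻ _, (C : ℝ≥0∞) ∂Pr := lintegral_mono_ae (hC i)
      _ = C := by simp
  have hi : ∀ i, Integrable (fun ω => g i ω ^ 2) Pr := fun i => by
    refine ⟨((hgm i).pow_const 2).aestronglyMeasurable, ?_⟩
    rw [hasFiniteIntegral_iff_ofReal (ae_of_all _ fun y => sq_nonneg _)]
    exact (hl i).trans_lt ENNReal.coe_lt_top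
  have hL2 : ∀ i, MemLp (g i) 2 Pr := fun i =>
    (memLp_two_iff_integrable_sq (hgm i).aestronglyMeasurable).2 (hi i)
  have h := ae_exists_tendsto_sum_mul_sub_condExp (pastFiltration hY y₀)
    (fun i => stronglyMeasurable_comp_pastPath_prod hY y₀ i (hφ i)) hL2 (C := C) (fun i => by
      rw [integral_eq_lintegral_of_nonneg_ae (ae_of_all _ fun y => sq_nonneg _)
        ((hgm i).pow_const 2).aestronglyMeasurable]
      exact ENNReal.toReal_le_coe_of_le_coe (hl i)) hc
  have hce := ae_all_iff.2 fun i => condExp_pastPath hY hind hlaw y₀ i (hφ i)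
    ((hL2 i).integrable (by norm_num))
  filter_upwards [h, hce] with ω h1 h2
  obtain ⟨l, hl⟩ := h1
  refine ⟨l, hl.congr fun n => Finset.sum_congr rfl fun i _ => ?_⟩
  rw [h2 i]

/-- Almost sure convergence for almost supermartingales depending on the past observations. -/
theorem ae_exists_tendsto_mul_pastPath (hY : ∀ i, Measurable (Y i)) (hind : iIndepFun Y Pr)
    (hlaw : ∀ i, Pr.map (Y i) = P) (y₀ : 𝒴) [SFinite P] {κ : ℕ → (ℕ → 𝒴) → ℝ}
    (hκ : ∀ n, Measurable (κ n)) {B : ℝ}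
    (h0 : ∀ n, ∀ᵐ ω ∂Pr, 0 ≤ κ n (pastPath Y y₀ n ω))
    (hB : ∀ n, ∀ᵐ ω ∂Pr, κ n (pastPath Y y₀ n ω) ≤ B) {ε c : ℕ → ℝ} (hε : ∀ n, 0 ≤ ε n)
    (hstep : ∀ n, ∀ᵐ ω ∂Pr, ∫ y, κ (n + 1) (Function.update (pastPath Y y₀ n ω) n y) ∂P ≤
      κ n (pastPath Y y₀ n ω) + ε n)
    (hc0 : ∀ n, 0 ≤ c n) (hc : Monotone c) (hcε : Summable fun n => c (n + 1) * ε n) {D : ℝ}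
    (hD : ∀ n, ∑ i ∈ Finset.range n, (c (i + 1) - c i) *
      ∫ ω, κ i (pastPath Y y₀ i ω) ∂Pr ≤ D) :
    ∀ᵐ ω ∂Pr, ∃ l, Tendsto (fun n => c n * κ n (pastPath Y y₀ n ω)) atTop (𝓝 l) := by
  set K : ℕ → Ω → ℝ := fun n ω => κ n (pastPath Y y₀ n ω) with hK
  set ℱ := pastFiltration hY y₀
  have hKm : ∀ n, StronglyMeasurable[ℱ n] (K n) := fun n =>
    stronglyMeasurable_comp_pastPath hY y₀ n (hκ n)
  have hKi : ∀ n, Integrable (K n) Pr := fun n => by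
    refine Integrable.of_bound ((hKm n).mono (ℱ.le n)).aestronglyMeasurable B ?_
    filter_upwards [h0 n, hB n] with ω h1 h2
    rw [Real.norm_of_nonneg h1]
    exact h2
  set S : ℕ → Ω → ℝ := fun n ω => ∑ i ∈ Finset.range n, (c (i + 1) - c i) * K i ω with hSdef
  set T : ℕ → ℝ := fun n => ∑ i ∈ Finset.range n, c (i + 1) * ε i with hT
  -- Robbins–Siegmund compensation with weights: the increment of `U` is `c (n + 1) * (K n + ε n - K
  -- (n + 1))`, whose conditional mean is nonnegative by `hstep`. Thus `U` is a submartingale.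
  set U : ℕ → Ω → ℝ := fun n ω => S n ω + T n - c n * K n ω with hU
  have hSi : ∀ n, Integrable (S n) Pr := fun n =>
    integrable_finsetSum _ fun i _ => (hKi i).const_mul _
  have hSTi : ∀ n, Integrable (fun ω => S n ω + T n) Pr := fun n =>
    (hSi n).add (integrable_const _)
  have hUi : ∀ n, Integrable (U n) Pr := fun n =>
    (hSTi n).sub ((hKi n).const_mul _)
  have hSm : ∀ n, StronglyMeasurable[ℱ n] (S n) := fun n =>
    Finset.stronglyMeasurable_fun_sum _ fun i hi =>
      ((hKm i).mono (ℱ.mono (Finset.mem_range.1 hi).le)).const_mul _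
  have hUm : ∀ n, StronglyMeasurable[ℱ n] (U n) := fun n =>
    ((hSm n).add stronglyMeasurable_const).sub ((hKm n).const_mul _)
  have hsub : Submartingale U ℱ Pr := by
    refine submartingale_of_condExp_sub_nonneg_nat hUm hUi fun n => ?_
    set φ : (ℕ → 𝒴) × 𝒴 → ℝ := fun q =>
      c (n + 1) * (κ n q.1 + ε n - κ (n + 1) (Function.update q.1 n q.2)) with hφ
    have hupd : Measurable fun q : (ℕ → 𝒴) × 𝒴 => Function.update q.1 n q.2 := by
      refine measurable_pi_lambda _ fun j => ?_
      rcases eq_or_ne j n with rfl | hj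
      · simpa using measurable_snd
      · simp only [Function.update_of_ne hj]
        exact (measurable_pi_apply j).comp measurable_fst
    have hφm : Measurable φ := ((((hκ n).comp measurable_fst).add_const _).sub
      ((hκ (n + 1)).comp hupd)).const_mul _
    have e : U (n + 1) - U n = fun ω => φ (pastPath Y y₀ n ω, Y n ω) := by
      funext ω
      simp only [hU, hφ, hSdef, hT, hK, Pi.sub_apply, Finset.sum_range_succ, pastPath_succ]
      ring
    have hint : Integrable (fun ω => φ (pastPath Y y₀ n ω, Y n ω)) Pr := by
      rw [← e]
      exact (hUi _).sub (hUi _)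
    rw [e]
    filter_upwards [condExp_pastPath hY hind hlaw y₀ n hφm hint, hstep n] with ω h1 h2
    rw [h1]
    simp only [hφ, Pi.zero_apply]
    rw [integral_const_mul]
    refine mul_nonneg (hc0 _) ?_
    by_cases hi : Integrable (fun y => κ (n + 1) (Function.update (pastPath Y y₀ n ω) n y)) P
    · have : IsProbabilityMeasure P := by
        rw [← hlaw 0]
        exact Measure.isProbabilityMeasure_map (hY 0).aemeasurable
      rw [integral_sub (integrable_const _) hi]
      simp only [integral_const, probReal_univ, smul_eq_mul, one_mul]
      linarith
    -- If the updated value is not integrable in `y`, neither is the increment, and its integral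
    -- takes the default value `0`, which is still nonnegative.
    · rw [integral_undef]
      intro hcon
      have : IsProbabilityMeasure P := by
        rw [← hlaw 0]
        exact Measure.isProbabilityMeasure_map (hY 0).aemeasurable
      refine hi ?_
      have := (integrable_const (κ n (pastPath Y y₀ n ω) + ε n)).sub hcon
      refine this.congr (ae_of_all _ fun y => ?_)
      simp
  have hS0 : ∀ n, 0 ≤ᵐ[Pr] S n := fun n => by
    filter_upwards [ae_all_iff.2 h0] with ω hω
    exact Finset.sum_nonneg fun i _ => mul_nonneg (sub_nonneg.2 (hc (Nat.le_succ i))) (hω i)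
  have hSint : ∀ n, ∫ ω, S n ω ∂Pr ≤ D := fun n => by
    rw [hSdef]
    simp only
    rw [integral_finsetSum _ fun i _ => (hKi i).const_mul _]
    simp_rw [integral_const_mul]
    exact hD n
  have hT0 : ∀ n, 0 ≤ T n := fun n => Finset.sum_nonneg fun i _ => mul_nonneg (hc0 _) (hε i)
  have hTle : ∀ n, T n ≤ ∑' i, c (i + 1) * ε i := fun n =>
    hcε.sum_le_tsum _ fun i _ => mul_nonneg (hc0 _) (hε i)
  set τ := ∑' i, c (i + 1) * ε i
  have hUint : ∀ n, ∫ ω, U n ω ∂Pr = ∫ ω, S n ω ∂Pr + T n - c n * ∫ ω, K n ω ∂Pr := fun n => by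
    rw [hU]
    simp only
    rw [integral_sub (hSTi n) ((hKi n).const_mul _),
      integral_add (hSi n) (integrable_const _), integral_const_mul]
    simp
  have hU0 : ∀ n, ∫ ω, U 0 ω ∂Pr ≤ ∫ ω, U n ω ∂Pr := fun n => by
    have h := hsub.setIntegral_le (Nat.zero_le n) MeasurableSet.univ
    simpa using h
  -- Means of a submartingale increase, so `E U 0 ≤ E U n` bounds `c n * E K n` by `E S n + T n + c
  -- 0 * E K 0`; insert this into `|U| ≤ S + T + c K`.
  have hbdd : ∀ n, ∫ ω, |U n ω| ∂Pr ≤ 2 * (D + τ) + c 0 * ∫ ω, K 0 ω ∂Pr := fun n => by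
    have h1 := hU0 n
    rw [hUint, hUint] at h1
    have h2 : ∫ ω, S 0 ω ∂Pr = 0 := by simp [hSdef]
    have h3 : T 0 = 0 := by simp [hT]
    have h4 : ∫ ω, |U n ω| ∂Pr ≤ ∫ ω, (S n ω + T n + c n * K n ω) ∂Pr := by
      refine integral_mono_ae (hUi n).abs
        ((hSTi n).add ((hKi n).const_mul _)) ?_
      filter_upwards [hS0 n, h0 n] with ω ha hb
      have hb' := mul_nonneg (hc0 n) hb
      have := hT0 n
      simp only [hU]
      rw [abs_le]
      simp only [Pi.zero_apply] at ha
      constructor <;> simp only [hK] <;> linarith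
    rw [integral_add (hSTi n) ((hKi n).const_mul _),
      integral_add (hSi n) (integrable_const _), integral_const_mul] at h4
    simp only [integral_const, probReal_univ, smul_eq_mul, one_mul] at h4
    have := hSint n
    have := hTle n
    linarith
  have hconv := hsub.exists_ae_tendsto_of_bdd fun n =>
    eLpNorm_one_le_of_integral_abs_le (hUi n) (hbdd n)
  have hsum : ∀ᵐ ω ∂Pr, Summable fun i => (c (i + 1) - c i) * K i ω := by
    refine ae_summable_of_sum_integral_le (fun i => (hKi i).const_mul _) (fun i => ?_) (D := D)
      fun n => ?_
    · filter_upwards [h0 i] with ω hω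
      exact mul_nonneg (sub_nonneg.2 (hc (Nat.le_succ i))) hω
    · simp_rw [integral_const_mul]
      exact hD n
  -- Since `c K = S + T - U`, convergence of the three terms gives the claim.
  filter_upwards [hconv, hsum] with ω ⟨l, hl⟩ hs
  refine ⟨_, ((hs.hasSum.tendsto_sum_nat.add hcε.hasSum.tendsto_sum_nat).sub hl).congr fun n => ?_⟩
  simp only [hU, hSdef, hT]
  ring

end Past

end PredRec

namespace PredRec

/-! ### Deterministic sequences: Kronecker, Abel and Hardy. -/

section Sequences

/-- If `a > 0` then eventually `e > a / 2`, and the weighted sums exceed `a / 2` times the divergent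
sum of weights up to a constant. -/
theorem nonpos_of_sum_mul_le {w e : ℕ → ℝ} {a C : ℝ} (hw : ∀ n, 0 ≤ w n)
    (hsum : Tendsto (partialSum w) atTop atTop) (he : Tendsto e atTop (𝓝 a))
    (hC : ∀ n, ∑ i ∈ Finset.range n, w i * e i ≤ C) : a ≤ 0 := by
  by_contra! ha
  obtain ⟨N, hN⟩ := eventually_atTop.1 (he.eventually (lt_mem_nhds (half_lt_self ha)))
  have h1 : ∀ m, ∑ i ∈ Finset.range N, w i * (e i - a / 2) ≤
      ∑ i ∈ Finset.range (N + m), w i * (e i - a / 2) := fun m =>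
    Finset.sum_le_sum_of_subset_of_nonneg (Finset.range_mono (Nat.le_add_right N m))
      fun i _ hi => mul_nonneg (hw i) (sub_nonneg.2 (hN i (by simpa using hi)).le)
  have h2 : ∀ n, ∑ i ∈ Finset.range n, w i * (e i - a / 2) =
      ∑ i ∈ Finset.range n, w i * e i - partialSum w n * (a / 2) := fun n => by
    simp only [mul_sub, Finset.sum_sub_distrib, partialSum, Finset.sum_mul]
  have h3 : Tendsto (fun n => partialSum w n * (a / 2)) atTop atTop :=
    hsum.atTop_mul_const (half_pos ha)
  obtain ⟨n, hn, hnN⟩ := ((h3.eventually_gt_atTop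
    (C - ∑ i ∈ Finset.range N, w i * (e i - a / 2))).and (eventually_ge_atTop N)).exists
  obtain ⟨m, rfl⟩ := Nat.exists_eq_add_of_le hnN
  have := h1 m
  rw [h2 (N + m)] at this
  linarith [hC (N + m)]

/-- Square summability sends the weights to `0`, so only finitely many exceed `1 / 2`, and each of
those is below `1`. -/
theorem exists_pos_forall_le_one_sub {w : ℕ → ℝ} (hw : ∀ n, w n ∈ Set.Ioo (0 : ℝ) 1)
    (hsq : Summable fun n => w n ^ 2) : ∃ η > 0, ∀ n, w n ≤ 1 - η := by
  have h0 : Tendsto w atTop (𝓝 0) := by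
    have h := hsq.tendsto_atTop_zero.sqrt
    simp only [Real.sqrt_zero] at h
    exact h.congr fun n => Real.sqrt_sq (hw n).1.le
  obtain ⟨N, hN⟩ := eventually_atTop.1 (h0.eventually (gt_mem_nhds (half_pos one_pos)))
  have key : ∀ M, ∃ η > 0, ∀ n < M, w n ≤ 1 - η := by
    intro M
    induction M with
    | zero => exact ⟨1, one_pos, fun n hn => absurd hn (Nat.not_lt_zero n)⟩
    | succ M ih =>
      obtain ⟨η, hη, h⟩ := ih
      refine ⟨min η (1 - w M), lt_min hη (sub_pos.2 (hw M).2), fun n hn => ?_⟩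
      rcases Nat.lt_succ_iff_lt_or_eq.1 hn with h1 | rfl
      · linarith [h n h1, min_le_left η (1 - w M)]
      · linarith [min_le_right η (1 - w n)]
  obtain ⟨η, hη, h⟩ := key N
  refine ⟨min η (1 / 2), lt_min hη (half_pos one_pos), fun n => ?_⟩
  rcases lt_or_ge n N with hn | hn
  · linarith [h n hn, min_le_left η (1 / 2)]
  · linarith [hN n hn, min_le_right η (1 / 2)]

/-- Kronecker's lemma: by summation by parts the mean is `s n` minus the Cesàro mean of `s`, and
both have the same limit. -/
theorem tendsto_mean_zero_of_tendsto_sum {x : ℕ → ℝ} {l : ℝ}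
    (h : Tendsto (fun n => ∑ i ∈ Finset.range n, ((i : ℝ) + 1)⁻¹ * x i) atTop (𝓝 l)) :
    Tendsto (fun n : ℕ => (n : ℝ)⁻¹ * ∑ i ∈ Finset.range n, x i) atTop (𝓝 0) := by
  set s : ℕ → ℝ := fun n => ∑ i ∈ Finset.range n, ((i : ℝ) + 1)⁻¹ * x i with hs
  have key : ∀ n : ℕ, ∑ i ∈ Finset.range n, x i = n * s n - ∑ i ∈ Finset.range n, s i := by
    intro n
    induction n with
    | zero => simp
    | succ n ih =>
      have e : s (n + 1) = s n + ((n : ℝ) + 1)⁻¹ * x n := Finset.sum_range_succ _ _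
      have hn : (n : ℝ) + 1 ≠ 0 := by positivity
      rw [Finset.sum_range_succ, Finset.sum_range_succ, ih, e]
      push_cast
      field_simp
      ring
  have h1 := h.sub h.cesaro
  rw [sub_self] at h1
  refine h1.congr' ?_
  filter_upwards [eventually_gt_atTop 0] with n hn
  have hn' : (n : ℝ) ≠ 0 := by positivity
  rw [key]
  simp only [hs]
  field_simp

/-- A bounded form of Kronecker's lemma. Abel summation writes the sum as `T / b` minus increments
of `1 / b` against `T`; those increments are nonnegative and telescope, so each piece is at most `S
/ b`. -/
theorem abs_mul_sum_le_of_abs_sum_le {b x : ℕ → ℝ} {S : ℝ} (hb : ∀ n, 0 < b n) (hbm : Antitone b)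
    (hS : ∀ n, |∑ i ∈ Finset.range n, b i * x i| ≤ S) (n : ℕ) :
    |b n * ∑ i ∈ Finset.range (n + 1), x i| ≤ 2 * S := by
  set T : ℕ → ℝ := fun n => ∑ i ∈ Finset.range n, b i * x i with hT
  have hS0 : 0 ≤ S := (abs_nonneg _).trans (hS 0)
  have key : ∀ n, |∑ i ∈ Finset.range (n + 1), x i - (b n)⁻¹ * T (n + 1)| ≤ S * (b n)⁻¹ := by
    intro n
    induction n with
    | zero =>
      have h0 : (∑ i ∈ Finset.range (0 + 1), x i) - (b 0)⁻¹ * T (0 + 1) = 0 := by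
        have := (hb 0).ne'
        simp only [hT, zero_add, Finset.sum_range_one]
        field_simp
        ring
      rw [h0, abs_zero]
      exact mul_nonneg hS0 (inv_nonneg.2 (hb 0).le)
    | succ n ih =>
      have e : T (n + 1 + 1) = T (n + 1) + b (n + 1) * x (n + 1) := Finset.sum_range_succ _ _
      have hbn := (hb (n + 1)).ne'
      have e2 : (∑ i ∈ Finset.range (n + 1 + 1), x i) - (b (n + 1))⁻¹ * T (n + 1 + 1) =
          (∑ i ∈ Finset.range (n + 1), x i - (b n)⁻¹ * T (n + 1)) -
            ((b (n + 1))⁻¹ - (b n)⁻¹) * T (n + 1) := by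
        rw [Finset.sum_range_succ, e]
        field_simp
        ring
      have hd : 0 ≤ (b (n + 1))⁻¹ - (b n)⁻¹ :=
        sub_nonneg.2 (inv_anti₀ (hb (n + 1)) (hbm (Nat.le_succ n)))
      rw [e2]
      refine (abs_sub _ _).trans ?_
      rw [abs_mul, abs_of_nonneg hd]
      have := mul_le_mul_of_nonneg_left (hS (n + 1)) hd
      simp only [hT] at this ih ⊢
      linarith
  have h1 := key n
  have hbn := hb n
  have e3 : b n * ∑ i ∈ Finset.range (n + 1), x i =
      b n * (∑ i ∈ Finset.range (n + 1), x i - (b n)⁻¹ * T (n + 1)) + T (n + 1) := by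
    field_simp
    ring
  rw [e3]
  refine (abs_add_le _ _).trans ?_
  rw [abs_mul, abs_of_pos hbn]
  have h2 := mul_le_mul_of_nonneg_left h1 hbn.le
  rw [mul_comm S, mul_inv_cancel_left₀ hbn.ne'] at h2
  have := hS (n + 1)
  simp only [hT] at h2 ⊢
  linarith

/-- **Hardy's inequality**: the averages of a square summable sequence are square summable. -/
theorem summable_partialSum_div_sq {w : ℕ → ℝ} (hsq : Summable fun n => w n ^ 2) :
    Summable fun n : ℕ => (partialSum w (n + 1) / ((n : ℝ) + 1)) ^ 2 := by
  set b : ℕ → ℝ := fun n => partialSum w (n + 1) / ((n : ℝ) + 1) with hb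
  -- This is the telescoping inequality behind Hardy's; its induction step reduces to `(b n - w n)²
  -- ≥ 0`. It is converted by `b² ≤ 2 (b² - 2 b w) + 4 w²`, that is `(b - 2 w)² ≥ 0`.
  have key : ∀ n : ℕ, ∑ i ∈ Finset.range n, (b i ^ 2 - 2 * b i * w i) ≤
      -(partialSum w n ^ 2 / n) := by
    intro n
    induction n with
    | zero => simp
    | succ n ih =>
      rw [Finset.sum_range_succ]
      have e : partialSum w (n + 1) = partialSum w n + w n := Finset.sum_range_succ _ _
      have hn1 : (n : ℝ) + 1 ≠ 0 := by positivity
      have hb' : partialSum w (n + 1) = (n + 1) * b n := by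
        simp only [hb]
        field_simp
      have ha : partialSum w n = (n + 1) * b n - w n := by linarith
      have e2 : partialSum w (n + 1) ^ 2 / ((n + 1 : ℕ) : ℝ) = (n + 1) * b n ^ 2 := by
        rw [hb']
        push_cast
        field_simp
      rw [e2]
      rcases Nat.eq_zero_or_pos n with rfl | hn
      · have h0 : b 0 = w 0 := by simp [hb, partialSum]
        simp only [Finset.range_zero, Finset.sum_empty, h0]
        push_cast
        nlinarith
      · have hn' : (0 : ℝ) < n := by positivity
        have h3 : (n + 2) * b n ^ 2 - 2 * b n * w n ≤ partialSum w n ^ 2 / n := by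
          rw [le_div_iff₀ hn', ha]
          nlinarith [sq_nonneg (b n - w n)]
        linarith
  refine summable_of_sum_range_le (c := 4 * ∑' n, w n ^ 2) (fun n => sq_nonneg _) fun n => ?_
  have h1 : ∑ i ∈ Finset.range n, b i ^ 2 ≤
      2 * ∑ i ∈ Finset.range n, (b i ^ 2 - 2 * b i * w i) + 4 * ∑ i ∈ Finset.range n, w i ^ 2 := by
    rw [Finset.mul_sum, Finset.mul_sum, ← Finset.sum_add_distrib]
    refine Finset.sum_le_sum fun i _ => ?_
    nlinarith [sq_nonneg (b i - 2 * w i)]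
  have h2 := key n
  have h3 : 0 ≤ partialSum w n ^ 2 / n := by positivity
  have h4 := hsq.sum_le_tsum (Finset.range n) fun i _ => sq_nonneg _
  linarith

theorem partialSum_succ (w : ℕ → ℝ) (n : ℕ) : partialSum w (n + 1) = partialSum w n + w n :=
  Finset.sum_range_succ _ _

theorem partialSum_nonneg {w : ℕ → ℝ} (hw : ∀ n, 0 ≤ w n) (n : ℕ) : 0 ≤ partialSum w n :=
  Finset.sum_nonneg fun i _ => hw i

theorem monotone_partialSum {w : ℕ → ℝ} (hw : ∀ n, 0 ≤ w n) : Monotone (partialSum w) :=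
  monotone_nat_of_le_succ fun n => by linarith [partialSum_succ w n, hw n]

theorem antitone_partialSum_div {w : ℕ → ℝ} (hw : Antitone w) :
    Antitone fun n : ℕ => partialSum w (n + 1) / ((n : ℝ) + 1) := by
  refine antitone_nat_of_succ_le fun n => ?_
  have h1 : ((n : ℝ) + 1) * w (n + 1) ≤ partialSum w (n + 1) := by
    have h := Finset.card_nsmul_le_sum (Finset.range (n + 1)) w (w (n + 1)) fun i hi =>
      hw (Finset.mem_range.1 hi).le
    simpa [partialSum] using h
  rw [partialSum_succ w (n + 1), div_le_div_iff₀ (by positivity) (by positivity)]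
  push_cast
  nlinarith

/-- Passing from `n` to `n + 1` adds `a_n κ_n ≤ M` and `w_n ∑_{i ≤ n} κ_i`. The latter is at most `∑
w_i κ_i ≤ D` because the weights are nonincreasing. -/
theorem partialSum_mul_sum_le {w κ : ℕ → ℝ} {M D : ℝ} (hw : Antitone w)
    (hκ : ∀ n, 0 ≤ κ n) (hM : ∀ n, partialSum w n * κ n ≤ M)
    (hD : ∀ n, ∑ i ∈ Finset.range n, w i * κ i ≤ D) (n : ℕ) :
    partialSum w n * ∑ i ∈ Finset.range n, κ i ≤ (M + D) * n := by
  induction n with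
  | zero => simp
  | succ n ih =>
    have h1 : w n * ∑ i ∈ Finset.range (n + 1), κ i ≤ D := by
      rw [Finset.mul_sum]
      refine (Finset.sum_le_sum fun i hi => ?_).trans (hD (n + 1))
      exact mul_le_mul_of_nonneg_right (hw (Nat.lt_succ_iff.1 (Finset.mem_range.1 hi))) (hκ i)
    rw [Finset.sum_range_succ] at h1 ⊢
    rw [partialSum_succ]
    push_cast
    have := hM n
    nlinarith

end Sequences

/-! ### The recursion driven by i.i.d. observations. -/

section PredictiveRecursion

variable {𝒰 𝒴 Ω : Type*} [MeasurableSpace 𝒰] [MeasurableSpace 𝒴] {mΩ : MeasurableSpace Ω}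
  {Pr : Measure Ω} [IsProbabilityMeasure Pr] {Y : ℕ → Ω → 𝒴} {P : Measure 𝒴}

theorem integrable_pastPath (hY : ∀ i, Measurable (Y i)) (hind : iIndepFun Y Pr)
    (hlaw : ∀ i, Pr.map (Y i) = P) (y₀ : 𝒴) (n : ℕ) [SFinite P] {φ : (ℕ → 𝒴) × 𝒴 → ℝ}
    (hφ : Measurable φ) {C : ℝ≥0}
    (hC : ∀ᵐ ω ∂Pr, ∫⁻ y, ENNReal.ofReal |φ (pastPath Y y₀ n ω, y)| ∂P ≤ C) :
    Integrable (fun ω => φ (pastPath Y y₀ n ω, Y n ω)) Pr := by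
  refine ⟨(hφ.comp ((measurable_pastPath hY y₀ n).prodMk (hY n))).aestronglyMeasurable, ?_⟩
  rw [hasFiniteIntegral_iff_norm]
  have h := lintegral_pastPath hY hind hlaw y₀ n (φ := fun q => ENNReal.ofReal |φ q|)
    hφ.abs.ennreal_ofReal
  simp only [Real.norm_eq_abs]
  rw [h]
  calc _ ≤ ∫⁻ _, (C : ℝ≥0∞) ∂Pr := lintegral_mono_ae hC
    _ < ∞ := by simp

theorem integral_pastPath (hY : ∀ i, Measurable (Y i)) (hind : iIndepFun Y Pr)
    (hlaw : ∀ i, Pr.map (Y i) = P) (y₀ : 𝒴) (n : ℕ) [SFinite P] {φ : (ℕ → 𝒴) × 𝒴 → ℝ}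
    (hφ : Measurable φ) (hint : Integrable (fun ω => φ (pastPath Y y₀ n ω, Y n ω)) Pr) :
    ∫ ω, φ (pastPath Y y₀ n ω, Y n ω) ∂Pr = ∫ ω, ∫ y, φ (pastPath Y y₀ n ω, y) ∂P ∂Pr := by
  rw [← integral_condExp ((pastFiltration hY y₀).le n)]
  exact integral_congr_ae (condExp_pastPath hY hind hlaw y₀ n hφ hint)

theorem IsRegularKernel.ae_mem_goodPaths {Ω : Type*} {mΩ : MeasurableSpace Ω} {Pr : Measure Ω}
    {Y : ℕ → Ω → 𝒴} {P : Measure 𝒴} {μ : Measure 𝒰} {k : 𝒴 → 𝒰 → ℝ} {f₀ : 𝒰 → ℝ} {A : ℝ≥0}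
    (hk : IsRegularKernel k P A (ofDensity μ f₀))
    (hY : ∀ i, Measurable (Y i)) (hlaw : ∀ i, Pr.map (Y i) = P) :
    ∀ᵐ ω ∂Pr, (fun j => Y j ω) ∈ goodPaths k (ofDensity μ f₀) :=
  ae_all_iff.2 fun i => ae_of_ae_map (hY i).aemeasurable (by rw [hlaw]; exact hk.pos)

theorem prMeasure_pastPath {Ω 𝒴 : Type*} {μ : Measure 𝒰} {k : 𝒴 → 𝒰 → ℝ} {f₀ : 𝒰 → ℝ}
    {w : ℕ → ℝ} (Y : ℕ → Ω → 𝒴) (y₀ : 𝒴) (n : ℕ)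
    (ω : Ω) : prMeasure μ k f₀ w (pastPath Y y₀ n ω) n = prMeasure μ k f₀ w (fun j => Y j ω) n :=
  prMeasure_congr fun j hj => by simp [pastPath, hj]

theorem IsRegularKernel.measurable_logGrowth_prod {P : Measure 𝒴} {μ : Measure 𝒰} [SFinite μ]
    {k : 𝒴 → 𝒰 → ℝ} {f₀ : 𝒰 → ℝ} {w : ℕ → ℝ} {A : ℝ≥0} (hk : IsRegularKernel k P A (ofDensity μ f₀))
    (hf₀ : f₀ ∈ Densities μ) (hw : ∀ n, w n ∈ Set.Ioo (0 : ℝ) 1) (Φ : Measure 𝒰) [SFinite Φ]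
    (i : ℕ) : Measurable fun q : (ℕ → 𝒴) × 𝒴 =>
      logGrowth k Φ (prMeasure μ k f₀ w q.1 i) (w i) q.2 := by
  refine (StronglyMeasurable.integral_prod_right (f := fun (q : (ℕ → 𝒴) × 𝒴) u =>
    Real.log (1 + w i * (k q.2 u / mixture k (prMeasure μ k f₀ w q.1 i) q.2 - 1)))
    (Measurable.stronglyMeasurable ?_)).measurable
  refine Real.measurable_log.comp (measurable_const.add (measurable_const.mul
    (Measurable.sub (Measurable.div ?_ ?_) measurable_const)))
  · exact hk.meas.comp (f := fun q : ((ℕ → 𝒴) × 𝒴) × 𝒰 => (q.1.2, q.2)) (by fun_prop)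
  · exact (measurable_mixture_prMeasure hk.meas hk.nonneg hf₀.1 hf₀.2.1 hw i).comp measurable_fst

variable {μ : Measure 𝒰} [SFinite μ] {k : 𝒴 → 𝒰 → ℝ} {f₀ : 𝒰 → ℝ} {w : ℕ → ℝ}
  [IsProbabilityMeasure P] {A : ℝ≥0}

theorem pastPath_mem_goodPaths {Ω 𝒴 : Type*} {k : 𝒴 → 𝒰 → ℝ} {F₀ : Measure 𝒰} {Y : ℕ → Ω → 𝒴}
    {y₀ : 𝒴} (hy₀ : 0 < mixture k F₀ y₀) {ω : Ω} (hω : (fun j => Y j ω) ∈ goodPaths k F₀) (n : ℕ) :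
    pastPath Y y₀ n ω ∈ goodPaths k F₀ := by
  intro j
  by_cases h : j < n
  · simpa [pastPath, h] using hω j
  · simpa [pastPath, h] using hy₀

theorem IsRegularKernel.ae_exists_tendsto_sum_log (hk : IsRegularKernel k P A (ofDensity μ f₀))
    (hf₀ : f₀ ∈ Densities μ) (hw : ∀ n, w n ∈ Set.Ioo (0 : ℝ) 1)
    (hY : ∀ i, Measurable (Y i)) (hind : iIndepFun Y Pr) (hlaw : ∀ i, Pr.map (Y i) = P)
    (G : Measure 𝒰) [IsProbabilityMeasure G] {c : ℕ → ℝ} (hc : Summable fun i => c i ^ 2) :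
    ∀ᵐ ω ∂Pr, ∃ l, Tendsto (fun n => ∑ i ∈ Finset.range n, c i *
      (Real.log (mixture k G (Y i ω) / mixture k (prMeasure μ k f₀ w (fun j => Y j ω) i) (Y i ω)) -
        relEnt k P G (prMeasure μ k f₀ w (fun j => Y j ω) i))) atTop (𝓝 l) := by
  have := isProbabilityMeasure_ofDensity hf₀
  obtain ⟨y₀, hy₀⟩ := hk.pos.exists
  have h := ae_exists_tendsto_sum_pastPath hY hind hlaw y₀
    (φ := fun i q => Real.log (mixture k G q.2 / mixture k (prMeasure μ k f₀ w q.1 i) q.2))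
    (fun i => Real.measurable_log.comp (((hk.measurable_mixture G).comp measurable_snd).div
      (measurable_mixture_prMeasure hk.meas hk.nonneg hf₀.1 hf₀.2.1 hw i))) (C := 2 * A)
    (fun i => by
      filter_upwards [hk.ae_mem_goodPaths hY hlaw] with ω hω
      have := hk.isProbabilityMeasure_prMeasure hf₀ hw (pastPath_mem_goodPaths hy₀ hω i) i
      rw [← ofReal_integral_eq_lintegral_ofReal (hk.integrable_log_ratio_sq G _)
        (ae_of_all _ fun y => sq_nonneg _), ← ENNReal.ofReal_coe_nnreal]
      refine ENNReal.ofReal_le_ofReal ((hk.integral_log_ratio_sq_le G _).trans ?_)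
      push_cast
      exact le_rfl) hc
  filter_upwards [h] with ω hω
  simpa only [prMeasure_pastPath, relEnt] using hω

/-- The total logarithmic growth is at most `C` on almost every path, whereas each increment has
conditional mean at least `w_i relEnt Φ F_i` up to a quadratic error. Taking expectations compares
the two. -/
theorem IsRegularKernel.sum_mul_integral_relEnt_le (hk : IsRegularKernel k P A (ofDensity μ f₀))
    (hf₀ : f₀ ∈ Densities μ) (hw : ∀ n, w n ∈ Set.Ioo (0 : ℝ) 1) {η : ℝ} (hη : 0 < η)
    (hwη : ∀ n, w n ≤ 1 - η) (hY : ∀ i, Measurable (Y i)) (hind : iIndepFun Y Pr)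
    (hlaw : ∀ i, Pr.map (Y i) = P) {y₀ : 𝒴} (hy₀ : 0 < mixture k (ofDensity μ f₀) y₀)
    {Φ : Measure 𝒰} [IsProbabilityMeasure Φ] {C : ℝ} (hΦ : HasLogBound μ f₀ Φ C) (n : ℕ) :
    ∑ i ∈ Finset.range n,
      w i * ∫ ω, relEnt k P Φ (prMeasure μ k f₀ w (pastPath Y y₀ i ω) i) ∂Pr ≤
      C + ∑ i ∈ Finset.range n, w i ^ 2 / η * (A + 1) := by
  have := isProbabilityMeasure_ofDensity hf₀
  have hgood := hk.ae_mem_goodPaths hY hlaw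
  set φ : ℕ → (ℕ → 𝒴) × 𝒴 → ℝ := fun i q =>
    logGrowth k Φ (prMeasure μ k f₀ w q.1 i) (w i) q.2 with hφ
  have hφm : ∀ i, Measurable (φ i) := hk.measurable_logGrowth_prod hf₀ hw Φ
  have hint : ∀ i, Integrable (fun ω => φ i (pastPath Y y₀ i ω, Y i ω)) Pr := fun i => by
    refine integrable_pastPath hY hind hlaw y₀ i (hφm i)
      (C := (|Real.log η| + (1 + A)).toNNReal) ?_
    filter_upwards [hgood] with ω hω
    have := hk.isProbabilityMeasure_prMeasure hf₀ hw (pastPath_mem_goodPaths hy₀ hω i) i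
    have hi := (hk.integrable_logGrowth Φ (prMeasure μ k f₀ w (pastPath Y y₀ i ω) i) hη
      (hw i).1.le (hwη i))
    have hr := hk.integrable_ratio Φ (prMeasure μ k f₀ w (pastPath Y y₀ i ω) i)
    simp only [hφ]
    rw [← ofReal_integral_eq_lintegral_ofReal hi.abs (ae_of_all _ fun y => abs_nonneg _)]
    refine ENNReal.ofReal_le_ofReal ?_
    calc _ ≤ ∫ y, (|Real.log η| + mixture k Φ y /
          mixture k (prMeasure μ k f₀ w (pastPath Y y₀ i ω) i) y) ∂P :=
          integral_mono hi.abs ((integrable_const _).add hr) fun y =>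
            hk.abs_logGrowth_le Φ _ hη (hw i).1.le (hwη i) y
      _ ≤ _ := by
          rw [integral_add (integrable_const _) hr]
          simp only [integral_const, probReal_univ, smul_eq_mul, one_mul]
          linarith [hk.integral_ratio_le Φ (prMeasure μ k f₀ w (pastPath Y y₀ i ω) i)]
  have hRi : ∀ i, Integrable
      (fun ω => relEnt k P Φ (prMeasure μ k f₀ w (pastPath Y y₀ i ω) i)) Pr := fun i => by
    refine Integrable.of_bound ((hk.measurable_relEnt_prMeasure hf₀ hw Φ i).comp
      (measurable_pastPath hY y₀ i)).aestronglyMeasurable A ?_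
    filter_upwards [hgood] with ω hω
    have := hk.isProbabilityMeasure_prMeasure hf₀ hw (pastPath_mem_goodPaths hy₀ hω i) i
    exact hk.abs_relEnt_le Φ _
  have hstep : ∀ i, w i * ∫ ω, relEnt k P Φ (prMeasure μ k f₀ w (pastPath Y y₀ i ω) i) ∂Pr -
      w i ^ 2 / η * (A + 1) ≤ ∫ ω, φ i (pastPath Y y₀ i ω, Y i ω) ∂Pr := fun i => by
    rw [integral_pastPath hY hind hlaw y₀ i (hφm i) (hint i)]
    calc _ = ∫ ω, (w i * relEnt k P Φ (prMeasure μ k f₀ w (pastPath Y y₀ i ω) i) -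
          w i ^ 2 / η * (A + 1)) ∂Pr := by
          rw [integral_sub ((hRi i).const_mul _) (integrable_const _), integral_const_mul]
          simp
      _ ≤ _ := by
          refine integral_mono_ae (((hRi i).const_mul _).sub (integrable_const _)) ?_ ?_
          · exact (integrable_condExp (f := fun ω => φ i (pastPath Y y₀ i ω, Y i ω))
              (m := pastFiltration hY y₀ i)).congr
              (condExp_pastPath hY hind hlaw y₀ i (hφm i) (hint i))
          · filter_upwards [hgood] with ω hω
            have := hk.isProbabilityMeasure_prMeasure hf₀ hw (pastPath_mem_goodPaths hy₀ hω i) i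
            exact hk.le_integral_logGrowth Φ _ hη (hw i).1.le (hwη i)
  have hsum : ∑ i ∈ Finset.range n, ∫ ω, φ i (pastPath Y y₀ i ω, Y i ω) ∂Pr ≤ C := by
    rw [← integral_finsetSum _ fun i _ => hint i]
    calc _ ≤ ∫ _, C ∂Pr := by
          refine integral_mono_ae (integrable_finsetSum _ fun i _ => hint i)
            (integrable_const _) ?_
          filter_upwards [hgood] with ω hω
          simp only [hφ, prMeasure_pastPath]
          exact hk.sum_logGrowth_le hf₀ hw hη hwη hΦ hω n
      _ = C := by simp
  have := Finset.sum_le_sum fun i (_ : i ∈ Finset.range n) => hstep i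
  rw [Finset.sum_sub_distrib] at this
  linarith

/-- The multiplier `c` serves two purposes: `c = 1` gives convergence of the excess divergence, and
`c = partialSum w` its decay rate. -/
theorem IsRegularKernel.ae_exists_tendsto_mul_relEnt
    (hk : IsRegularKernel k P A (ofDensity μ f₀))
    (hf₀ : f₀ ∈ Densities μ) (hw : ∀ n, w n ∈ Set.Ioo (0 : ℝ) 1) {η : ℝ} (hη : 0 < η)
    (hwη : ∀ n, w n ≤ 1 - η) (hY : ∀ i, Measurable (Y i)) (hind : iIndepFun Y Pr)
    (hlaw : ∀ i, Pr.map (Y i) = P) {y₀ : 𝒴} (hy₀ : 0 < mixture k (ofDensity μ f₀) y₀)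
    {L : ℝ} (hL : ∀ f ∈ Densities μ, L ≤ relEnt k P (ofDensity μ f₀) (ofDensity μ f))
    {c : ℕ → ℝ} (hc0 : ∀ n, 0 ≤ c n) (hc : Monotone c)
    (hcw : Summable fun n => c (n + 1) * w n ^ 2) {D : ℝ}
    (hD : ∀ n, ∑ i ∈ Finset.range n, (c (i + 1) - c i) *
      ∫ ω, (relEnt k P (ofDensity μ f₀) (prMeasure μ k f₀ w (pastPath Y y₀ i ω) i) - L) ∂Pr ≤ D) :
    ∀ᵐ ω ∂Pr, ∃ l, Tendsto (fun n => c n * (relEnt k P (ofDensity μ f₀)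
      (prMeasure μ k f₀ w (fun j => Y j ω) n) - L)) atTop (𝓝 l) := by
  have := isProbabilityMeasure_ofDensity hf₀
  have hgood := hk.ae_mem_goodPaths hY hlaw
  have h := ae_exists_tendsto_mul_pastPath hY hind hlaw y₀
    (κ := fun n x => relEnt k P (ofDensity μ f₀) (prMeasure μ k f₀ w x n) - L)
    (fun n => (hk.measurable_relEnt_prMeasure hf₀ hw _ n).sub_const _) (B := A - L)
    (fun n => by
      filter_upwards [hgood] with ω hω
      exact sub_nonneg.2 (hL _ (hk.prDensity_mem hf₀ hw (pastPath_mem_goodPaths hy₀ hω n) n).1))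
    (fun n => by
      filter_upwards [hgood] with ω hω
      have := hk.isProbabilityMeasure_prMeasure hf₀ hw (pastPath_mem_goodPaths hy₀ hω n) n
      exact sub_le_sub_right ((le_abs_self _).trans (hk.abs_relEnt_le _ _)) _)
    (ε := fun n => w n ^ 2 / η * (A + 1)) (fun n => by positivity)
    (fun n => by
      filter_upwards [hgood] with ω hω
      have hg := pastPath_mem_goodPaths hy₀ hω n
      have hle := hk.integral_relEnt_prMeasure_succ_le hf₀ hw hη hwη (ofDensity μ f₀) hg n
      have hi : Integrable (fun y => relEnt k P (ofDensity μ f₀)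
          (prMeasure μ k f₀ w (Function.update (pastPath Y y₀ n ω) n y) (n + 1))) P := by
        refine Integrable.of_bound ((hk.measurable_relEnt_prMeasure hf₀ hw _ (n + 1)).comp
          (measurable_update _)).aestronglyMeasurable A ?_
        filter_upwards [hk.pos] with y hy
        have := hk.isProbabilityMeasure_prMeasure hf₀ hw (update_mem_goodPaths hg n hy) (n + 1)
        exact hk.abs_relEnt_le _ _
      rw [integral_sub hi (integrable_const _)]
      simp only [integral_const, probReal_univ, smul_eq_mul, one_mul]
      linarith)
    hc0 hc (by
      refine (hcw.mul_right (1 / η * (A + 1))).congr fun n => ?_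
      ring) hD
  filter_upwards [h] with ω hω
  simpa only [prMeasure_pastPath] using hω

/-- The predictive recursion mixtures attain the minimal relative entropy in the limit. -/
theorem IsRegularKernel.ae_tendsto_relEnt (hk : IsRegularKernel k P A (ofDensity μ f₀))
    (hf₀ : f₀ ∈ Densities μ) (hw : ∀ n, w n ∈ Set.Ioo (0 : ℝ) 1)
    (hsum : Tendsto (partialSum w) atTop atTop) (hsq : Summable fun n => w n ^ 2)
    (hY : ∀ i, Measurable (Y i)) (hind : iIndepFun Y Pr) (hlaw : ∀ i, Pr.map (Y i) = P)
    {L : ℝ} (hL : ∀ f ∈ Densities μ, L ≤ relEnt k P (ofDensity μ f₀) (ofDensity μ f))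
    (happ : ∀ ε > 0, ∃ Φ, IsProbabilityMeasure Φ ∧ (∃ C, HasLogBound μ f₀ Φ C) ∧
      relEnt k P (ofDensity μ f₀) Φ ≤ L + ε) :
    ∀ᵐ ω ∂Pr, Tendsto (fun n => relEnt k P (ofDensity μ f₀)
      (prMeasure μ k f₀ w (fun j => Y j ω) n)) atTop (𝓝 L) := by
  have := isProbabilityMeasure_ofDensity hf₀
  obtain ⟨η, hη, hwη⟩ := exists_pos_forall_le_one_sub hw hsq
  obtain ⟨y₀, hy₀⟩ := hk.pos.exists
  have hgood := hk.ae_mem_goodPaths hY hlaw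
  have hconv := hk.ae_exists_tendsto_mul_relEnt hf₀ hw hη hwη hY hind hlaw hy₀ hL
    (c := fun _ => 1) (fun _ => zero_le_one) monotone_const (by simpa using hsq) (D := 0)
    (fun n => by simp)
  simp only [one_mul] at hconv
  set κ : ℕ → Ω → ℝ := fun n ω =>
    relEnt k P (ofDensity μ f₀) (prMeasure μ k f₀ w (fun j => Y j ω) n) - L with hκ
  have hκm : ∀ n, AEStronglyMeasurable (κ n) Pr := fun n =>
    (((hk.measurable_relEnt_prMeasure hf₀ hw _ n).sub_const _).comp
      (measurable_pi_iff.2 hY)).aestronglyMeasurable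
  have hκ0 : ∀ n, ∀ᵐ ω ∂Pr, 0 ≤ κ n ω := fun n => by
    filter_upwards [hgood] with ω hω
    exact sub_nonneg.2 (hL _ (hk.prDensity_mem hf₀ hw hω n).1)
  have hκB : ∀ n, ∀ᵐ ω ∂Pr, ‖κ n ω‖ ≤ A - L := fun n => by
    filter_upwards [hgood, hκ0 n] with ω hω h0
    have := hk.isProbabilityMeasure_prMeasure hf₀ hw hω n
    rw [Real.norm_of_nonneg h0]
    exact sub_le_sub_right ((le_abs_self _).trans (hk.abs_relEnt_le _ _)) _
  set l : Ω → ℝ := fun ω => limUnder atTop fun n => κ n ω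
  have hlim : ∀ᵐ ω ∂Pr, Tendsto (fun n => κ n ω) atTop (𝓝 (l ω)) := by
    filter_upwards [hconv] with ω hω
    exact tendsto_nhds_limUnder hω
  have hlint := tendsto_integral_of_dominated_convergence (fun _ => A - L) hκm
    (integrable_const _) hκB hlim
  have hκi : ∀ n, Integrable (κ n) Pr := fun n => Integrable.of_bound (hκm n) _ (hκB n)
  have hl0 : 0 ≤ᵐ[Pr] l := by
    filter_upwards [hlim, ae_all_iff.2 hκ0] with ω h1 h2
    exact ge_of_tendsto' h1 h2
  have hlm : AEStronglyMeasurable l Pr := aestronglyMeasurable_of_tendsto_ae atTop hκm hlim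
  have hli : Integrable l Pr := by
    refine Integrable.of_bound hlm (A - L) ?_
    filter_upwards [hlim, ae_all_iff.2 hκB] with ω h1 h2
    exact le_of_tendsto' h1.norm h2
  -- For `Φ` within `ε` of the optimum, `κ i - ε ≤ relEnt Φ F_i`, so `∑ w_i (E κ_i - ε)` is bounded
  -- above; divergence of `∑ w_i` forces `lim E κ_i ≤ ε`. Since `l ≥ 0`, this makes `l` vanish
  -- almost surely.
  have hle : ∫ ω, l ω ∂Pr ≤ 0 := by
    refine le_of_forall_pos_le_add fun ε hε => ?_
    obtain ⟨Φ, hΦp, ⟨C, hΦ⟩, hΦε⟩ := happ ε hε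
    have hsumle := hk.sum_mul_integral_relEnt_le hf₀ hw hη hwη hY hind hlaw hy₀ hΦ
    have key := nonpos_of_sum_mul_le (w := w) (e := fun n => ∫ ω, κ n ω ∂Pr - ε)
      (C := C + (∑' i, w i ^ 2 / η * (A + 1))) (fun n => (hw n).1.le) hsum
      (hlint.sub_const ε) (fun n => ?_)
    · linarith
    · refine le_trans (Finset.sum_le_sum fun i _ => ?_) ((hsumle n).trans ?_)
      · refine mul_le_mul_of_nonneg_left ?_ (hw i).1.le
        calc ∫ ω, κ i ω ∂Pr - ε = ∫ ω, (κ i ω - ε) ∂Pr := by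
              rw [integral_sub (hκi i) (integrable_const _)]
              simp
          _ ≤ _ := by
              have e : ∀ᵐ ω ∂Pr, κ i ω - ε ≤
                  relEnt k P Φ (prMeasure μ k f₀ w (pastPath Y y₀ i ω) i) := by
                filter_upwards [hgood] with ω hω
                have := hk.isProbabilityMeasure_prMeasure hf₀ hw hω i
                rw [prMeasure_pastPath]
                have h1 := hk.relEnt_add (ofDensity μ f₀) Φ
                  (prMeasure μ k f₀ w (fun j => Y j ω) i)
                simp only [hκ]
                linarith
              refine integral_mono_ae ((hκi i).sub (integrable_const _)) ?_ e
              refine Integrable.of_bound ((hk.measurable_relEnt_prMeasure hf₀ hw Φ i).comp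
                (measurable_pastPath hY y₀ i)).aestronglyMeasurable A ?_
              filter_upwards [hgood] with ω hω
              have := hk.isProbabilityMeasure_prMeasure hf₀ hw
                (pastPath_mem_goodPaths hy₀ hω i) i
              exact hk.abs_relEnt_le Φ _
      · gcongr
        have hs : Summable fun i => w i ^ 2 / η * ((A : ℝ) + 1) :=
          (hsq.div_const η).mul_right _
        exact hs.sum_le_tsum _ fun i _ => by positivity
  have hl_ae : l =ᵐ[Pr] 0 :=
    (integral_eq_zero_iff_of_nonneg_ae hl0 hli).1 (le_antisymm hle (integral_nonneg_of_ae hl0))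
  filter_upwards [hlim, hl_ae] with ω h1 h2
  rw [h2] at h1
  have := h1.add_const L
  simpa [hκ] using this

/-- The Cesàro sums of the excess relative entropies grow at most like `n / a_n`. -/
theorem IsRegularKernel.ae_exists_partialSum_mul_sum_le
    (hk : IsRegularKernel k P A (ofDensity μ f₀))
    (hf₀ : f₀ ∈ Densities μ) (hw : ∀ n, w n ∈ Set.Ioo (0 : ℝ) 1)
    (hsq : Summable fun n => w n ^ 2) (hanti : Antitone w)
    (haw : Summable fun n => partialSum w (n + 1) * w n ^ 2)
    (hY : ∀ i, Measurable (Y i)) (hind : iIndepFun Y Pr) (hlaw : ∀ i, Pr.map (Y i) = P)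
    {Φ : Measure 𝒰} [IsProbabilityMeasure Φ] {C : ℝ} (hΦ : HasLogBound μ f₀ Φ C)
    (hmin : ∀ f ∈ Densities μ, 0 ≤ relEnt k P Φ (ofDensity μ f)) :
    ∀ᵐ ω ∂Pr, ∃ M, ∀ n, partialSum w n * ∑ i ∈ Finset.range n,
      relEnt k P Φ (prMeasure μ k f₀ w (fun j => Y j ω) i) ≤ M * n := by
  have := isProbabilityMeasure_ofDensity hf₀
  obtain ⟨η, hη, hwη⟩ := exists_pos_forall_le_one_sub hw hsq
  obtain ⟨y₀, hy₀⟩ := hk.pos.exists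
  have hgood := hk.ae_mem_goodPaths hY hlaw
  have hw0 : ∀ n, 0 ≤ w n := fun n => (hw n).1.le
  -- With this level the excess `relEnt f₀ F - L` is `relEnt Φ F`, by the cocycle identity.
  set L := relEnt k P (ofDensity μ f₀) Φ
  have hadd : ∀ (F : Measure 𝒰) [IsProbabilityMeasure F],
      relEnt k P (ofDensity μ f₀) F - L = relEnt k P Φ F := fun F _ => by
    rw [hk.relEnt_add (ofDensity μ f₀) Φ F]
    ring
  have hL : ∀ f ∈ Densities μ, L ≤ relEnt k P (ofDensity μ f₀) (ofDensity μ f) := fun f hf => by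
    have := isProbabilityMeasure_ofDensity hf
    linarith [hadd (ofDensity μ f), hmin f hf]
  have hprob : ∀ᵐ ω ∂Pr, ∀ i, IsProbabilityMeasure (prMeasure μ k f₀ w (fun j => Y j ω) i) := by
    filter_upwards [hgood] with ω hω i using hk.isProbabilityMeasure_prMeasure hf₀ hw hω i
  set κ : ℕ → Ω → ℝ := fun i ω =>
    relEnt k P Φ (prMeasure μ k f₀ w (fun j => Y j ω) i) with hκ
  have hκi : ∀ n, Integrable (κ n) Pr := fun n => by
    refine Integrable.of_bound ((hk.measurable_relEnt_prMeasure hf₀ hw Φ n).comp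
      (measurable_pi_iff.2 hY)).aestronglyMeasurable A ?_
    filter_upwards [hprob] with ω hω
    have := hω n
    exact hk.abs_relEnt_le Φ _
  have hκ0 : ∀ n, ∀ᵐ ω ∂Pr, 0 ≤ κ n ω := fun n => by
    filter_upwards [hgood] with ω hω using hmin _ (hk.prDensity_mem hf₀ hw hω n).1
  have hbound : ∀ n, ∑ i ∈ Finset.range n, w i * ∫ ω, κ i ω ∂Pr ≤
      C + ∑' i, w i ^ 2 / η * (A + 1) := fun n => by
    have h := hk.sum_mul_integral_relEnt_le hf₀ hw hη hwη hY hind hlaw hy₀ hΦ n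
    simp only [prMeasure_pastPath] at h
    have hs : Summable fun i => w i ^ 2 / η * ((A : ℝ) + 1) := (hsq.div_const η).mul_right _
    have := hs.sum_le_tsum (Finset.range n) fun i _ => by positivity
    linarith
  have hsummable : ∀ᵐ ω ∂Pr, Summable fun i => w i * κ i ω := by
    refine ae_summable_of_sum_integral_le (fun i => (hκi i).const_mul _) (fun i => ?_)
      (D := C + ∑' i, w i ^ 2 / η * (A + 1)) fun n => ?_
    · filter_upwards [hκ0 i] with ω hω using mul_nonneg (hw0 i) hω
    · simp_rw [integral_const_mul]
      exact hbound n
  -- For `c = partialSum w` the increments are the weights themselves, so the condition on `D` is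
  -- `hbound`.
  have hconv := hk.ae_exists_tendsto_mul_relEnt hf₀ hw hη hwη hY hind hlaw hy₀ hL
    (partialSum_nonneg hw0) (monotone_partialSum hw0) haw
    (D := C + ∑' i, w i ^ 2 / η * (A + 1)) (fun n => by
      refine le_trans (le_of_eq (Finset.sum_congr rfl fun i _ => ?_)) (hbound n)
      rw [partialSum_succ, add_sub_cancel_left]
      congr 1
      refine integral_congr_ae ?_
      filter_upwards [hprob] with ω hω
      have := hω i
      rw [prMeasure_pastPath, hadd])
  filter_upwards [hsummable, hconv, hprob, ae_all_iff.2 hκ0] with ω h1 ⟨l, h2⟩ h3 h4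
  obtain ⟨M, hM⟩ := h2.bddAbove_range
  refine ⟨M + ∑' i, w i * κ i ω, fun n => ?_⟩
  refine partialSum_mul_sum_le hanti h4 (fun n => ?_) (fun n => ?_) n
  · have := h3 n
    rw [hκ]
    simp only
    rw [← hadd]
    exact hM ⟨n, rfl⟩
  · exact h1.sum_le_tsum _ fun i _ => mul_nonneg (hw0 i) (h4 i)

end PredictiveRecursion

end PredRec

namespace PredRec

variable {𝒰 𝒴 : Type*} [MeasurableSpace 𝒰] [MeasurableSpace 𝒴]

/-! ### Approximating mixing measures; sources of log bounds. -/

section Approximation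

/-- By `relEnt_le` it is enough to bound the mean of the ratio near `1`. Truncated at `N`, the ratio
converges in mean by dominated convergence; the second moment bounds the remainder by `A / N`. -/
theorem IsRegularKernel.eventually_relEnt_le {k : 𝒴 → 𝒰 → ℝ} {P : Measure 𝒴}
    [IsProbabilityMeasure P] {A : ℝ≥0} {F₀ : Measure 𝒰} [IsProbabilityMeasure F₀]
    (hk : IsRegularKernel k P A F₀) {F : Measure 𝒰} [IsProbabilityMeasure F] {G : ℕ → Measure 𝒰}
    (hG : ∀ᶠ j in atTop, IsProbabilityMeasure (G j)) [∀ j, SFinite (G j)]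
    (hlim : ∀ y, Tendsto (fun j => mixture k (G j) y) atTop (𝓝 (mixture k F y)))
    {ε : ℝ} (hε : 0 < ε) : ∀ᶠ j in atTop, relEnt k P F (G j) ≤ ε := by
  -- This gives `A / N < ε / 2`, while `N ≥ 1` leaves the limiting ratio `1` untouched by
  -- truncation.
  set N : ℝ := 1 + 2 * A / ε with hN
  have hN1 : 1 ≤ N := by
    rw [hN]
    have : 0 ≤ 2 * (A : ℝ) / ε := by positivity
    linarith
  have hN0 : 0 < N := by linarith
  have hAN : A / N < ε / 2 := by
    rw [div_lt_iff₀ hN0, hN]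
    have : ε / 2 * (1 + 2 * A / ε) = ε / 2 + A := by
      field_simp
    linarith
  have htr : Tendsto (fun j => ∫ y, min (mixture k F y / mixture k (G j) y) N ∂P) atTop
      (𝓝 (∫ _, (1 : ℝ) ∂P)) := by
    refine tendsto_integral_of_dominated_convergence (fun _ => N)
      (fun j => ((hk.measurable_ratio F (G j)).min measurable_const).aestronglyMeasurable)
      (integrable_const _) (fun j => ae_of_all _ fun y => ?_) ?_
    · have h1 : 0 ≤ mixture k F y / mixture k (G j) y :=
        div_nonneg (mixture_nonneg hk.nonneg _ _) (mixture_nonneg hk.nonneg _ _)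
      rw [Real.norm_of_nonneg (le_min h1 hN0.le)]
      exact min_le_right _ _
    · filter_upwards [hk.mixture_pos F] with y hy
      have h1 := (tendsto_const_nhds (x := mixture k F y)).div (hlim y) hy.ne'
      have h2 := h1.min (tendsto_const_nhds (x := N))
      rwa [div_self hy.ne', min_eq_left hN1] at h2
  simp only [integral_const, probReal_univ, smul_eq_mul, mul_one] at htr
  filter_upwards [hG, htr.eventually (gt_mem_nhds (lt_add_of_pos_right 1 (half_pos hε)))] with
    j hj hlt
  have hr := hk.integrable_ratio F (G j)
  have hr2 := hk.integrable_ratio_sq F (G j)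
  have hmin : Integrable (fun y => min (mixture k F y / mixture k (G j) y) N) P :=
    hr.inf (integrable_const _)
  have hle : ∫ y, mixture k F y / mixture k (G j) y ∂P ≤
      ∫ y, min (mixture k F y / mixture k (G j) y) N ∂P + A / N := by
    calc _ ≤ ∫ y, (min (mixture k F y / mixture k (G j) y) N +
          (mixture k F y / mixture k (G j) y) ^ 2 / N) ∂P := by
          refine integral_mono hr (hmin.add (hr2.div_const _)) fun y => ?_
          simp only
          set r := mixture k F y / mixture k (G j) y
          rcases le_total r N with h | h
          · rw [min_eq_left h]
            have : 0 ≤ r ^ 2 / N := by positivity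
            linarith
          · rw [min_eq_right h]
            have : r ≤ r ^ 2 / N := by
              rw [le_div_iff₀ hN0]
              nlinarith
            linarith
      _ = ∫ y, min (mixture k F y / mixture k (G j) y) N ∂P +
          (∫ y, (mixture k F y / mixture k (G j) y) ^ 2 ∂P) / N := by
          rw [integral_add hmin (hr2.div_const _), integral_div]
      _ ≤ _ := by
          gcongr
          exact hk.integral_ratio_sq_le F (G j)
  have := hk.relEnt_le F (G j)
  linarith

variable {μ : Measure 𝒰} {f₀ : 𝒰 → ℝ}

theorem ae_pos_ofDensity {f : 𝒰 → ℝ} (hf : Measurable f) : ∀ᵐ u ∂(ofDensity μ f), 0 < f u := by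
  rw [ofDensity, ae_withDensity_iff hf.ennreal_ofReal]
  exact ae_of_all _ fun u hu => by simpa using hu

theorem ofDensity_absolutelyContinuous (f : 𝒰 → ℝ) : ofDensity μ f ≪ μ :=
  withDensity_absolutelyContinuous μ _

/-- Crudely `log x ≤ x`, and `∫ (q / f₀) f ≤ C ∫ q = C`. -/
theorem hasLogBound_of_le (hf₀ : f₀ ∈ Densities μ) (hpos : ∀ᵐ u ∂μ, 0 < f₀ u) {f : 𝒰 → ℝ}
    (hf : f ∈ Densities μ) {C : ℝ} (hle : ∀ u, f u ≤ C * f₀ u) :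
    HasLogBound μ f₀ (ofDensity μ f) C := by
  refine ⟨(ofDensity_absolutelyContinuous f).ae_le hpos, fun q hq _ hint => ?_⟩
  have hqi := integrable_of_mem_densities hq
  have hpt : ∀ᵐ u ∂μ, q u / f₀ u * f u ≤ C * q u := by
    filter_upwards [hpos] with u hu
    calc q u / f₀ u * f u ≤ q u / f₀ u * (C * f₀ u) :=
          mul_le_mul_of_nonneg_left (hle u) (div_nonneg (hq.2.1 u) hu.le)
      _ = C * q u := by field_simp
  have hi : Integrable (fun u => q u / f₀ u * f u) μ := by
    refine (hqi.const_mul C).mono' ((hq.1.div hf₀.1).mul hf.1).aestronglyMeasurable ?_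
    filter_upwards [hpt] with u hu
    rwa [Real.norm_of_nonneg (mul_nonneg (div_nonneg (hq.2.1 u) (hf₀.2.1 u)) (hf.2.1 u))]
  calc ∫ u, Real.log (q u / f₀ u) ∂(ofDensity μ f) ≤ ∫ u, q u / f₀ u ∂(ofDensity μ f) :=
        integral_mono hint ((integrable_ofDensity_iff hf.1 hf.2.1 _).2 hi) fun u =>
          Real.log_le_self (div_nonneg (hq.2.1 u) (hf₀.2.1 u))
    _ = ∫ u, q u / f₀ u * f u ∂μ := integral_ofDensity hf.1 hf.2.1 _
    _ ≤ ∫ u, C * q u ∂μ := integral_mono_ae hi (hqi.const_mul C) hpt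
    _ = C := by rw [integral_const_mul, integral_of_mem_densities hq, mul_one]

/-- The chain rule for Radon–Nikodym derivatives through `μ`. -/
theorem ofDensity_rnDeriv [SigmaFinite μ] {f g : 𝒰 → ℝ} (hf : f ∈ Densities μ)
    (hg : g ∈ Densities μ) (hac : ofDensity μ f ≪ ofDensity μ g) :
    llr (ofDensity μ f) (ofDensity μ g) =ᵐ[ofDensity μ f] fun u => Real.log (f u / g u) := by
  have := isProbabilityMeasure_ofDensity hf
  have := isProbabilityMeasure_ofDensity hg
  have hfμ := ofDensity_absolutelyContinuous (μ := μ) f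
  have h1 := hfμ.ae_le (Measure.rnDeriv_mul_rnDeriv (κ := μ) hac)
  have h2 := hfμ.ae_le (Measure.rnDeriv_withDensity μ hf.1.ennreal_ofReal)
  have h3 := hfμ.ae_le (Measure.rnDeriv_withDensity μ hg.1.ennreal_ofReal)
  filter_upwards [h1, h2, h3, hac.ae_le (ae_pos_ofDensity hg.1)] with u h1 h2 h3 h4
  change _ = _ at h1
  rw [Pi.mul_apply] at h1
  change (ofDensity μ f).rnDeriv μ u = _ at h2
  change (ofDensity μ g).rnDeriv μ u = _ at h3
  rw [h2, h3] at h1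
  have h5 := congrArg ENNReal.toReal h1
  rw [ENNReal.toReal_mul, ENNReal.toReal_ofReal (hf.2.1 u), ENNReal.toReal_ofReal (hg.2.1 u)] at h5
  rw [llr, ← h5, mul_div_cancel_right₀ _ h4.ne']

theorem KL_toReal [SigmaFinite μ] {f g : 𝒰 → ℝ} (hf : f ∈ Densities μ)
    (hg : g ∈ Densities μ) (hfin : KL μ f g < ∞) :
    (∀ᵐ u ∂(ofDensity μ f), 0 < g u) ∧
      Integrable (fun u => Real.log (f u / g u)) (ofDensity μ f) ∧
      (KL μ f g).toReal = ∫ u, Real.log (f u / g u) ∂(ofDensity μ f) := by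
  have := isProbabilityMeasure_ofDensity hf
  have := isProbabilityMeasure_ofDensity hg
  obtain ⟨hac, hint⟩ := klDiv_ne_top_iff.1 hfin.ne
  have h := ofDensity_rnDeriv hf hg hac
  refine ⟨hac.ae_le (ae_pos_ofDensity hg.1), (integrable_congr h).1 hint, ?_⟩
  rw [KL, toReal_klDiv_of_measure_eq hac (by simp), integral_congr_ae h]

/-- Split `log (q / f₀) = log (f / f₀) + log (q / f)`. The first part integrates to the divergence;
the second is nonpositive in mean by Gibbs' inequality. -/
theorem hasLogBound_of_KL_lt_top [SigmaFinite μ] (hf₀ : f₀ ∈ Densities μ) {f : 𝒰 → ℝ}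
    (hf : f ∈ Densities μ) (hfin : KL μ f f₀ < ∞) :
    HasLogBound μ f₀ (ofDensity μ f) (KL μ f f₀).toReal := by
  obtain ⟨hpos, hli, hKL⟩ := KL_toReal hf hf₀ hfin
  have := isProbabilityMeasure_ofDensity hf
  refine ⟨hpos, fun q hq hq0 hint => ?_⟩
  have hqi := integrable_of_mem_densities hq
  have hpt : ∀ u, q u / f u * f u ≤ q u := fun u => by
    rcases eq_or_ne (f u) 0 with h | h
    · simp [h, hq.2.1 u]
    · rw [div_mul_cancel₀ _ h]
  have hi : Integrable (fun u => q u / f u * f u) μ := by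
    refine hqi.mono' ((hq.1.div hf.1).mul hf.1).aestronglyMeasurable (ae_of_all _ fun u => ?_)
    rw [Real.norm_of_nonneg (mul_nonneg (div_nonneg (hq.2.1 u) (hf.2.1 u)) (hf.2.1 u))]
    exact hpt u
  have hi' : Integrable (fun u => q u / f u) (ofDensity μ f) :=
    (integrable_ofDensity_iff hf.1 hf.2.1 _).2 hi
  have h1 : ∫ u, q u / f u ∂(ofDensity μ f) ≤ 1 := by
    rw [integral_ofDensity hf.1 hf.2.1, ← integral_of_mem_densities hq]
    exact integral_mono hi hqi hpt
  have hi'' : Integrable (fun u => q u / f u - 1) (ofDensity μ f) := hi'.sub (integrable_const _)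
  calc ∫ u, Real.log (q u / f₀ u) ∂(ofDensity μ f) ≤
        ∫ u, (Real.log (f u / f₀ u) + (q u / f u - 1)) ∂(ofDensity μ f) := by
        refine integral_mono_ae hint (hli.add hi'') ?_
        filter_upwards [hpos, ae_pos_ofDensity hf.1] with u h0 hfu
        have hqu := hq0 u h0
        have h2 := Real.log_le_sub_one_of_pos (div_pos hqu hfu)
        rw [Real.log_div hqu.ne' hfu.ne'] at h2
        rw [Real.log_div hqu.ne' h0.ne', Real.log_div hfu.ne' h0.ne']
        linarith
    _ = (KL μ f f₀).toReal + (∫ u, q u / f u ∂(ofDensity μ f) - 1) := by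
        rw [integral_add hli hi'', integral_sub hi' (integrable_const _), hKL]
        simp
    _ ≤ _ := by linarith

/-- Densities are approximated by densities dominated by a multiple of `f₀`. -/
theorem IsRegularKernel.exists_hasLogBound_relEnt_le {k : 𝒴 → 𝒰 → ℝ} {P : Measure 𝒴}
    [IsProbabilityMeasure P] {A : ℝ≥0} (hk : IsRegularKernel k P A (ofDensity μ f₀)) [SFinite μ]
    (hf₀ : f₀ ∈ Densities μ) (hpos : ∀ᵐ u ∂μ, 0 < f₀ u) {f : 𝒰 → ℝ}
    (hf : f ∈ Densities μ) {ε : ℝ} (hε : 0 < ε) :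
    ∃ Φ, IsProbabilityMeasure Φ ∧ (∃ C, HasLogBound μ f₀ Φ C) ∧
      relEnt k P (ofDensity μ f) Φ ≤ ε := by
  have := isProbabilityMeasure_ofDensity hf₀
  have := isProbabilityMeasure_ofDensity hf
  -- The truncations tend to `f` wherever `f₀ > 0`. Their masses `c n` tend to `1`, so normalizing
  -- keeps the limit, and the result is dominated by `n / c n` times `f₀`.
  set g : ℕ → 𝒰 → ℝ := fun n u => min (f u) (n * f₀ u)
  have hgm : ∀ n, Measurable (g n) := fun n => hf.1.min (hf₀.1.const_mul _)
  have hg0 : ∀ n u, 0 ≤ g n u := fun n u =>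
    le_min (hf.2.1 u) (mul_nonneg (Nat.cast_nonneg n) (hf₀.2.1 u))
  have hfi := integrable_of_mem_densities hf
  have hglim : ∀ᵐ u ∂μ, Tendsto (fun n => g n u) atTop (𝓝 (f u)) := by
    filter_upwards [hpos] with u hu
    have h1 : Tendsto (fun n : ℕ => (n : ℝ) * f₀ u) atTop atTop :=
      tendsto_natCast_atTop_atTop.atTop_mul_const hu
    refine tendsto_const_nhds.congr' ?_
    filter_upwards [h1.eventually_ge_atTop (f u)] with n hn
    exact (min_eq_left hn).symm
  set c : ℕ → ℝ := fun n => ∫ u, g n u ∂μ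
  have hclim : Tendsto c atTop (𝓝 1) := by
    rw [← integral_of_mem_densities hf]
    refine tendsto_integral_of_dominated_convergence f
      (fun n => (hgm n).aestronglyMeasurable) hfi (fun n => ae_of_all _ fun u => ?_) hglim
    rw [Real.norm_of_nonneg (hg0 n u)]
    exact min_le_left _ _
  have hcpos : ∀ᶠ n in atTop, 0 < c n := hclim.eventually (lt_mem_nhds one_pos)
  set h : ℕ → 𝒰 → ℝ := fun n u => g n u / c n
  have hhmem : ∀ᶠ n in atTop, h n ∈ Densities μ := by
    filter_upwards [hcpos] with n hn
    refine mem_densities_of_integral ((hgm n).div_const _)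
      (fun u => div_nonneg (hg0 n u) hn.le) ?_
    rw [integral_div]
    exact div_self hn.ne'
  have hc0 : ∀ n, 0 ≤ c n := fun n => integral_nonneg (hg0 n)
  have hprob : ∀ᶠ n in atTop, IsProbabilityMeasure (ofDensity μ (h n)) := by
    filter_upwards [hhmem] with n hn using isProbabilityMeasure_ofDensity hn
  have hlim : ∀ y, Tendsto (fun n => mixture k (ofDensity μ (h n)) y) atTop
      (𝓝 (mixture k (ofDensity μ f) y)) := by
    intro y
    have hki : Integrable (fun u => k y u * f u) μ :=
      (integrable_ofDensity_iff hf.1 hf.2.1 _).1 (hk.integrable (ofDensity μ f) y)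
    have h1 : Tendsto (fun n => ∫ u, k y u * g n u ∂μ) atTop (𝓝 (∫ u, k y u * f u ∂μ)) := by
      refine tendsto_integral_of_dominated_convergence (fun u => k y u * f u)
        (fun n => ((hk.meas_right y).mul (hgm n)).aestronglyMeasurable) hki
        (fun n => ae_of_all _ fun u => ?_) ?_
      · rw [Real.norm_of_nonneg (mul_nonneg (hk.nonneg y u) (hg0 n u))]
        exact mul_le_mul_of_nonneg_left (min_le_left _ _) (hk.nonneg y u)
      · filter_upwards [hglim] with u hu using hu.const_mul _
    have h2 := h1.div hclim one_ne_zero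
    rw [div_one, ← integral_ofDensity hf.1 hf.2.1] at h2
    refine h2.congr fun n => ?_
    rw [Pi.div_apply, mixture, integral_ofDensity ((hgm n).div_const _)
      (fun u => div_nonneg (hg0 n u) (hc0 n)), ← integral_div]
    refine integral_congr_ae (ae_of_all _ fun u => ?_)
    simp only
    ring
  have hsf : ∀ n, SFinite (ofDensity μ (h n)) := fun n => by
    rw [ofDensity]
    infer_instance
  obtain ⟨n, hn1, hn2, hn3⟩ := ((hk.eventually_relEnt_le hprob hlim hε).and
    (hhmem.and hcpos)).exists
  refine ⟨ofDensity μ (h n), isProbabilityMeasure_ofDensity hn2, ⟨n / c n, ?_⟩, hn1⟩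
  refine hasLogBound_of_le hf₀ hpos hn2 fun u => ?_
  rw [div_mul_eq_mul_div]
  exact div_le_div_of_nonneg_right (min_le_right _ _) hn3.le

end Approximation

/-! ### Passing from the weak closure to densities. -/

section Closure

variable [TopologicalSpace 𝒰] {μ : Measure 𝒰}

theorem exists_mem_closedMixing [OpensMeasurableSpace 𝒰] {f : 𝒰 → ℝ} (hf : f ∈ Densities μ) :
    ∃ F ∈ closedMixing μ, (F : Measure 𝒰) = ofDensity μ f := by
  let F : ProbabilityMeasure 𝒰 := ⟨ofDensity μ f, isProbabilityMeasure_ofDensity hf⟩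
  exact ⟨F, subset_closure ⟨f, hf, rfl⟩, rfl⟩

variable [TopologicalSpace.MetrizableSpace 𝒰] [SecondCountableTopology 𝒰] [BorelSpace 𝒰]

/-- Weak convergence on a separable metrizable space is metrizable, so points of the closure are
limits of sequences. Mixtures converge pointwise because `k y` is bounded and continuous. -/
theorem IsRegularKernel.exists_density_relEnt_le {k : 𝒴 → 𝒰 → ℝ} {P : Measure 𝒴}
    [IsProbabilityMeasure P] {A : ℝ≥0} {F₀ : Measure 𝒰} [IsProbabilityMeasure F₀]
    (hk : IsRegularKernel k P A F₀) (hcont : ∀ y, Continuous (k y))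
    {F : ProbabilityMeasure 𝒰} (hF : F ∈ closedMixing μ) {ε : ℝ} (hε : 0 < ε) :
    ∃ f ∈ Densities μ, relEnt k P (F : Measure 𝒰) (ofDensity μ f) ≤ ε := by
  obtain ⟨G, hG, hGF⟩ := mem_closure_iff_seq_limit.1 hF
  have hlim : ∀ y, Tendsto (fun j => mixture k (G j : Measure 𝒰) y) atTop
      (𝓝 (mixture k (F : Measure 𝒰) y)) := by
    intro y
    obtain ⟨C, hC⟩ := hk.bdd y
    exact ProbabilityMeasure.tendsto_iff_forall_integral_tendsto.1 hGF
      (BoundedContinuousFunction.ofNormedAddCommGroup (k y) (hcont y) C fun u => by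
        rw [Real.norm_of_nonneg (hk.nonneg y u)]
        exact hC u)
  obtain ⟨j, hj⟩ := (hk.eventually_relEnt_le (Eventually.of_forall fun j => inferInstance)
    hlim hε).exists
  obtain ⟨f, hf, hfG⟩ := hG j
  exact ⟨f, hf, hfG ▸ hj⟩

end Closure

/-! ### Relative entropy as a difference of divergences, and the splitting of the empirical
divergence. -/

theorem IsRegularKernel.mixture_mem_densities {k : 𝒴 → 𝒰 → ℝ} {P : Measure 𝒴} {A : ℝ≥0}
    {F₀ : Measure 𝒰} (hk : IsRegularKernel k P A F₀) {ν : Measure 𝒴} [SFinite ν]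
    (hdens : ∀ u, (fun y => k y u) ∈ Densities ν) (F : Measure 𝒰) [IsProbabilityMeasure F] :
    mixture k F ∈ Densities ν := by
  refine ⟨hk.measurable_mixture F, mixture_nonneg hk.nonneg F, ?_⟩
  simp_rw [hk.ofReal_mixture F]
  rw [lintegral_lintegral_swap (hk.meas.ennreal_ofReal).aemeasurable]
  simp_rw [(hdens _).2.2]
  simp

theorem IsRegularKernel.relEnt_eq_sub {k : 𝒴 → 𝒰 → ℝ} {A : ℝ≥0} {F₀ : Measure 𝒰} {ν : Measure 𝒴}
    [SigmaFinite ν] {m : 𝒴 → ℝ} (hm : m ∈ Densities ν)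
    (hk : IsRegularKernel k (ofDensity ν m) A F₀)
    (hdens : ∀ u, (fun y => k y u) ∈ Densities ν) (G F : Measure 𝒰) [IsProbabilityMeasure G]
    [IsProbabilityMeasure F] (hG : KL ν m (mixture k G) < ∞) (hF : KL ν m (mixture k F) < ∞) :
    relEnt k (ofDensity ν m) G F =
      (KL ν m (mixture k F)).toReal - (KL ν m (mixture k G)).toReal := by
  obtain ⟨hG0, hGi, hGe⟩ := KL_toReal hm (hk.mixture_mem_densities hdens G) hG
  obtain ⟨hF0, hFi, hFe⟩ := KL_toReal hm (hk.mixture_mem_densities hdens F) hF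
  rw [hGe, hFe, ← integral_sub hFi hGi, relEnt]
  refine integral_congr_ae ?_
  filter_upwards [hG0, hF0, ae_pos_ofDensity hm.1] with y h1 h2 h3
  rw [Real.log_div h1.ne' h2.ne', Real.log_div h3.ne' h1.ne', Real.log_div h3.ne' h2.ne']
  ring

/-- The reference `G` is free: the initial density serves for consistency, the minimizer for the
rate. -/
theorem IsRegularKernel.ae_empKL_eq {Ω : Type*} {mΩ : MeasurableSpace Ω} {Pr : Measure Ω}
    [IsProbabilityMeasure Pr] {μ : Measure 𝒰} [SFinite μ] {ν : Measure 𝒴} {k : 𝒴 → 𝒰 → ℝ}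
    {m : 𝒴 → ℝ} {A : ℝ≥0} {f₀ : 𝒰 → ℝ} {w : ℕ → ℝ} {Y : ℕ → Ω → 𝒴} (hm : m ∈ Densities ν)
    (hk : IsRegularKernel k (ofDensity ν m) A (ofDensity μ f₀)) (hf₀ : f₀ ∈ Densities μ)
    (hw : ∀ n, w n ∈ Set.Ioo (0 : ℝ) 1) (hY : ∀ i, Measurable (Y i))
    (hlaw : ∀ i, Pr.map (Y i) = ofDensity ν m) (G : Measure 𝒰) [IsProbabilityMeasure G] :
    ∀ᵐ ω ∂Pr, ∀ n, empKL μ m k f₀ w (fun i => Y i ω) n =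
      (n : ℝ)⁻¹ * ∑ i ∈ Finset.range n, Real.log (m (Y i ω) / mixture k G (Y i ω)) +
      (n : ℝ)⁻¹ * ∑ i ∈ Finset.range n, (Real.log (mixture k G (Y i ω) /
          mixture k (prMeasure μ k f₀ w (fun j => Y j ω) i) (Y i ω)) -
        relEnt k (ofDensity ν m) G (prMeasure μ k f₀ w (fun j => Y j ω) i)) +
      (n : ℝ)⁻¹ * ∑ i ∈ Finset.range n,
        relEnt k (ofDensity ν m) G (prMeasure μ k f₀ w (fun j => Y j ω) i) := by
  have := isProbabilityMeasure_ofDensity hm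
  have := isProbabilityMeasure_ofDensity hf₀
  have h1 : ∀ᵐ ω ∂Pr, ∀ i, 0 < m (Y i ω) ∧ 0 < mixture k G (Y i ω) :=
    ae_all_iff.2 fun i => ae_of_ae_map (hY i).aemeasurable
      (p := fun y => 0 < m y ∧ 0 < mixture k G y) (by
        rw [hlaw]
        exact (ae_pos_ofDensity hm.1).and (hk.mixture_pos G))
  filter_upwards [h1, hk.ae_mem_goodPaths hY hlaw] with ω hω hgood n
  rw [← mul_add, ← mul_add, ← Finset.sum_add_distrib, ← Finset.sum_add_distrib, empKL]
  congr 1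
  refine Finset.sum_congr rfl fun i _ => ?_
  obtain ⟨hm0, hG0⟩ := hω i
  have hF0 := hk.mixture_prMeasure_pos hf₀ hw hgood i (hgood i)
  rw [← mixture_prMeasure hk.meas hk.nonneg hf₀.1 hf₀.2.1 hw, Real.log_div hm0.ne' hF0.ne',
    Real.log_div hm0.ne' hG0.ne', Real.log_div hG0.ne' hF0.ne']
  ring

section Optimum

variable [TopologicalSpace 𝒰] [OpensMeasurableSpace 𝒰] {μ : Measure 𝒰} {ν : Measure 𝒴}
  {k : 𝒴 → 𝒰 → ℝ} {m : 𝒴 → ℝ}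

theorem KLopt_le {F : ProbabilityMeasure 𝒰} (hF : F ∈ closedMixing μ) :
    KLopt μ ν m k ≤ KL ν m (mixture k (F : Measure 𝒰)) :=
  iInf₂_le F hF

theorem KLopt_toReal_le
    (hKL : ∀ F ∈ closedMixing μ, KL ν m (mixture k (F : Measure 𝒰)) < ∞) {f : 𝒰 → ℝ}
    (hf : f ∈ Densities μ) : KL ν m (mixture k (ofDensity μ f)) < ∞ ∧
      (KLopt μ ν m k).toReal ≤ (KL ν m (mixture k (ofDensity μ f))).toReal := by
  obtain ⟨F, hF, e⟩ := exists_mem_closedMixing hf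
  rw [← e]
  exact ⟨hKL F hF, ENNReal.toReal_mono (hKL F hF).ne (KLopt_le hF)⟩

end Optimum

/-! ### Consistency and rate. -/

section Convergence

variable {Ω : Type*} {mΩ : MeasurableSpace Ω} {Pr : Measure Ω} [IsProbabilityMeasure Pr]
  [TopologicalSpace 𝒰] [TopologicalSpace.MetrizableSpace 𝒰] [SecondCountableTopology 𝒰]
  [BorelSpace 𝒰] {μ : Measure 𝒰} [SigmaFinite μ] {ν : Measure 𝒴} [SigmaFinite ν]
  {k : 𝒴 → 𝒰 → ℝ} {m : 𝒴 → ℝ} {A : ℝ≥0} {f₀ : 𝒰 → ℝ} {w : ℕ → ℝ} {Y : ℕ → Ω → 𝒴}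

/-- The optimal divergence is approached by mixing measures comparable with `f₀`. -/
theorem IsRegularKernel.exists_hasLogBound_relEnt_le_KLopt (hm : m ∈ Densities ν)
    (hk : IsRegularKernel k (ofDensity ν m) A (ofDensity μ f₀))
    (hdens : ∀ u, (fun y => k y u) ∈ Densities ν) (hcont : ∀ y, Continuous (k y))
    (hf₀ : f₀ ∈ Densities μ) (hpos : ∀ᵐ u ∂μ, 0 < f₀ u)
    (hKL : ∀ F ∈ closedMixing μ, KL ν m (mixture k (F : Measure 𝒰)) < ∞) {ε : ℝ} (hε : 0 < ε) :
    ∃ Φ, IsProbabilityMeasure Φ ∧ (∃ C, HasLogBound μ f₀ Φ C) ∧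
      relEnt k (ofDensity ν m) (ofDensity μ f₀) Φ ≤
        (KLopt μ ν m k).toReal - (KL ν m (mixture k (ofDensity μ f₀))).toReal + ε := by
  have := isProbabilityMeasure_ofDensity hm
  have := isProbabilityMeasure_ofDensity hf₀
  obtain ⟨F₀, hF₀, e₀⟩ := exists_mem_closedMixing hf₀
  have hfin : KLopt μ ν m k ≠ ∞ := ((KLopt_le hF₀).trans_lt (hKL F₀ hF₀)).ne
  -- One third of `ε` each for nearly attaining the infimum, for replacing the closure point by a
  -- density, and for truncating that density against `f₀`.
  have hlt : KLopt μ ν m k < KLopt μ ν m k + ENNReal.ofReal (ε / 3) :=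
    ENNReal.lt_add_right hfin (by simpa using hε)
  obtain ⟨F, hF⟩ := iInf_lt_iff.1 hlt
  obtain ⟨hFmem, hFlt⟩ := iInf_lt_iff.1 hF
  have h1 : (KL ν m (mixture k (F : Measure 𝒰))).toReal ≤ (KLopt μ ν m k).toReal + ε / 3 := by
    have h := ENNReal.toReal_mono (ENNReal.add_ne_top.2 ⟨hfin, ENNReal.ofReal_ne_top⟩) hFlt.le
    rwa [ENNReal.toReal_add hfin ENNReal.ofReal_ne_top, ENNReal.toReal_ofReal (by positivity)] at h
  obtain ⟨f, hf, hfle⟩ := hk.exists_density_relEnt_le hcont hFmem (ε := ε / 3) (by positivity)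
  obtain ⟨Φ, hΦ, hC, hΦle⟩ := hk.exists_hasLogBound_relEnt_le hf₀ hpos hf (ε := ε / 3)
    (by positivity)
  have := isProbabilityMeasure_ofDensity hf
  refine ⟨Φ, hΦ, hC, ?_⟩
  have e1 := hk.relEnt_add (ofDensity μ f₀) (F : Measure 𝒰) Φ
  have e2 := hk.relEnt_add (F : Measure 𝒰) (ofDensity μ f) Φ
  have e3 := hk.relEnt_eq_sub hm hdens (ofDensity μ f₀) (F : Measure 𝒰)
    (by rw [← e₀]; exact hKL F₀ hF₀) (hKL F hFmem)
  linarith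

/-- Consistency of the predictive recursion marginal likelihood. -/
theorem IsRegularKernel.ae_tendsto_empKL (hm : m ∈ Densities ν)
    (hk : IsRegularKernel k (ofDensity ν m) A (ofDensity μ f₀))
    (hdens : ∀ u, (fun y => k y u) ∈ Densities ν) (hcont : ∀ y, Continuous (k y))
    (hf₀ : f₀ ∈ Densities μ) (hpos : ∀ᵐ u ∂μ, 0 < f₀ u)
    (hKL : ∀ F ∈ closedMixing μ, KL ν m (mixture k (F : Measure 𝒰)) < ∞)
    (hw : ∀ n, w n ∈ Set.Ioo (0 : ℝ) 1) (hsum : Tendsto (partialSum w) atTop atTop)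
    (hsq : Summable fun n => w n ^ 2) (hY : ∀ i, Measurable (Y i)) (hind : iIndepFun Y Pr)
    (hlaw : ∀ i, Pr.map (Y i) = ofDensity ν m) :
    ∀ᵐ ω ∂Pr, Tendsto (fun n => empKL μ m k f₀ w (fun i => Y i ω) n) atTop
      (𝓝 (KLopt μ ν m k).toReal) := by
  have := isProbabilityMeasure_ofDensity hm
  have := isProbabilityMeasure_ofDensity hf₀
  obtain ⟨hfin₀, -⟩ := KLopt_toReal_le hKL hf₀
  obtain ⟨-, hint₀, hKL₀⟩ := KL_toReal hm (hk.mixture_mem_densities hdens _) hfin₀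
  have hmeas : Measurable fun y => Real.log (m y / mixture k (ofDensity μ f₀) y) :=
    Real.measurable_log.comp (hm.1.div (hk.measurable_mixture _))
  have hslln := strong_law_ae_real
    (fun i ω => Real.log (m (Y i ω) / mixture k (ofDensity μ f₀) (Y i ω))) (μ := Pr)
    (by
      rw [← hlaw 0] at hint₀
      exact (integrable_map_measure hmeas.aestronglyMeasurable (hY 0).aemeasurable).1 hint₀)
    (fun i j hij => (hind.indepFun hij).comp hmeas hmeas)
    (fun i => IdentDistrib.comp ⟨(hY i).aemeasurable, (hY 0).aemeasurable, by
      rw [hlaw, hlaw]⟩ hmeas)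
  have hmean : ∫ ω, Real.log (m (Y 0 ω) / mixture k (ofDensity μ f₀) (Y 0 ω)) ∂Pr =
      (KL ν m (mixture k (ofDensity μ f₀))).toReal := by
    rw [hKL₀, ← hlaw 0, integral_map (hY 0).aemeasurable hmeas.aestronglyMeasurable]
  have hharm : Summable fun i : ℕ => (((i : ℝ) + 1)⁻¹) ^ 2 := by
    have h := (summable_nat_add_iff 1).2 (Real.summable_nat_pow_inv.2 one_lt_two)
    simpa using h
  have hdev := hk.ae_exists_tendsto_sum_log hf₀ hw hY hind hlaw (ofDensity μ f₀) hharm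
  have hrel := hk.ae_tendsto_relEnt hf₀ hw hsum hsq hY hind hlaw
    (L := (KLopt μ ν m k).toReal - (KL ν m (mixture k (ofDensity μ f₀))).toReal)
    (fun f hf => by
      have := isProbabilityMeasure_ofDensity hf
      obtain ⟨h1, h2⟩ := KLopt_toReal_le hKL hf
      rw [hk.relEnt_eq_sub hm hdens _ _ hfin₀ h1]
      linarith)
    (fun ε hε => hk.exists_hasLogBound_relEnt_le_KLopt hm hdens hcont hf₀ hpos hKL hε)
  filter_upwards [hslln, hdev, hrel, hk.ae_empKL_eq hm hf₀ hw hY hlaw (ofDensity μ f₀)]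
    with ω h1 ⟨l, h2⟩ h3 h4
  -- The limits are the divergence at `f₀`, then `0`, then the optimal divergence minus the one at
  -- `f₀`.
  have h := (h1.add (tendsto_mean_zero_of_tendsto_sum h2)).add h3.cesaro
  rw [hmean, add_zero, add_sub_cancel] at h
  refine h.congr fun n => ?_
  rw [h4 n, div_eq_inv_mul]

/-- Rate of convergence of the predictive recursion marginal likelihood. -/
theorem IsRegularKernel.ae_empKL_sub_isBigO (hm : m ∈ Densities ν)
    (hk : IsRegularKernel k (ofDensity ν m) A (ofDensity μ f₀))
    (hdens : ∀ u, (fun y => k y u) ∈ Densities ν) (hf₀ : f₀ ∈ Densities μ)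
    (hKL : ∀ F ∈ closedMixing μ, KL ν m (mixture k (F : Measure 𝒰)) < ∞)
    (hw : ∀ n, w n ∈ Set.Ioo (0 : ℝ) 1) (hsq : Summable fun n => w n ^ 2)
    (hY : ∀ i, Measurable (Y i)) (hind : iIndepFun Y Pr)
    (hlaw : ∀ i, Pr.map (Y i) = ofDensity ν m) {f : 𝒰 → ℝ} (hf : f ∈ Densities μ)
    (hopt : KL ν m (mixture k (ofDensity μ f)) = KLopt μ ν m k) (hfin : KL μ f f₀ < ∞) {B : ℝ≥0}
    (hB : ∫⁻ y, ENNReal.ofReal (Real.log (m y / mixture k (ofDensity μ f) y) ^ 2)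
      ∂(ofDensity ν m) ≤ B)
    (hanti : Antitone w) (haw : Summable fun n => partialSum w (n + 1) * w n ^ 2) :
    ∀ᵐ ω ∂Pr, (fun n => empKL μ m k f₀ w (fun i => Y i ω) n - (KLopt μ ν m k).toReal)
      =O[atTop] fun n => (partialSum w n)⁻¹ := by
  have := isProbabilityMeasure_ofDensity hm
  have := isProbabilityMeasure_ofDensity hf
  have := isProbabilityMeasure_ofDensity hf₀
  obtain ⟨y₀, -⟩ := hk.pos.exists
  obtain ⟨hfinf, -⟩ := KLopt_toReal_le hKL hf
  obtain ⟨-, -, hKLf⟩ := KL_toReal hm (hk.mixture_mem_densities hdens _) hfinf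
  set Φ := ofDensity μ f
  -- Multiplying an average of `n + 1` terms by `partialSum w (n + 1)` is multiplying their sum by
  -- `b n`. This weight is square summable by Hardy and nonincreasing because `w` is.
  set b : ℕ → ℝ := fun n => partialSum w (n + 1) / ((n : ℝ) + 1) with hb
  have hbsq : Summable fun n => b n ^ 2 := summable_partialSum_div_sq hsq
  have hw0 : ∀ n, 0 ≤ w n := fun n => (hw n).1.le
  have hapos : ∀ n, 0 < partialSum w (n + 1) := fun n => by
    rw [partialSum_succ]
    linarith [partialSum_nonneg hw0 n, (hw n).1]
  have hbpos : ∀ n, 0 < b n := fun n => div_pos (hapos n) (by positivity)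
  have hmeas : Measurable fun y => Real.log (m y / mixture k Φ y) :=
    Real.measurable_log.comp (hm.1.div (hk.measurable_mixture _))
  have hiid := ae_exists_tendsto_sum_pastPath hY hind hlaw y₀
    (φ := fun _ q => Real.log (m q.2 / mixture k Φ q.2)) (fun _ => hmeas.comp measurable_snd)
    (C := B) (fun _ => ae_of_all _ fun _ => hB) hbsq
  have hdev := hk.ae_exists_tendsto_sum_log hf₀ hw hY hind hlaw Φ hbsq
  have hrel := hk.ae_exists_partialSum_mul_sum_le hf₀ hw hsq hanti haw hY hind hlaw
    (hasLogBound_of_KL_lt_top hf₀ hf hfin) (fun g hg => by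
      have := isProbabilityMeasure_ofDensity hg
      obtain ⟨h1, h2⟩ := KLopt_toReal_le hKL hg
      rw [hk.relEnt_eq_sub hm hdens _ _ hfinf h1, hopt]
      linarith)
  have hnonneg : ∀ᵐ ω ∂Pr, ∀ i, 0 ≤
      relEnt k (ofDensity ν m) Φ (prMeasure μ k f₀ w (fun j => Y j ω) i) := by
    filter_upwards [hk.ae_mem_goodPaths hY hlaw] with ω hω i
    have hmem := (hk.prDensity_mem hf₀ hw hω i).1
    have := isProbabilityMeasure_ofDensity hmem
    obtain ⟨h1, h2⟩ := KLopt_toReal_le hKL hmem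
    rw [prMeasure, hk.relEnt_eq_sub hm hdens _ _ hfinf h1, hopt]
    linarith
  have habs : ∀ {x : ℕ → ℝ} {l : ℝ},
      Tendsto (fun n => ∑ i ∈ Finset.range n, b i * x i) atTop (𝓝 l) →
      ∃ S, ∀ n, |b n * ∑ i ∈ Finset.range (n + 1), x i| ≤ S := by
    intro x l hx
    obtain ⟨S, hS⟩ := hx.abs.bddAbove_range
    exact ⟨2 * S, abs_mul_sum_le_of_abs_sum_le hbpos (antitone_partialSum_div hanti)
      fun n => hS ⟨n, rfl⟩⟩
  filter_upwards [hiid, hdev, hrel, hnonneg, hk.ae_empKL_eq hm hf₀ hw hY hlaw Φ]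
    with ω ⟨l₁, h1⟩ ⟨l₂, h2⟩ ⟨M, h3⟩ h4 h5
  obtain ⟨S₁, hS₁⟩ := habs h1
  obtain ⟨S₂, hS₂⟩ := habs h2
  refine IsBigO.of_bound (S₁ + S₂ + M) ?_
  filter_upwards [eventually_gt_atTop 0] with n hn
  -- The index is shifted because `partialSum w 0 = 0`, while every later partial sum is positive.
  obtain ⟨n, rfl⟩ := Nat.exists_eq_succ_of_ne_zero hn.ne'
  rw [Nat.succ_eq_add_one, norm_inv, Real.norm_of_nonneg (hapos n).le, ← div_eq_mul_inv,
    le_div_iff₀ (hapos n), Real.norm_eq_abs, ← abs_of_pos (hapos n), ← abs_mul]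
  set κ : ℕ → ℝ := fun i =>
    relEnt k (ofDensity ν m) Φ (prMeasure μ k f₀ w (fun j => Y j ω) i)
  have hn1 : (0 : ℝ) < (n : ℝ) + 1 := by positivity
  have hκ0 : 0 ≤ b n * ∑ i ∈ Finset.range (n + 1), κ i :=
    mul_nonneg (hbpos n).le (Finset.sum_nonneg fun i _ => h4 i)
  have hκM : b n * ∑ i ∈ Finset.range (n + 1), κ i ≤ M := by
    have h := h3 (n + 1)
    rw [hb]
    simp only
    rw [div_mul_eq_mul_div, div_le_iff₀ hn1]
    push_cast at h
    exact h
  have e := h5 (n + 1)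
  have key : (empKL μ m k f₀ w (fun i => Y i ω) (n + 1) - (KLopt μ ν m k).toReal) *
      partialSum w (n + 1) =
      b n * ∑ i ∈ Finset.range (n + 1), (Real.log (m (Y i ω) / mixture k Φ (Y i ω)) -
        ∫ y, Real.log (m y / mixture k Φ y) ∂(ofDensity ν m)) +
      b n * ∑ i ∈ Finset.range (n + 1), (Real.log (mixture k Φ (Y i ω) /
          mixture k (prMeasure μ k f₀ w (fun j => Y j ω) i) (Y i ω)) - κ i) +
      b n * ∑ i ∈ Finset.range (n + 1), κ i := by
    rw [e, ← hKLf, hopt, Finset.sum_sub_distrib (s := Finset.range (n + 1))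
      (f := fun i => Real.log (m (Y i ω) / mixture k Φ (Y i ω)))]
    simp only [Finset.sum_const, Finset.card_range, nsmul_eq_mul, hb]
    push_cast
    field_simp
    ring
  rw [key]
  refine (abs_add_three _ _ _).trans ?_
  rw [abs_of_nonneg hκ0]
  exact add_le_add (add_le_add (hS₁ n) (hS₂ n)) hκM

end Convergence

end PredRec

theorem theorem2
    {Ω Θ 𝒰 𝒴 : Type*}
    [MeasurableSpace Ω] (Pr : Measure Ω) [IsProbabilityMeasure Pr]
    [TopologicalSpace 𝒰] [TopologicalSpace.MetrizableSpace 𝒰] [SecondCountableTopology 𝒰]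
    [MeasurableSpace 𝒰] [BorelSpace 𝒰] (μ : Measure 𝒰) [SigmaFinite μ]
    [MeasurableSpace 𝒴] (ν : Measure 𝒴) [SigmaFinite ν]
    -- the kernel `p(y | θ, u)`, a density in `y`
    (p : 𝒴 → Θ → 𝒰 → ℝ)
    (hp_meas : ∀ θ, Measurable fun z : 𝒴 × 𝒰 => p z.1 θ z.2)
    (hp_dens : ∀ θ u, (fun y => p y θ u) ∈ PredRec.Densities ν)
    -- the initial densities, positive almost everywhere
    (f₀ : Θ → 𝒰 → ℝ) (hf₀ : ∀ θ, f₀ θ ∈ PredRec.Densities μ)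
    (hf₀_pos : ∀ θ, ∀ᵐ u ∂μ, 0 < f₀ θ u)
    -- the weights
    (w : ℕ → ℝ) (hw : ∀ n, w n ∈ Set.Ioo (0 : ℝ) 1)
    -- independent observations with common density `m`; all divergences are finite
    (m : 𝒴 → ℝ) (hm : m ∈ PredRec.Densities ν)
    (Y : ℕ → Ω → 𝒴) (hY_meas : ∀ i, Measurable (Y i)) (hY_indep : iIndepFun Y Pr)
    (hY_law : ∀ i, Pr.map (Y i) = PredRec.ofDensity ν m)
    (hKL : ∀ θ, ∀ F ∈ PredRec.closedMixing μ,
      PredRec.KL ν m (PredRec.mixture (fun y => p y θ) (F : Measure 𝒰)) < ∞)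
    -- summability of the weights
    (hw_sum : Tendsto (PredRec.partialSum w) atTop atTop)
    (hw_sq : Summable fun n => w n ^ 2)
    -- compactness of the closed set of mixing measures
    (hcompact : IsCompact (PredRec.closedMixing μ))
    -- the kernel is bounded and continuous in `u`
    (hp_cont : ∀ y θ, Continuous (p y θ) ∧ ∃ C : ℝ, ∀ u, p y θ u ≤ C)
    -- uniform second moments of the kernel ratios (`a / 0 = ∞` for `a > 0` in `[0, ∞]`)
    (hbound1 : ∀ θ₁ θ₂, ∃ A : ℝ≥0, ∀ u₁ u₂,
      ∫⁻ y, (ENNReal.ofReal (p y θ₁ u₁) / ENNReal.ofReal (p y θ₂ u₂)) ^ 2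
        ∂(PredRec.ofDensity ν m) ≤ A)
    -- square-integrable log-ratio at the minimizer of the divergence
    (hbound2 : ∀ θ, ∃ B : ℝ≥0, ∀ F ∈ PredRec.closedMixing μ,
      PredRec.KL ν m (PredRec.mixture (fun y => p y θ) (F : Measure 𝒰)) =
        PredRec.KLopt μ ν m (fun y => p y θ) →
      ∫⁻ y, ENNReal.ofReal
        ((Real.log (m y / PredRec.mixture (fun y => p y θ) (F : Measure 𝒰) y)) ^ 2)
        ∂(PredRec.ofDensity ν m) ≤ B)
    (θ : Θ) :
    (∀ᵐ ω ∂Pr, Tendsto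
      (fun n => PredRec.empKL μ m (fun y => p y θ) (f₀ θ) w (fun i => Y i ω) n) atTop
      (𝓝 (PredRec.KLopt μ ν m (fun y => p y θ)).toReal)) ∧
    ( -- the infimum is attained at a density `f` with finite divergence from `f₀ θ`
      (∃ f ∈ PredRec.Densities μ,
        PredRec.KL ν m (PredRec.mixture (fun y => p y θ) (PredRec.ofDensity μ f)) =
          PredRec.KLopt μ ν m (fun y => p y θ) ∧
        PredRec.KL μ f (f₀ θ) < ∞) →
      Antitone w →
      (Summable fun n => PredRec.partialSum w (n + 1) * w n ^ 2) →
      ∀ᵐ ω ∂Pr,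
        (fun n => PredRec.empKL μ m (fun y => p y θ) (f₀ θ) w (fun i => Y i ω) n -
          (PredRec.KLopt μ ν m (fun y => p y θ)).toReal)
        =O[atTop] fun n => (PredRec.partialSum w n)⁻¹) := by

  have hm' := PredRec.isProbabilityMeasure_ofDensity hm
  obtain ⟨A, hA⟩ := hbound1 θ θ
  obtain ⟨B, hB⟩ := hbound2 θ
  obtain ⟨F₀, hF₀, e₀⟩ := PredRec.exists_mem_closedMixing (hf₀ θ)
  -- Under the zero measure the positivity and ratio conditions are void. This gives that mixtures
  -- are densities, and finiteness of the divergence at `f₀ θ` then yields positivity under the true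
  -- law.
  have hk₀ : PredRec.IsRegularKernel (fun y => p y θ) (0 : Measure 𝒴) A
      (PredRec.ofDensity μ (f₀ θ)) :=
    ⟨hp_meas θ, fun y u => (hp_dens θ u).2.1 y, fun y => (hp_cont y θ).2, by simp, by simp⟩
  have hpos : ∀ᵐ y ∂(PredRec.ofDensity ν m),
      0 < PredRec.mixture (fun y => p y θ) (PredRec.ofDensity μ (f₀ θ)) y := by
    have := PredRec.isProbabilityMeasure_ofDensity (hf₀ θ)
    refine (PredRec.KL_toReal hm (hk₀.mixture_mem_densities (hp_dens θ) _) ?_).1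
    rw [← e₀]
    exact hKL θ F₀ hF₀
  have hk : PredRec.IsRegularKernel (fun y => p y θ) (PredRec.ofDensity ν m) A
      (PredRec.ofDensity μ (f₀ θ)) :=
    ⟨hk₀.meas, hk₀.nonneg, hk₀.bdd, hA, hpos⟩
  refine ⟨hk.ae_tendsto_empKL hm (hp_dens θ) (fun y => (hp_cont y θ).1) (hf₀ θ) (hf₀_pos θ)
    (hKL θ) hw hw_sum hw_sq hY_meas hY_indep hY_law, ?_⟩
  rintro ⟨f, hf, hopt, hfin⟩ hanti haw
  obtain ⟨F, hF, e⟩ := PredRec.exists_mem_closedMixing hf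
  refine hk.ae_empKL_sub_isBigO hm (hp_dens θ) (hf₀ θ) (hKL θ) hw hw_sq hY_meas hY_indep hY_law
    hf hopt hfin (B := B) ?_ hanti haw
  rw [← e] at hopt ⊢
  exact hB F hF hopt
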